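/- Let $(M^4,g)$ and $(\overline M^4,\overline g)$ be two oriented and time-oriented four-dimensional spacetimes (smooth Lorentzian metrics of signature $(-,+,+,+)$, Levi-Civita connections $\nabla,\overline\nabla$), let $\iota:S\to M$ be an oriented closed (compact, without boundary) smoothly embedded spacelike surface, and let $N$ be a smooth future-directed timelike vector field of $M$ along $S$. A *reference* is a smooth embedding $\varphi:U\to\overline M$ of an open neighbourhood $U$ of $S$ in $M$ that preserves the orientation and the time-orientation; it is a *4D isometric matching reference* if $\varphi^*\overline g=g$ as forms on $T_pM$ for every $p\in S$. The Chen–Nester–Tung quasi-local energy of $S$ with respect to $N$ and a reference $\varphi$ is, with $\kappa=8\pi$, $$E(S,N,\varphi)=\frac1{2\kappa}\int_S\iota^*\Big[(\omega^a{}_b-\overline\omega^a{}_b)\wedge i_N\eta_a{}^b+\overline D_bN^a\,(\eta_a{}^b-\overline\eta_a{}^b)\Big],\qquad \eta_a{}^b=\tfrac12\sqrt{-\det g}\;g^{b\beta}\epsilon_{a\beta\mu\nu}\,dx^\mu\wedge dx^\nu ,$$ in positively oriented coordinates ($\epsilon_{0123}=1$), summed over $a,b$. Here $\omega^a{}_b$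 are the connection forms of the Levi-Civita connection of $g$, the quantities $\overline\omega^a{}_b$, $\overline\eta_a{}^b$, $\overline D$ are those of $\varphi^*\overline g$ in the same frame, and $\overline D_bN^a$ is formed with an extension of $N$ to a neighbourhood of $S$. Let $N^\perp$ be the orthogonal projection of $N$ to the normal bundle $T^\perp_SM$, $N^\top=N-N^\perp$, and let $X$ be the smooth unit vector field along $S$ that is normal to $S$ and orthogonal to $N$, and for which $N^\perp$, $X$ followed by a positively oriented frame of $S$ is a positively oriented frame of $M$. Let $\varphi$ be a 4D isometric matching reference, and put $\overline S=\varphi(S)$, $\overline X=\varphi_*X$, $\overline N^\perp=\varphi_*N^\perp$, $\overline N^\top=\varphi_*N^\top$. Let $H$ and $\overline H$ be the mean curvature vectors (traces of the second fundamental forms) of $S$ in $M$ and of $\overline S$ in $\overline M$, and $\|v\|=\sqrt{|\langle v,v\rangle|}$. Then, for every extension of $N$, $$E(S,N,\varphi)=\frac1{8\pi}\int_{\overline S}\Big(-\|\overline N^\perp\|\langle\overline H,\overline X\rangle+\frac1{\|\overline N^\perp\|}\langle\overline\nabla_{\overline N^\top}\overline X,\overline N^\perp\rangle\Big)dV_{\overline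 S}-\frac1{8\pi}\int_S\Big(-\|N^\perp\|\langle H,X\rangle+\frac1{\|N^\perp\|}\langle\nabla_{N^\top}X,N^\perp\rangle\Big)dV_S .$$ In particular, if $N$ is orthogonal to $S$, then $$E(S,N,\varphi)=\frac1{8\pi}\int_S\|N\|\big(-\langle\overline H,\overline X\rangle+\langle H,X\rangle\big)\,dV_S ,$$ where $\overline H$ and $\overline X$ at $p\in S$ stand for their values at $\varphi(p)$. -/

import Mathlib

open Set Filter Topology MeasureTheory
open scoped Manifold ContDiff BigOperators

noncomputable section

namespace CNT

/-! ### Coordinates, frames and orientations -/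

section Coordinates

variable {n : ℕ} {M : Type*} [TopologicalSpace M] [ChartedSpace (EuclideanSpace ℝ (Fin n)) M]

/-- The components `(dx⁰(v), …, dxⁿ⁻¹(v))` of a tangent vector `v ∈ T_x M` in the chart `x⁰, …, xⁿ⁻¹`
centred at `c`. Used for `x` in the domain of that chart. -/
def comps (c x : M) : TangentSpace (𝓡 n) x →L[ℝ] EuclideanSpace ℝ (Fin n) :=
  mfderiv (𝓡 n) 𝓘(ℝ, EuclideanSpace ℝ (Fin n)) (extChartAt (𝓡 n) c) x

/-- The coordinate vector `∂_i` at `x` of the chart centred at `c`, that is, the vector with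
`dx^j(∂_i) = δ_i^j`. Used for `x` in the domain of that chart. -/
def coordFrame (c x : M) (i : Fin n) : TangentSpace (𝓡 n) x :=
  (comps c x).inverse (EuclideanSpace.single i (1 : ℝ))

/-- The frame `v` of the vector space `V` is a basis and is positively oriented. -/
def IsPositiveFrame {V : Type*} [AddCommGroup V] [Module ℝ V]
    (o : Orientation ℝ V (Fin n)) (v : Fin n → V) : Prop :=
  ∃ b : Module.Basis (Fin n) ℝ V, (∀ i, b i = v i) ∧ b.orientation = o

variable (n M) in
/-- An orientation of an `n`-manifold: an orientation of every tangent space, such that in every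
chart the property that the coordinate frame is positively oriented is locally constant. -/
structure ManifoldOrientation where
  /-- the orientation of `T_x M` -/
  at' : ∀ x : M, Orientation ℝ (TangentSpace (𝓡 n) x) (Fin n)
  locallyConstant : ∀ c : M, ∀ x ∈ (chartAt (EuclideanSpace ℝ (Fin n)) c).source, ∀ᶠ y in 𝓝 x,
    (IsPositiveFrame (at' y) (coordFrame c y) ↔ IsPositiveFrame (at' x) (coordFrame c x))

open Classical in
/-- `1` if the coordinate frame at `x` of the chart centred at `c` is positively oriented,
`-1` otherwise. -/
def ManifoldOrientation.sign (o : ManifoldOrientation n M) (c x : M) : ℝ :=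
  if IsPositiveFrame (o.at' x) (coordFrame c x) then 1 else -1

variable (n M) in
/-- Fields of (bilinear) forms on the tangent spaces, not necessarily smooth. -/
abbrev FormField := ∀ x : M, TangentSpace (𝓡 n) x → TangentSpace (𝓡 n) x → ℝ

/-- The matrix `(g_ij) = (g(∂_i, ∂_j))` at `x` in the chart centred at `c`. -/
def gram (g : FormField n M) (c x : M) : Matrix (Fin n) (Fin n) ℝ :=
  Matrix.of fun i j => g x (coordFrame c x i) (coordFrame c x j)

/-- The partial derivative `∂_i f` at `x` of a function `f` in the chart centred at `c`. -/
def partialDeriv (c : M) (i : Fin n) (f : M → ℝ) (x : M) : ℝ :=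
  fderiv ℝ (fun y => f ((extChartAt (𝓡 n) c).symm y)) (extChartAt (𝓡 n) c x)
    (EuclideanSpace.single i (1 : ℝ))

/-- The Christoffel symbols `Γ^a_{m b}` of the Levi-Civita connection of `g`, at `x` in the chart
centred at `c`: `∇_{∂_m} ∂_b = Γ^a_{m b} ∂_a`. -/
def christoffel (g : FormField n M) (c x : M) (a m b : Fin n) : ℝ :=
  (1 / 2) * ∑ d, (gram g c x)⁻¹ a d *
    (partialDeriv c m (fun z => gram g c z d b) x
      + partialDeriv c b (fun z => gram g c z d m) x
      - partialDeriv c d (fun z => gram g c z m b) x)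

/-- The connection forms `ω^a_b = Γ^a_{m b} dx^m` of the Levi-Civita connection of `g` with respect
to the coordinate frame of the chart centred at `c`, applied to `u ∈ T_x M`:
`∇_u ∂_b = ω^a_b(u) ∂_a`. -/
def connForm (g : FormField n M) (c x : M) (a b : Fin n) (u : TangentSpace (𝓡 n) x) : ℝ :=
  ∑ m, christoffel g c x a m b * comps c x u m

/-- The components `D_b N^a = ∂_b N^a + Γ^a_{b d} N^d` of the covariant derivative of a vector
field `N` with respect to the Levi-Civita connection of `g`. -/
def covDerivComp (g : FormField n M) (N : ∀ x : M, TangentSpace (𝓡 n) x) (c x : M)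
    (b a : Fin n) : ℝ :=
  partialDeriv c b (fun z => comps c z (N z) a) x
    + ∑ d, christoffel g c x a b d * comps c x (N x) d

end Coordinates

/-! ### Geometry of maps between manifolds -/

section Maps

variable {k n : ℕ} {S : Type*} [TopologicalSpace S] [ChartedSpace (EuclideanSpace ℝ (Fin k)) S]
  {M : Type*} [TopologicalSpace M] [ChartedSpace (EuclideanSpace ℝ (Fin n)) M]

/-- The pullback `F^* g`. -/
def pullback (F : S → M) (g : FormField n M) : FormField k S := fun p u v =>
  g (F p) (mfderiv (𝓡 k) (𝓡 n) F p u) (mfderiv (𝓡 k) (𝓡 n) F p v)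

/-- The covariant derivative `∇_v Y` (Levi-Civita connection of `g`) of a vector field `Y` along
the map `F`, for `v ∈ T_p S`, computed in the chart of `M` centred at `F p`:
`(∇_v Y)^a = v(Y^a) + Γ^a_{m b} dF(v)^m Y^b`. -/
def covAlong (g : FormField n M) (F : S → M) (Y : ∀ q : S, TangentSpace (𝓡 n) (F q)) (p : S)
    (v : TangentSpace (𝓡 k) p) : TangentSpace (𝓡 n) (F p) :=
  ∑ a, (mvfderiv (𝓡 k) (fun q : S => comps (F p) (F q) (Y q) a) p v
      + ∑ b, connForm g (F p) (F p) a b (mfderiv (𝓡 k) (𝓡 n) F p v)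
          * comps (F p) (F p) (Y p) b) • coordFrame (F p) (F p) a

/-- The tangential part of `v ∈ T_{F p} M` along an immersion `F` with non-degenerate induced metric
`h = F^* g`, as a vector of `T_p S`: `h^{ij} g(v, dF ∂_j) ∂_i`. -/
def tangentialPart (g : FormField n M) (F : S → M) (p : S) (v : TangentSpace (𝓡 n) (F p)) :
    TangentSpace (𝓡 k) p :=
  ∑ i, ∑ j, ((gram (pullback (k := k) F g) p p)⁻¹ i j
    * g (F p) v (mfderiv (𝓡 k) (𝓡 n) F p (coordFrame p p j))) • coordFrame p p i

/-- The orthogonal projection `v^⊥` of `v ∈ T_{F p} M` to the normal space of `F` at `p`. -/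
def normalPart (k : ℕ) [ChartedSpace (EuclideanSpace ℝ (Fin k)) S]
    (g : FormField n M) (F : S → M) (p : S) (v : TangentSpace (𝓡 n) (F p)) :
    TangentSpace (𝓡 n) (F p) :=
  v - mfderiv (𝓡 k) (𝓡 n) F p (tangentialPart g F p v)

/-- The mean curvature vector `H = h^{ij} (∇_{∂_i} (dF ∂_j))^⊥`, the trace with respect to the
induced metric `h = F^* g` of the second fundamental form of `F`. -/
def meanCurvature (k : ℕ) [ChartedSpace (EuclideanSpace ℝ (Fin k)) S]
    (g : FormField n M) (F : S → M) (p : S) : TangentSpace (𝓡 n) (F p) :=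
  ∑ i, ∑ j, (gram (pullback (k := k) F g) p p)⁻¹ i j •
    normalPart k g F p
      (covAlong g F (fun q => mfderiv (𝓡 k) (𝓡 n) F q (coordFrame p q j)) p (coordFrame p p i))

/-- `‖v‖ = |g(v, v)|^{1/2}`. -/
def lnorm (g : FormField n M) {x : M} (v : TangentSpace (𝓡 n) x) : ℝ := Real.sqrt |g x v v|

end Maps

/-! ### Integration over surfaces -/

section Integration

variable {S : Type*} [TopologicalSpace S] [ChartedSpace (EuclideanSpace ℝ (Fin 2)) S]
  [IsManifold (𝓡 2) ∞ S] [T2Space S] [SigmaCompactSpace S]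

variable (S) in
/-- A smooth partition of unity subordinate to the cover of the surface `S` by its charts. -/
def chartPartition : SmoothPartitionOfUnity S (𝓡 2) S univ :=
  (SmoothPartitionOfUnity.exists_isSubordinate_chartAt_source (𝓡 2) S).choose

variable (S) in
theorem chartPartition_isSubordinate :
    (chartPartition S).IsSubordinate
      (fun c => (chartAt (EuclideanSpace ℝ (Fin 2)) c).source) :=
  (SmoothPartitionOfUnity.exists_isSubordinate_chartAt_source (𝓡 2) S).choose_spec

/-- The integral `∫_S α` of a (continuous) 2-form `α` over the oriented compact surface `S`: the sum
over the charts of the integrals of `ρ_c α(∂_1, ∂_2) dx¹ dx²`, with a minus sign where the chart is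
negatively oriented. -/
def integralForm (o : ManifoldOrientation 2 S) (α : FormField 2 S) : ℝ :=
  ∑ᶠ c : S, ∫ y in (extChartAt (𝓡 2) c).target,
    chartPartition S c ((extChartAt (𝓡 2) c).symm y)
      * o.sign c ((extChartAt (𝓡 2) c).symm y)
      * α ((extChartAt (𝓡 2) c).symm y) (coordFrame c ((extChartAt (𝓡 2) c).symm y) 0)
          (coordFrame c ((extChartAt (𝓡 2) c).symm y) 1)

/-- The integral `∫_S f dV` of a (continuous) function `f` over the compact surface `S` with respect
to the area element `dV = (det h_ij)^{1/2} dx¹ dx²` of the Riemannian metric `h`. -/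
def integralArea (h : FormField 2 S) (f : S → ℝ) : ℝ :=
  ∑ᶠ c : S, ∫ y in (extChartAt (𝓡 2) c).target,
    chartPartition S c ((extChartAt (𝓡 2) c).symm y)
      * f ((extChartAt (𝓡 2) c).symm y)
      * Real.sqrt (gram h c ((extChartAt (𝓡 2) c).symm y)).det

end Integration

/-! ### Spacetimes -/

section Spacetimes

variable (M : Type*) [TopologicalSpace M] [ChartedSpace (EuclideanSpace ℝ (Fin 4)) M]
  [IsManifold (𝓡 4) ∞ M]

/-- An oriented and time-oriented four-dimensional spacetime structure on the manifold `M`: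
a smooth Lorentzian metric of signature `(-,+,+,+)`, an orientation, and a time-orientation, given
by a continuous timelike vector field `time`. -/
structure Spacetime where
  /-- the Lorentzian metric -/
  metric : ∀ x : M, TangentSpace (𝓡 4) x →L[ℝ] TangentSpace (𝓡 4) x →L[ℝ] ℝ
  smooth : ContMDiff (𝓡 4)
    ((𝓡 4).prod 𝓘(ℝ, EuclideanSpace ℝ (Fin 4) →L[ℝ] EuclideanSpace ℝ (Fin 4) →L[ℝ] ℝ)) ∞
    (fun x => Bundle.TotalSpace.mk'
      (EuclideanSpace ℝ (Fin 4) →L[ℝ] EuclideanSpace ℝ (Fin 4) →L[ℝ] ℝ)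
      (E := fun x : M => TangentSpace (𝓡 4) x →L[ℝ] TangentSpace (𝓡 4) x →L[ℝ] ℝ) x (metric x))
  symm : ∀ (x : M) (u v : TangentSpace (𝓡 4) x), metric x u v = metric x v u
  lorentzian : ∀ x : M, ∃ b : Module.Basis (Fin 4) ℝ (TangentSpace (𝓡 4) x), ∀ i j,
    metric x (b i) (b j) = if i = j then (if i = 0 then -1 else 1) else 0
  /-- the orientation -/
  orientation : ManifoldOrientation 4 M
  /-- the timelike vector field that determines the future -/
  time : ∀ x : M, TangentSpace (𝓡 4) x
  continuous_time : Continuous fun x => (⟨x, time x⟩ : TangentBundle (𝓡 4) M)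
  time_timelike : ∀ x : M, metric x (time x) (time x) < 0

variable {M}

/-- The metric as a field of forms. -/
def Spacetime.g (𝓜 : Spacetime M) : FormField 4 M := fun x u v => 𝓜.metric x u v

/-- The vector `v` is timelike. -/
def Spacetime.IsTimelike (𝓜 : Spacetime M) {x : M} (v : TangentSpace (𝓡 4) x) : Prop :=
  𝓜.g x v v < 0

/-- The vector `v` is timelike and future-directed. -/
def Spacetime.IsFutureTimelike (𝓜 : Spacetime M) {x : M} (v : TangentSpace (𝓡 4) x) : Prop :=
  𝓜.g x v v < 0 ∧ 𝓜.g x v (𝓜.time x) < 0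

/-- The Levi-Civita symbol `ε_{a b m s}`, with `ε_{0123} = 1`. -/
def leviCivita (a b m s : Fin 4) : ℝ :=
  Matrix.det (Matrix.of fun r t : Fin 4 => if ![a, b, m, s] r = t then (1 : ℝ) else 0)

/-- The 2-forms `η_a^b = (1/2) (-det g)^{1/2} g^{b d} ε_{a d m s} dx^m ∧ dx^s` of the metric `g`,
applied to `u, v ∈ T_x M`, in the chart centred at `c`. The formula is the one for a positively
oriented chart; in a negatively oriented chart `ε` changes its sign. -/
def etaForm (o : ManifoldOrientation 4 M) (g : FormField 4 M) (c x : M) (a b : Fin 4)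
    (u v : TangentSpace (𝓡 4) x) : ℝ :=
  (1 / 2) * o.sign c x * Real.sqrt (-(gram g c x).det) *
    ∑ d, ∑ m, ∑ s, (gram g c x)⁻¹ b d * leviCivita a d m s *
      (comps c x u m * comps c x v s - comps c x u s * comps c x v m)

/-- The 2-form `(ω^a_b - ω̄^a_b) ∧ i_N η_a^b + D̄_b N^a (η_a^b - η̄_a^b)` on a neighbourhood of the
surface, applied to `u, v ∈ T_x M`, in the chart centred at `x`. The barred quantities belong to the
metric `gbar`, the others to the metric `g`. -/
def cntForm (o : ManifoldOrientation 4 M) (g gbar : FormField 4 M)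
    (N : ∀ x : M, TangentSpace (𝓡 4) x) : FormField 4 M := fun x u v =>
  ∑ a, ∑ b,
    ((connForm g x x a b u - connForm gbar x x a b u) * etaForm o g x x a b (N x) v
      - (connForm g x x a b v - connForm gbar x x a b v) * etaForm o g x x a b (N x) u
      + covDerivComp gbar N x x b a
          * (etaForm o g x x a b u v - etaForm o gbar x x a b u v))

variable {M' : Type*} [TopologicalSpace M'] [ChartedSpace (EuclideanSpace ℝ (Fin 4)) M']
  [IsManifold (𝓡 4) ∞ M']

/-- `φ`, restricted to `U`, is a reference for the subset `K` of the physical spacetime `𝓜` in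
the reference spacetime `𝓜'`: `U` is an open neighbourhood of `K`, and `φ` is a smooth embedding of
`U` that preserves the orientation and the time-orientation. -/
structure IsReference (𝓜 : Spacetime M) (𝓜' : Spacetime M') (K U : Set M) (φ : M → M') :
    Prop where
  isOpen : IsOpen U
  subset : K ⊆ U
  smooth : ContMDiffOn (𝓡 4) (𝓡 4) ∞ φ U
  immersion : ∀ x ∈ U, Function.Injective (mfderiv (𝓡 4) (𝓡 4) φ x)
  embedding : IsEmbedding (U.domRestrict φ)
  orientation : ∀ x ∈ U, ∀ v : Fin 4 → TangentSpace (𝓡 4) x,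
    IsPositiveFrame (𝓜.orientation.at' x) v →
      IsPositiveFrame (𝓜'.orientation.at' (φ x)) (fun i => mfderiv (𝓡 4) (𝓡 4) φ x (v i))
  time : ∀ x ∈ U, ∀ v : TangentSpace (𝓡 4) x, 𝓜.IsFutureTimelike v →
    𝓜'.IsTimelike (mfderiv (𝓡 4) (𝓡 4) φ x v) →
      𝓜'.IsFutureTimelike (mfderiv (𝓡 4) (𝓡 4) φ x v)

/-- A 4D isometric matching reference: a reference with `φ^* ḡ = g` at the points of `K` (as forms
on the four-dimensional tangent spaces). -/
structure IsIsometricMatching (𝓜 : Spacetime M) (𝓜' : Spacetime M') (K U : Set M) (φ : M → M') :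
    Prop extends IsReference 𝓜 𝓜' K U φ where
  matching : ∀ x ∈ K, ∀ u v : TangentSpace (𝓡 4) x, pullback φ 𝓜'.g x u v = 𝓜.g x u v

variable {S : Type*} [TopologicalSpace S] [ChartedSpace (EuclideanSpace ℝ (Fin 2)) S]
  [IsManifold (𝓡 2) ∞ S] [T2Space S] [SigmaCompactSpace S]

/-- The Chen-Nester-Tung quasi-local energy (with `κ = 8π`)
`E = (1/2κ) ∫_S ι^*[(ω^a_b - ω̄^a_b) ∧ i_N η_a^b + D̄_b N^a (η_a^b - η̄_a^b)]`
of the surface `ι : S → M` with respect to the displacement field `N`, given on `M` (only its germ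
along the surface matters), and the reference `φ`. The barred quantities belong to `φ^* ḡ`. -/
def energy (𝓜 : Spacetime M) (𝓜' : Spacetime M') (o : ManifoldOrientation 2 S) (ι : S → M)
    (N : ∀ x : M, TangentSpace (𝓡 4) x) (φ : M → M') : ℝ :=
  1 / (2 * (8 * Real.pi)) *
    integralForm o
      (pullback ι (cntForm 𝓜.orientation 𝓜.g (pullback φ 𝓜'.g) N))

/-- The integrand `-‖n‖ ⟨H, X⟩ + ‖n‖⁻¹ ⟨∇_w X, n⟩` for the surface `F : S → M` with mean curvature
vector `H`, a tangent vector `w ∈ T_p S`, a normal vector `n` at `p` and a vector field `X` along the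
surface. -/
def boundaryDensity (𝓜 : Spacetime M) (F : S → M) (X : ∀ q : S, TangentSpace (𝓡 4) (F q)) (p : S)
    (n : TangentSpace (𝓡 4) (F p)) (w : TangentSpace (𝓡 2) p) : ℝ :=
  -lnorm 𝓜.g n * 𝓜.g (F p) (meanCurvature 2 𝓜.g F p) (X p)
    + 1 / lnorm 𝓜.g n * 𝓜.g (F p) (covAlong 𝓜.g F X p w) n

end Spacetimes

end CNT

/-!
Naturality of the Levi-Civita connection under `φ` replaces the reference spacetime by the metric
`g' = φ^* ḡ` on a neighbourhood of the surface. Since `g = g'` on `T_p M` for `p ∈ S`, the forms `η`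
and `η̄` agree there, so the second term of the energy vanishes, and for `v` tangent to `S` the
difference of the connection matrices `(ω - ω̄)(v)` is skew with respect to `g`. In a frame
`(N^⊥, X, ∂₁, ∂₂)` adapted to `S`, the contraction of a skew matrix with the volume form is a sum of
two kinds of terms: the `(X, ∂_i)` entries, whose trace is the difference of the `⟨H, X⟩` because
`⟨X, ∂_i⟩ = 0` along `S`, and the `(X, N^⊥)` entry in the direction `N^⊤`, which is the difference
of the `⟨∇_{N^⊤} X, N^⊥⟩`. The factor `√(-det g)` times the determinant of the frame is
`‖N^⊥‖ √(det h)` up to sign, where `h` is the induced metric; the orientations fix the sign. So the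
energy density is pointwise the difference of the two boundary densities, and their continuity
allows the integral to be split.
-/

noncomputable section

namespace CNT

local notation "𝔼" n:max => EuclideanSpace ℝ (Fin n)

section CoordinateCalculus

variable {k n : ℕ} {M : Type*} [TopologicalSpace M] [ChartedSpace (𝔼 n) M]
  {S : Type*} [TopologicalSpace S] [ChartedSpace (𝔼 k) S]
  {V : Type*} [NormedAddCommGroup V] [NormedSpace ℝ V] {c x : M}

theorem mem_extChartAt_source_of_mem_chart_source (hx : x ∈ (chartAt (𝔼 n) c).source) :
    x ∈ (extChartAt (𝓡 n) c).source := by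
  rwa [extChartAt_source]

theorem extChartAt_symm_extChartAt (hx : x ∈ (chartAt (𝔼 n) c).source) :
    (extChartAt (𝓡 n) c).symm (extChartAt (𝓡 n) c x) = x :=
  (extChartAt (𝓡 n) c).left_inv (mem_extChartAt_source_of_mem_chart_source hx)

theorem eventually_extChartAt_symm_extChartAt (hx : x ∈ (chartAt (𝔼 n) c).source) :
    ∀ᶠ z in 𝓝 x, (extChartAt (𝓡 n) c).symm (extChartAt (𝓡 n) c z) = z := by
  filter_upwards [(chartAt (𝔼 n) c).open_source.mem_nhds hx] with z hz
  exact extChartAt_symm_extChartAt hz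

theorem tendsto_extChartAt_symm (hx : x ∈ (chartAt (𝔼 n) c).source) :
    Tendsto (extChartAt (𝓡 n) c).symm (𝓝 (extChartAt (𝓡 n) c x)) (𝓝 x) := by
  have h := continuousAt_extChartAt_symm' (mem_extChartAt_source_of_mem_chart_source hx)
  rwa [ContinuousAt, extChartAt_symm_extChartAt hx] at h

variable [IsManifold (𝓡 n) ∞ M]

theorem isInvertible_comps (hx : x ∈ (chartAt (𝔼 n) c).source) :
    (comps (n := n) c x).IsInvertible :=
  isInvertible_mfderiv_extChartAt (mem_extChartAt_source_of_mem_chart_source hx)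

theorem comps_coordFrame (hx : x ∈ (chartAt (𝔼 n) c).source) (i : Fin n) :
    comps c x (coordFrame c x i) = EuclideanSpace.single i 1 :=
  (isInvertible_comps hx).self_apply_inverse _

theorem sum_comps_smul_coordFrame (hx : x ∈ (chartAt (𝔼 n) c).source)
    (v : TangentSpace (𝓡 n) x) : ∑ a, comps c x v a • coordFrame c x a = v := by
  apply (isInvertible_comps hx).injective
  ext b
  simp [comps_coordFrame hx, Finset.sum_apply, Pi.single_apply]

theorem comps_mfderiv {F : S → M} {p : S} (hF : MDifferentiableAt (𝓡 k) (𝓡 n) F p)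
    (hc : F p ∈ (chartAt (𝔼 n) c).source) (v : TangentSpace (𝓡 k) p) :
    comps c (F p) (mfderiv (𝓡 k) (𝓡 n) F p v)
      = mvfderiv (𝓡 k) (fun q => extChartAt (𝓡 n) c (F q)) p v :=
  (mfderiv_comp_apply p (mdifferentiableAt_extChartAt hc) hF v).symm

theorem mdifferentiableAt_extChartAt_symm (hx : x ∈ (chartAt (𝔼 n) c).source) :
    MDifferentiableAt 𝓘(ℝ, 𝔼 n) (𝓡 n) (extChartAt (𝓡 n) c).symm (extChartAt (𝓡 n) c x) := by
  have h := mdifferentiableWithinAt_extChartAt_symm (I := 𝓡 n) (x := c)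
    ((extChartAt (𝓡 n) c).map_source (mem_extChartAt_source_of_mem_chart_source hx))
  rwa [ModelWithCorners.range_eq_univ, mdifferentiableWithinAt_univ] at h

theorem differentiableAt_comp_extChartAt_symm {f : M → V}
    (hf : MDifferentiableAt (𝓡 n) 𝓘(ℝ, V) f x) (hx : x ∈ (chartAt (𝔼 n) c).source) :
    DifferentiableAt ℝ (fun y => f ((extChartAt (𝓡 n) c).symm y)) (extChartAt (𝓡 n) c x) :=
  (MDifferentiableAt.comp (g := f) _ (by rwa [extChartAt_symm_extChartAt hx])
    (mdifferentiableAt_extChartAt_symm hx)).differentiableAt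

theorem mvfderiv_eq_fderiv {f : M → V} (hf : MDifferentiableAt (𝓡 n) 𝓘(ℝ, V) f x)
    (hx : x ∈ (chartAt (𝔼 n) c).source) (v : TangentSpace (𝓡 n) x) :
    mvfderiv (𝓡 n) f x v
      = fderiv ℝ (fun y => f ((extChartAt (𝓡 n) c).symm y)) (extChartAt (𝓡 n) c x)
          (comps c x v) := by
  have hchain := mfderiv_comp_apply x
    (differentiableAt_comp_extChartAt_symm hf hx).mdifferentiableAt
    (mdifferentiableAt_extChartAt hx) v
  rw [mfderiv_eq_fderiv] at hchain
  have heq : f =ᶠ[𝓝 x] (fun y => f ((extChartAt (𝓡 n) c).symm y)) ∘ extChartAt (𝓡 n) c := by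
    filter_upwards [eventually_extChartAt_symm_extChartAt hx] with z hz
    rw [Function.comp_apply, hz]
  exact (congrArg (fun L : TangentSpace (𝓡 n) x →L[ℝ] V => L v) heq.mfderiv_eq).trans hchain

end CoordinateCalculus

section LinearCalculus

variable {X E F : Type*} [NormedAddCommGroup X] [NormedSpace ℝ X]
  [NormedAddCommGroup E] [NormedSpace ℝ E] [NormedAddCommGroup F] [NormedSpace ℝ F]

theorem clm_ext_single {n : ℕ} {L L' : 𝔼 n →L[ℝ] F}
    (h : ∀ i, L (EuclideanSpace.single i 1) = L' (EuclideanSpace.single i 1)) : L = L' := by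
  have hlin : L.toLinearMap = L'.toLinearMap :=
    (EuclideanSpace.basisFun (Fin n) ℝ).toBasis.ext fun i => by simpa using h i
  ext1 u
  exact LinearMap.congr_fun hlin u

theorem fderiv_clm_apply_const {f : X → E →L[ℝ] F} {y : X} (hf : DifferentiableAt ℝ f y) (u : E)
    (w : X) : fderiv ℝ (fun y => f y u) y w = fderiv ℝ f y w u := by
  rw [(hf.hasFDerivAt.clm_apply (hasFDerivAt_const u y)).fderiv]
  simp

theorem fderiv_comp_clm_apply {f : E → E →L[ℝ] F} {c u : X → E} {y w : X}
    (hf : DifferentiableAt ℝ f (c y)) (hc : DifferentiableAt ℝ c y) (hu : DifferentiableAt ℝ u y) :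
    fderiv ℝ (fun y => f (c y) (u y)) y w
      = fderiv ℝ f (c y) (fderiv ℝ c y w) (u y) + f (c y) (fderiv ℝ u y w) := by
  have h : HasFDerivAt (fun y => f (c y) (u y)) _ y :=
    (hf.hasFDerivAt.comp y hc.hasFDerivAt).clm_apply hu.hasFDerivAt
  rw [h.fderiv]
  exact add_comm _ _

theorem fderiv_comp_bilin_apply {f : E → E →L[ℝ] E →L[ℝ] F} {c u v : X → E} {y w : X}
    (hf : DifferentiableAt ℝ f (c y)) (hc : DifferentiableAt ℝ c y)
    (hu : DifferentiableAt ℝ u y) (hv : DifferentiableAt ℝ v y) :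
    fderiv ℝ (fun y => f (c y) (u y) (v y)) y w
      = fderiv ℝ f (c y) (fderiv ℝ c y w) (u y) (v y)
        + f (c y) (fderiv ℝ u y w) (v y) + f (c y) (u y) (fderiv ℝ v y w) := by
  have hfu : DifferentiableAt ℝ (fun y => f (c y) (u y)) y :=
    (DifferentiableAt.comp (g := f) y hf hc).clm_apply hu
  rw [(hfu.hasFDerivAt.clm_apply hv.hasFDerivAt).fderiv]
  simp only [add_apply, ContinuousLinearMap.comp_apply, ContinuousLinearMap.flip_apply]
  rw [fderiv_comp_clm_apply hf hc hu, add_apply]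
  abel

end LinearCalculus

section MetricInCoordinates

open Matrix

variable {n : ℕ} {M : Type*} [TopologicalSpace M] [ChartedSpace (𝔼 n) M]

/-- The form field `g` is bilinear at `x`; a `FormField` is just a family of functions. -/
def IsBilinAt (g : FormField n M) (x : M) : Prop :=
  ∃ B : TangentSpace (𝓡 n) x →ₗ[ℝ] TangentSpace (𝓡 n) x →ₗ[ℝ] ℝ, ∀ u v, g x u v = B u v

/-- The coordinate expression `g_ij dx^i ⊗ dx^j` of the form field `g` in the chart centred at `c`,
as a function of the coordinates with values in the bilinear forms on the model space. -/
def metricIn (g : FormField n M) (c : M) (y : 𝔼 n) : 𝔼 n →L[ℝ] 𝔼 n →L[ℝ] ℝ :=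
  ∑ i, ∑ j, gram g c ((extChartAt (𝓡 n) c).symm y) i j •
    (EuclideanSpace.proj i : 𝔼 n →L[ℝ] ℝ).smulRight (EuclideanSpace.proj j : 𝔼 n →L[ℝ] ℝ)

theorem metricIn_apply (g : FormField n M) (c : M) (y u v : 𝔼 n) :
    metricIn g c y u v = u.ofLp ⬝ᵥ gram g c ((extChartAt (𝓡 n) c).symm y) *ᵥ v.ofLp := by
  simp [metricIn, dotProduct, mulVec, Finset.mul_sum, mul_left_comm]

theorem metricIn_single (g : FormField n M) (c : M) (y : 𝔼 n) (i j : Fin n) :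
    metricIn g c y (EuclideanSpace.single i 1) (EuclideanSpace.single j 1)
      = gram g c ((extChartAt (𝓡 n) c).symm y) i j := by
  simp [metricIn_apply]

theorem metricIn_extChartAt {g : FormField n M} {c x : M} (hx : x ∈ (chartAt (𝔼 n) c).source)
    (u v : 𝔼 n) : metricIn g c (extChartAt (𝓡 n) c x) u v = u.ofLp ⬝ᵥ gram g c x *ᵥ v.ofLp := by
  rw [metricIn_apply, extChartAt_symm_extChartAt hx]

theorem IsBilinAt.eq_metricIn [IsManifold (𝓡 n) ∞ M] {g : FormField n M} {c x : M}
    (hg : IsBilinAt g x) (hx : x ∈ (chartAt (𝔼 n) c).source) (u v : TangentSpace (𝓡 n) x) :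
    g x u v = metricIn g c (extChartAt (𝓡 n) c x) (comps c x u) (comps c x v) := by
  obtain ⟨B, hB⟩ := hg
  rw [metricIn_extChartAt hx]
  conv_lhs => rw [hB, ← sum_comps_smul_coordFrame hx u, ← sum_comps_smul_coordFrame hx v]
  simp only [map_sum, map_smul, LinearMap.sum_apply, LinearMap.smul_apply, smul_eq_mul, gram,
    Matrix.of_apply, hB, Finset.mul_sum, dotProduct, mulVec]
  rw [Finset.sum_comm]
  exact Finset.sum_congr rfl fun i _ => Finset.sum_congr rfl fun j _ => by ring

theorem contDiffAt_metricIn {m : WithTop ℕ∞} {g : FormField n M} {c : M} {y : 𝔼 n}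
    (h : ∀ i j, ContDiffAt ℝ m (fun y => gram g c ((extChartAt (𝓡 n) c).symm y) i j) y) :
    ContDiffAt ℝ m (metricIn g c) y :=
  ContDiffAt.sum fun i _ => ContDiffAt.sum fun j _ =>
    (ContinuousLinearMap.toSpanSingleton ℝ _).contDiff.contDiffAt.comp y (h i j)

/-- Near `x`, the form field `g` is a (pseudo-Riemannian) metric of class `C¹`. -/
structure IsMetricAt (g : FormField n M) (x : M) : Prop where
  bilin : ∀ᶠ z in 𝓝 x, IsBilinAt g z
  symm : ∀ᶠ z in 𝓝 x, ∀ u v, g z u v = g z v u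
  nondeg : ∀ u, (∀ v, g x u v = 0) → u = 0
  smooth : ∀ c, x ∈ (chartAt (𝔼 n) c).source → ∀ i j,
    ContDiffAt ℝ 1 (fun y => gram g c ((extChartAt (𝓡 n) c).symm y) i j) (extChartAt (𝓡 n) c x)

theorem gram_transpose {g : FormField n M} {x : M} (hs : ∀ u v, g x u v = g x v u) (c : M) :
    (gram g c x)ᵀ = gram g c x :=
  Matrix.ext fun _ _ => hs _ _

variable {g : FormField n M} {c x : M}

namespace IsMetricAt

theorem contDiffAt (hg : IsMetricAt g x) (hx : x ∈ (chartAt (𝔼 n) c).source) :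
    ContDiffAt ℝ 1 (metricIn g c) (extChartAt (𝓡 n) c x) :=
  contDiffAt_metricIn (hg.smooth c hx)

theorem differentiableAt (hg : IsMetricAt g x) (hx : x ∈ (chartAt (𝔼 n) c).source) :
    DifferentiableAt ℝ (metricIn g c) (extChartAt (𝓡 n) c x) :=
  (hg.contDiffAt hx).differentiableAt one_ne_zero

theorem metricIn_symm (hg : IsMetricAt g x) (hx : x ∈ (chartAt (𝔼 n) c).source) :
    ∀ᶠ y in 𝓝 (extChartAt (𝓡 n) c x), ∀ u v, metricIn g c y u v = metricIn g c y v u := by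
  filter_upwards [(tendsto_extChartAt_symm hx).eventually hg.symm] with y hy u v
  rw [metricIn_apply, metricIn_apply, dotProduct_mulVec, dotProduct_comm, ← mulVec_transpose,
    gram_transpose hy]

theorem metricIn_nondeg [IsManifold (𝓡 n) ∞ M] (hg : IsMetricAt g x)
    (hx : x ∈ (chartAt (𝔼 n) c).source) {u : 𝔼 n}
    (h : ∀ v, metricIn g c (extChartAt (𝓡 n) c x) u v = 0) : u = 0 := by
  have hinv : (comps c x).inverse u = 0 := hg.nondeg _ fun v => by
    rw [hg.bilin.self_of_nhds.eq_metricIn hx, (isInvertible_comps hx).self_apply_inverse]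
    exact h _
  rw [← (isInvertible_comps hx).self_apply_inverse u, hinv, map_zero]

theorem isUnit_det_gram [IsManifold (𝓡 n) ∞ M] (hg : IsMetricAt g x)
    (hx : x ∈ (chartAt (𝔼 n) c).source) : IsUnit (gram g c x).det := by
  rw [isUnit_iff_ne_zero]
  intro hdet
  obtain ⟨v, hv, hvg⟩ := Matrix.exists_vecMul_eq_zero_iff.mpr hdet
  have hzero : (WithLp.toLp 2 v : 𝔼 n) = 0 := hg.metricIn_nondeg hx fun w => by
    rw [metricIn_extChartAt hx, dotProduct_mulVec, hvg, zero_dotProduct]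
  exact hv (congrArg WithLp.ofLp hzero)

end IsMetricAt

theorem fderiv_metricIn_single (hg : IsMetricAt g x) (hx : x ∈ (chartAt (𝔼 n) c).source)
    (m i j : Fin n) :
    fderiv ℝ (metricIn g c) (extChartAt (𝓡 n) c x) (EuclideanSpace.single m 1)
        (EuclideanSpace.single i 1) (EuclideanSpace.single j 1)
      = partialDeriv c m (fun z => gram g c z i j) x := by
  have hG := hg.differentiableAt hx
  rw [partialDeriv, ← fderiv_clm_apply_const hG,
    ← fderiv_clm_apply_const (hG.clm_apply (differentiableAt_const _))]
  simp only [metricIn_single]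

end MetricInCoordinates

section Christoffel

open Matrix

variable {n : ℕ} {M : Type*} [TopologicalSpace M] [ChartedSpace (𝔼 n) M]
  {g : FormField n M} {c x : M}

/-- The bilinear map with components `Γ^a_{m b} u^m v^b`. -/
def christoffelMap (g : FormField n M) (c x : M) : 𝔼 n →L[ℝ] 𝔼 n →L[ℝ] 𝔼 n :=
  ∑ a, ∑ m, ∑ b, christoffel g c x a m b •
    (EuclideanSpace.proj m : 𝔼 n →L[ℝ] ℝ).smulRight
      ((EuclideanSpace.proj b : 𝔼 n →L[ℝ] ℝ).smulRight (EuclideanSpace.single a 1))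

theorem christoffelMap_apply (u v : 𝔼 n) (a : Fin n) :
    christoffelMap g c x u v a = ∑ m, ∑ b, christoffel g c x a m b * (u m * v b) := by
  simp [christoffelMap, Finset.sum_apply, Pi.single_apply]

theorem christoffelMap_comps (u : TangentSpace (𝓡 n) x) (v : 𝔼 n) (a : Fin n) :
    christoffelMap g c x (comps c x u) v a = ∑ b, connForm g c x a b u * v b := by
  rw [christoffelMap_apply, Finset.sum_comm]
  refine Finset.sum_congr rfl fun b _ => ?_
  rw [connForm, Finset.sum_mul]
  exact Finset.sum_congr rfl fun m _ => by ring

variable [IsManifold (𝓡 n) ∞ M]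

theorem gram_mul_christoffel (hg : IsMetricAt g x) (hx : x ∈ (chartAt (𝔼 n) c).source)
    (e m b : Fin n) :
    2 * ∑ a, christoffel g c x a m b * gram g c x a e
      = partialDeriv c m (fun z => gram g c z e b) x
      + partialDeriv c b (fun z => gram g c z e m) x
      - partialDeriv c e (fun z => gram g c z m b) x := by
  have hsymm : ∀ a, gram g c x a e = gram g c x e a := fun a => hg.symm.self_of_nhds _ _
  let T : Fin n → ℝ := fun d => partialDeriv c m (fun z => gram g c z d b) x
      + partialDeriv c b (fun z => gram g c z d m) x
      - partialDeriv c d (fun z => gram g c z m b) x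
  calc 2 * ∑ a, christoffel g c x a m b * gram g c x a e
      = (gram g c x *ᵥ (gram g c x)⁻¹ *ᵥ T) e := by
        rw [mulVec, dotProduct, Finset.mul_sum]
        refine Finset.sum_congr rfl fun a _ => ?_
        rw [christoffel, hsymm, mulVec, dotProduct]
        ring
    _ = T e := by
        rw [mulVec_mulVec, mul_nonsing_inv _ (hg.isUnit_det_gram hx), one_mulVec]

theorem koszul_single (hg : IsMetricAt g x) (hx : x ∈ (chartAt (𝔼 n) c).source)
    (m b e : Fin n) :
    let G := metricIn g c (extChartAt (𝓡 n) c x)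
    let D := fderiv ℝ (metricIn g c) (extChartAt (𝓡 n) c x)
    let ε : Fin n → 𝔼 n := fun i => EuclideanSpace.single i 1
    2 * G (christoffelMap g c x (ε m) (ε b)) (ε e)
      = D (ε m) (ε e) (ε b) + D (ε b) (ε e) (ε m) - D (ε e) (ε m) (ε b) := by
  intro G D ε
  simp only [D, ε, fderiv_metricIn_single hg hx]
  rw [← gram_mul_christoffel hg hx, metricIn_extChartAt hx]
  simp [dotProduct, christoffelMap_apply]

theorem koszul (hg : IsMetricAt g x) (hx : x ∈ (chartAt (𝔼 n) c).source) (u v w : 𝔼 n) :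
    2 * metricIn g c (extChartAt (𝓡 n) c x) (christoffelMap g c x u v) w
      = fderiv ℝ (metricIn g c) (extChartAt (𝓡 n) c x) u w v
        + fderiv ℝ (metricIn g c) (extChartAt (𝓡 n) c x) v w u
        - fderiv ℝ (metricIn g c) (extChartAt (𝓡 n) c x) w u v := by
  set G := metricIn g c (extChartAt (𝓡 n) c x)
  set D := fderiv ℝ (metricIn g c) (extChartAt (𝓡 n) c x)
  set Γ := christoffelMap g c x
  have linear_w : ∀ (m b : Fin n) (w : 𝔼 n),
      let u : 𝔼 n := EuclideanSpace.single m 1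
      let v : 𝔼 n := EuclideanSpace.single b 1
      2 * G (Γ u v) w = D u w v + D v w u - D w u v := fun m b w =>
    DFunLike.congr_fun (clm_ext_single (L := (2 : ℝ) • G (Γ _ _))
      (L' := (D _).flip _ + (D _).flip _ - (D.flip _).flip _) (koszul_single hg hx m b)) w
  have linear_v : ∀ (m : Fin n) (v w : 𝔼 n),
      let u : 𝔼 n := EuclideanSpace.single m 1
      2 * G (Γ u v) w = D u w v + D v w u - D w u v := fun m v w =>
    DFunLike.congr_fun (clm_ext_single (L := (2 : ℝ) • (G.flip w).comp (Γ _))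
      (L' := D _ w + (D.flip w).flip _ - D w _) (linear_w m · w)) v
  exact DFunLike.congr_fun (clm_ext_single (L := (2 : ℝ) • (G.flip w).comp (Γ.flip v))
      (L' := (D.flip w).flip v + D v w - (D w).flip v) (linear_v · v w)) u

end Christoffel

section LocalRepresentatives

variable {k n : ℕ} {S : Type*} [TopologicalSpace S] [ChartedSpace (𝔼 k) S]
  {M : Type*} [TopologicalSpace M] [ChartedSpace (𝔼 n) M]
  {V : Type*} [NormedAddCommGroup V] [NormedSpace ℝ V]
  {F : S → M} {s p : S} {c : M} {m : WithTop ℕ∞}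

/-- The map `F` in the charts centred at `s` and `c`. -/
def localRep (s : S) (c : M) (F : S → M) (y : 𝔼 k) : 𝔼 n :=
  extChartAt (𝓡 n) c (F ((extChartAt (𝓡 k) s).symm y))

theorem localRep_extChartAt (hp : p ∈ (chartAt (𝔼 k) s).source) (c : M) (F : S → M) :
    localRep s c F (extChartAt (𝓡 k) s p) = extChartAt (𝓡 n) c (F p) := by
  rw [localRep, extChartAt_symm_extChartAt hp]

theorem eventually_mem_chart_source (hF : ContinuousAt F p)
    (hc : F p ∈ (chartAt (𝔼 n) c).source) : ∀ᶠ q in 𝓝 p, F q ∈ (chartAt (𝔼 n) c).source :=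
  hF.eventually_mem ((chartAt (𝔼 n) c).open_source.mem_nhds hc)

theorem contMDiffAt_extChartAt_comp [IsManifold (𝓡 n) ∞ M] (hm : m ≤ ∞)
    (hF : ContMDiffAt (𝓡 k) (𝓡 n) m F p) (hc : F p ∈ (chartAt (𝔼 n) c).source) :
    ContMDiffAt (𝓡 k) 𝓘(ℝ, 𝔼 n) m (fun q => extChartAt (𝓡 n) c (F q)) p :=
  ((contMDiffAt_extChartAt' (n := ∞) hc).of_le hm).comp p hF

variable [IsManifold (𝓡 k) ∞ S]

theorem contDiffAt_comp_extChartAt_symm (hm : m ≤ ∞) {f : S → V}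
    (hp : p ∈ (chartAt (𝔼 k) s).source) (hf : ContMDiffAt (𝓡 k) 𝓘(ℝ, V) m f p) :
    ContDiffAt ℝ m (fun y => f ((extChartAt (𝓡 k) s).symm y)) (extChartAt (𝓡 k) s p) := by
  have hsymm : ContMDiffAt 𝓘(ℝ, 𝔼 k) (𝓡 k) m (extChartAt (𝓡 k) s).symm
      (extChartAt (𝓡 k) s p) :=
    ((contMDiffOn_extChartAt_symm s).contMDiffAt ((isOpen_extChartAt_target s).mem_nhds
      ((extChartAt (𝓡 k) s).map_source (mem_extChartAt_source_of_mem_chart_source hp)))).of_le hm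
  exact contMDiffAt_iff_contDiffAt.mp
    (ContMDiffAt.comp (g := f) _ (by rwa [extChartAt_symm_extChartAt hp]) hsymm)

variable [IsManifold (𝓡 n) ∞ M]

theorem contDiffAt_localRep (hF : ContMDiffAt (𝓡 k) (𝓡 n) ∞ F p)
    (hp : p ∈ (chartAt (𝔼 k) s).source) (hc : F p ∈ (chartAt (𝔼 n) c).source) :
    ContDiffAt ℝ ∞ (localRep (k := k) (n := n) s c F) (extChartAt (𝓡 k) s p) :=
  contDiffAt_comp_extChartAt_symm le_rfl hp (contMDiffAt_extChartAt_comp le_rfl hF hc)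

theorem contDiffAt_fderiv_localRep (hF : ContMDiffAt (𝓡 k) (𝓡 n) ∞ F p)
    (hp : p ∈ (chartAt (𝔼 k) s).source) (hc : F p ∈ (chartAt (𝔼 n) c).source) :
    ContDiffAt ℝ 1 (fderiv ℝ (localRep (k := k) (n := n) s c F)) (extChartAt (𝓡 k) s p) :=
  (contDiffAt_localRep hF hp hc).fderiv_right (by norm_cast)

theorem comps_mfderiv_eq_fderiv_localRep (hF : MDifferentiableAt (𝓡 k) (𝓡 n) F p)
    (hp : p ∈ (chartAt (𝔼 k) s).source) (hc : F p ∈ (chartAt (𝔼 n) c).source)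
    (v : TangentSpace (𝓡 k) p) :
    comps c (F p) (mfderiv (𝓡 k) (𝓡 n) F p v)
      = fderiv ℝ (localRep s c F) (extChartAt (𝓡 k) s p) (comps s p v) := by
  rw [comps_mfderiv hF hc]
  exact mvfderiv_eq_fderiv ((mdifferentiableAt_extChartAt hc).comp p hF) hp v

theorem eventually_mdifferentiableAt (hF : ContMDiffAt (𝓡 k) (𝓡 n) ∞ F p) :
    ∀ᶠ q in 𝓝 p, MDifferentiableAt (𝓡 k) (𝓡 n) F q := by
  have hF₁ : ContMDiffAt (𝓡 k) (𝓡 n) 1 F p := hF.of_le (mod_cast le_top)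
  filter_upwards [(contMDiffAt_iff_contMDiffAt_nhds (by simp)).mp hF₁] with q hq
  exact hq.mdifferentiableAt one_ne_zero

theorem eventually_comps_mfderiv (hF : ContMDiffAt (𝓡 k) (𝓡 n) ∞ F p)
    (hp : p ∈ (chartAt (𝔼 k) s).source) (hc : F p ∈ (chartAt (𝔼 n) c).source) :
    ∀ᶠ q in 𝓝 p, ∀ v, comps c (F q) (mfderiv (𝓡 k) (𝓡 n) F q v)
      = fderiv ℝ (localRep s c F) (extChartAt (𝓡 k) s q) (comps s q v) := by
  filter_upwards [eventually_mdifferentiableAt hF, eventually_mem_chart_source hF.continuousAt hc,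
    (chartAt (𝔼 k) s).open_source.mem_nhds hp] with q hFq hcq hpq
  exact comps_mfderiv_eq_fderiv_localRep hFq hpq hcq

theorem injective_fderiv_localRep (hF : MDifferentiableAt (𝓡 k) (𝓡 n) F p)
    (hinj : Function.Injective (mfderiv (𝓡 k) (𝓡 n) F p))
    (hp : p ∈ (chartAt (𝔼 k) s).source) (hc : F p ∈ (chartAt (𝔼 n) c).source) :
    Function.Injective
      (fderiv ℝ (localRep (k := k) (n := n) s c F) (extChartAt (𝓡 k) s p)) := by
  intro u v huv
  obtain ⟨u, rfl⟩ := (isInvertible_comps hp).surjective u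
  obtain ⟨v, rfl⟩ := (isInvertible_comps hp).surjective v
  rw [← comps_mfderiv_eq_fderiv_localRep hF hp hc, ← comps_mfderiv_eq_fderiv_localRep hF hp hc]
    at huv
  rw [hinj ((isInvertible_comps hc).injective huv)]

end LocalRepresentatives

section Pullback

variable {k n : ℕ} {M : Type*} [TopologicalSpace M] [ChartedSpace (𝔼 k) M]
  {M' : Type*} [TopologicalSpace M'] [ChartedSpace (𝔼 n) M']
  {g : FormField n M'} {φ : M → M'} {c x : M} {c' : M'}

theorem surjective_of_injective_euclidean {A : 𝔼 n →L[ℝ] 𝔼 n} (hA : Function.Injective A) :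
    Function.Surjective A :=
  (LinearMap.injective_iff_surjective (f := A.toLinearMap)).mp hA

theorem IsBilinAt.pullback (hg : IsBilinAt g (φ x)) : IsBilinAt (pullback (k := k) φ g) x := by
  obtain ⟨B, hB⟩ := hg
  exact ⟨B.compl₁₂ (mfderiv (𝓡 k) (𝓡 n) φ x).toLinearMap (mfderiv (𝓡 k) (𝓡 n) φ x).toLinearMap,
    fun u v => hB _ _⟩

variable [IsManifold (𝓡 k) ∞ M] [IsManifold (𝓡 n) ∞ M']

theorem eventually_metricIn_pullback (hφ : ContMDiffAt (𝓡 k) (𝓡 n) ∞ φ x)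
    (hg : ∀ᶠ z in 𝓝 (φ x), IsBilinAt g z)
    (hx : x ∈ (chartAt (𝔼 k) c).source) (hc : φ x ∈ (chartAt (𝔼 n) c').source) :
    ∀ᶠ y in 𝓝 (extChartAt (𝓡 k) c x), ∀ u v, metricIn (pullback (k := k) φ g) c y u v
      = metricIn g c' (localRep c c' φ y) (fderiv ℝ (localRep c c' φ) y u)
          (fderiv ℝ (localRep c c' φ) y v) := by
  have hlocal : ∀ᶠ z in 𝓝 x, ∀ u v,
      metricIn (CNT.pullback (k := k) φ g) c (extChartAt (𝓡 k) c z) u v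
        = metricIn g c' (extChartAt (𝓡 n) c' (φ z))
            (fderiv ℝ (localRep c c' φ) (extChartAt (𝓡 k) c z) u)
            (fderiv ℝ (localRep c c' φ) (extChartAt (𝓡 k) c z) v) := by
    filter_upwards [hφ.continuousAt.eventually hg, eventually_comps_mfderiv hφ hx hc,
      eventually_mem_chart_source hφ.continuousAt hc,
      (chartAt (𝔼 k) c).open_source.mem_nhds hx] with z hgz hφz hcz hz u v
    obtain ⟨u, rfl⟩ := (isInvertible_comps hz).surjective u
    obtain ⟨v, rfl⟩ := (isInvertible_comps hz).surjective v
    rw [← hgz.pullback.eq_metricIn hz, ← hφz, ← hφz, ← hgz.eq_metricIn hcz]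
    rfl
  filter_upwards [(tendsto_extChartAt_symm hx).eventually hlocal,
    (isOpen_extChartAt_target c).mem_nhds
      ((extChartAt (𝓡 k) c).map_source (mem_extChartAt_source_of_mem_chart_source hx))]
    with y hy hyc
  rwa [(extChartAt (𝓡 k) c).right_inv hyc] at hy

theorem contDiffAt_metricIn_pullback (hφ : ContMDiffAt (𝓡 k) (𝓡 n) ∞ φ x)
    (hg : IsMetricAt g (φ x)) (hx : x ∈ (chartAt (𝔼 k) c).source) (u v : 𝔼 k) :
    ContDiffAt ℝ 1 (fun y => metricIn (pullback (k := k) φ g) c y u v) (extChartAt (𝓡 k) c x) := by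
  have hc := mem_chart_source (𝔼 n) (φ x)
  set ψ : 𝔼 k → 𝔼 n := localRep c (φ x) φ with hψ
  have hψ₁ : ContDiffAt ℝ 1 ψ (extChartAt (𝓡 k) c x) :=
    (contDiffAt_localRep hφ hx hc).of_le (mod_cast le_top)
  have hDψ := contDiffAt_fderiv_localRep hφ hx hc
  have hG : ContDiffAt ℝ 1 (metricIn g (φ x)) (ψ (extChartAt (𝓡 k) c x)) := by
    rw [hψ, localRep_extChartAt hx]
    exact hg.contDiffAt hc
  have hlocal : ContDiffAt ℝ 1 (fun y =>
      metricIn g (φ x) (ψ y) (fderiv ℝ ψ y u) (fderiv ℝ ψ y v)) (extChartAt (𝓡 k) c x) :=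
    ((hG.comp _ hψ₁).clm_apply (hDψ.clm_apply contDiffAt_const)).clm_apply
      (hDψ.clm_apply contDiffAt_const)
  exact hlocal.congr_of_eventuallyEq
    ((eventually_metricIn_pullback hφ hg.bilin hx hc).mono fun y hy => hy u v)

theorem IsMetricAt.pullback {M : Type*} [TopologicalSpace M] [ChartedSpace (𝔼 n) M]
    [IsManifold (𝓡 n) ∞ M] {φ : M → M'} {x : M}
    (hg : IsMetricAt g (φ x)) (hφ : ContMDiffAt (𝓡 n) (𝓡 n) ∞ φ x)
    (hinj : Function.Injective (mfderiv (𝓡 n) (𝓡 n) φ x)) :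
    IsMetricAt (pullback (k := n) φ g) x where
  bilin := (hφ.continuousAt.eventually hg.bilin).mono fun _ h => h.pullback
  symm := (hφ.continuousAt.eventually hg.symm).mono fun _ h u v => h _ _
  nondeg u hu := by
    have himage := hg.nondeg (mfderiv (𝓡 n) (𝓡 n) φ x u) fun v => by
      obtain ⟨v, rfl⟩ := surjective_of_injective_euclidean hinj v
      exact hu v
    exact hinj (himage.trans (map_zero _).symm)
  smooth c hx i j := by
    simp only [← metricIn_single]
    exact contDiffAt_metricIn_pullback hφ hg hx _ _

end Pullback

section ChristoffelTransformation

variable {n : ℕ} {M : Type*} [TopologicalSpace M] [ChartedSpace (𝔼 n) M] [IsManifold (𝓡 n) ∞ M]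
  {M' : Type*} [TopologicalSpace M'] [ChartedSpace (𝔼 n) M'] [IsManifold (𝓡 n) ∞ M']
  {g : FormField n M'} {φ : M → M'} {c x : M} {c' : M'}

theorem fderiv_metricIn_pullback (hφ : ContMDiffAt (𝓡 n) (𝓡 n) ∞ φ x)
    (hinj : Function.Injective (mfderiv (𝓡 n) (𝓡 n) φ x)) (hg : IsMetricAt g (φ x))
    (hx : x ∈ (chartAt (𝔼 n) c).source) (hc : φ x ∈ (chartAt (𝔼 n) c').source) (w u v : 𝔼 n) :
    let y := extChartAt (𝓡 n) c x
    let G := metricIn g c'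
    let ψ := localRep c c' φ
    fderiv ℝ (metricIn (pullback (k := n) φ g) c) y w u v
      = fderiv ℝ G (ψ y) (fderiv ℝ ψ y w) (fderiv ℝ ψ y u) (fderiv ℝ ψ y v)
        + G (ψ y) (fderiv ℝ (fderiv ℝ ψ) y w u) (fderiv ℝ ψ y v)
        + G (ψ y) (fderiv ℝ ψ y u) (fderiv ℝ (fderiv ℝ ψ) y w v) := by
  intro y G ψ
  have hψ : DifferentiableAt ℝ ψ y := (contDiffAt_localRep hφ hx hc).differentiableAt (by simp)
  have hDψ : DifferentiableAt ℝ (fderiv ℝ ψ) y :=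
    (contDiffAt_fderiv_localRep hφ hx hc).differentiableAt one_ne_zero
  have hG : DifferentiableAt ℝ G (ψ y) := by
    simpa only [ψ, y, localRep_extChartAt hx] using hg.differentiableAt hc
  have hpullback := (hg.pullback hφ hinj).differentiableAt hx
  have hpull : (fun y => metricIn (pullback (k := n) φ g) c y u v) =ᶠ[𝓝 y]
      fun y => G (ψ y) (fderiv ℝ ψ y u) (fderiv ℝ ψ y v) :=
    (eventually_metricIn_pullback hφ hg.bilin hx hc).mono fun y hy => hy u v
  rw [← fderiv_clm_apply_const hpullback,
    ← fderiv_clm_apply_const (hpullback.clm_apply (differentiableAt_const _)), hpull.fderiv_eq,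
    fderiv_comp_bilin_apply hG hψ (hDψ.clm_apply (differentiableAt_const u))
      (hDψ.clm_apply (differentiableAt_const v)),
    fderiv_clm_apply_const hDψ, fderiv_clm_apply_const hDψ]

theorem christoffelMap_pullback (hφ : ContMDiffAt (𝓡 n) (𝓡 n) ∞ φ x)
    (hinj : Function.Injective (mfderiv (𝓡 n) (𝓡 n) φ x)) (hg : IsMetricAt g (φ x))
    (hx : x ∈ (chartAt (𝔼 n) c).source) (hc : φ x ∈ (chartAt (𝔼 n) c').source) (u v : 𝔼 n) :
    let y := extChartAt (𝓡 n) c x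
    let ψ := localRep c c' φ
    fderiv ℝ ψ y (christoffelMap (pullback (k := n) φ g) c x u v)
      = fderiv ℝ (fderiv ℝ ψ) y u v
        + christoffelMap g c' (φ x) (fderiv ℝ ψ y u) (fderiv ℝ ψ y v) := by
  intro y ψ
  rw [← sub_eq_zero]
  refine hg.metricIn_nondeg hc fun w => ?_
  obtain ⟨w, rfl⟩ := surjective_of_injective_euclidean
    (injective_fderiv_localRep (hφ.mdifferentiableAt (by simp)) hinj hx hc) w
  have hψ : ψ y = extChartAt (𝓡 n) c' (φ x) := localRep_extChartAt hx c' φ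
  have hsymm := (hg.metricIn_symm hc).self_of_nhds
  have hD : ∀ a b, fderiv ℝ (fderiv ℝ ψ) y a b = fderiv ℝ (fderiv ℝ ψ) y b a :=
    ((contDiffAt_localRep hφ hx hc).of_le (m := 2) (by norm_cast)).isSymmSndFDerivAt (by simp)
  have koszul_pull := koszul (hg.pullback hφ hinj) hx u v w
  have koszul_push := koszul hg hc (fderiv ℝ ψ y u) (fderiv ℝ ψ y v) (fderiv ℝ ψ y w)
  simp only [fderiv_metricIn_pullback hφ hinj hg hx hc] at koszul_pull
  rw [(eventually_metricIn_pullback hφ hg.bilin hx hc).self_of_nhds] at koszul_pull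
  change 2 * metricIn g c' (ψ y) _ (fderiv ℝ ψ y w) = _ at koszul_pull
  simp only [show localRep c c' φ = ψ from rfl, show extChartAt (𝓡 n) c x = y from rfl, hψ]
    at koszul_pull
  simp only [map_sub, map_add, sub_apply, add_apply]
  rw [hD w u, hD w v, hD v u, hsymm (fderiv ℝ ψ y w),
    hsymm (fderiv ℝ ψ y u) (fderiv ℝ (fderiv ℝ ψ) y v w)] at koszul_pull
  linarith

end ChristoffelTransformation

section CovariantDerivative

variable {k n : ℕ} {S : Type*} [TopologicalSpace S] [ChartedSpace (𝔼 k) S]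
  {M : Type*} [TopologicalSpace M] [ChartedSpace (𝔼 n) M]
  {F : S → M} {Y : ∀ q : S, TangentSpace (𝓡 n) (F q)} {p : S} {c : M}

/-- The vector field `Y` along `F` is of class `C¹` at `p`. -/
def IsC1Along (F : S → M) (Y : ∀ q : S, TangentSpace (𝓡 n) (F q)) (p : S) : Prop :=
  ∀ c, F p ∈ (chartAt (𝔼 n) c).source →
    ContMDiffAt (𝓡 k) 𝓘(ℝ, 𝔼 n) 1 (fun q => comps c (F q) (Y q)) p

theorem IsC1Along.mdifferentiableAt (hY : IsC1Along (k := k) F Y p)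
    (hc : F p ∈ (chartAt (𝔼 n) c).source) :
    MDifferentiableAt (𝓡 k) 𝓘(ℝ, 𝔼 n) (fun q => comps c (F q) (Y q)) p :=
  (hY c hc).mdifferentiableAt one_ne_zero

/-- The components in the chart centred at `c` of the covariant derivative along `F`. The definition
`covAlong` is the case `c = F p`; arbitrary `c` is needed to differentiate in `p`. -/
def covIn (g : FormField n M) (c : M) (F : S → M) (Y : ∀ q : S, TangentSpace (𝓡 n) (F q)) (p : S)
    (v : TangentSpace (𝓡 k) p) : 𝔼 n :=
  mvfderiv (𝓡 k) (fun q => comps c (F q) (Y q)) p v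
    + christoffelMap g c (F p) (comps c (F p) (mfderiv (𝓡 k) (𝓡 n) F p v)) (comps c (F p) (Y p))

theorem mvfderiv_component {f : S → 𝔼 n} (hf : MDifferentiableAt (𝓡 k) 𝓘(ℝ, 𝔼 n) f p)
    (v : TangentSpace (𝓡 k) p) (a : Fin n) :
    mvfderiv (𝓡 k) (fun q => f q a) p v = mvfderiv (𝓡 k) f p v a := by
  have h := mfderiv_comp_apply p
    (EuclideanSpace.proj a : 𝔼 n →L[ℝ] ℝ).differentiableAt.mdifferentiableAt hf v
  rwa [mfderiv_eq_fderiv, ContinuousLinearMap.fderiv] at h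

theorem mvfderiv_clm_comp [IsManifold (𝓡 k) ∞ S] {E V : Type*} [NormedAddCommGroup E]
    [NormedSpace ℝ E] [NormedAddCommGroup V] [NormedSpace ℝ V] {f : E → E →L[ℝ] V} {a u : S → E}
    (hf : DifferentiableAt ℝ f (a p)) (ha : MDifferentiableAt (𝓡 k) 𝓘(ℝ, E) a p)
    (hu : MDifferentiableAt (𝓡 k) 𝓘(ℝ, E) u p) (v : TangentSpace (𝓡 k) p) :
    mvfderiv (𝓡 k) (fun q => f (a q) (u q)) p v
      = fderiv ℝ f (a p) (mvfderiv (𝓡 k) a p v) (u p) + f (a p) (mvfderiv (𝓡 k) u p v) := by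
  have hp := mem_chart_source (𝔼 k) p
  have hfu : MDifferentiableAt (𝓡 k) 𝓘(ℝ, V) (fun q => f (a q) (u q)) p :=
    (hf.mdifferentiableAt.comp p ha).clm_apply hu
  have hsymm := extChartAt_symm_extChartAt hp
  rw [mvfderiv_eq_fderiv hfu hp, mvfderiv_eq_fderiv ha hp, mvfderiv_eq_fderiv hu hp,
    fderiv_comp_clm_apply (by rwa [hsymm]) (differentiableAt_comp_extChartAt_symm ha hp)
      (differentiableAt_comp_extChartAt_symm hu hp), hsymm]

variable [IsManifold (𝓡 n) ∞ M]

theorem comps_covAlong_self (g : FormField n M) (hY : IsC1Along (k := k) F Y p)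
    (v : TangentSpace (𝓡 k) p) :
    comps (F p) (F p) (covAlong g F Y p v) = covIn g (F p) F Y p v := by
  have hx := mem_chart_source (𝔼 n) (F p)
  ext a
  simp [covAlong, comps_coordFrame hx, Finset.sum_apply, Pi.single_apply, covIn,
    christoffelMap_comps, mvfderiv_component (hY.mdifferentiableAt hx)]

variable {M' : Type*} [TopologicalSpace M'] [ChartedSpace (𝔼 n) M'] [IsManifold (𝓡 n) ∞ M']
  {φ : M → M'} {g : FormField n M'} {c' : M'}

theorem eventually_comps_mfderiv_along (Y : ∀ q : S, TangentSpace (𝓡 n) (F q))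
    (hφ : ContMDiffAt (𝓡 n) (𝓡 n) ∞ φ (F p)) (hF : ContinuousAt F p)
    (hc : F p ∈ (chartAt (𝔼 n) c).source) (hc' : φ (F p) ∈ (chartAt (𝔼 n) c').source) :
    (fun q => comps c' (φ (F q)) (mfderiv (𝓡 n) (𝓡 n) φ (F q) (Y q))) =ᶠ[𝓝 p]
      fun q => fderiv ℝ (localRep c c' φ) (extChartAt (𝓡 n) c (F q)) (comps c (F q) (Y q)) :=
  (hF.eventually (eventually_comps_mfderiv hφ hc hc')).mono fun q hq => hq (Y q)

theorem IsC1Along.mfderiv (hY : IsC1Along (k := k) F Y p)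
    (hφ : ContMDiffAt (𝓡 n) (𝓡 n) ∞ φ (F p)) (hF : ContMDiffAt (𝓡 k) (𝓡 n) ∞ F p) :
    IsC1Along (k := k) (fun q => φ (F q)) (fun q => mfderiv (𝓡 n) (𝓡 n) φ (F q) (Y q)) p := by
  intro c' hc'
  have hc := mem_chart_source (𝔼 n) (F p)
  exact (((contDiffAt_fderiv_localRep hφ hc hc').contMDiffAt.comp p
    ((contMDiffAt_extChartAt_comp le_rfl hF hc).of_le (mod_cast le_top))).clm_apply
      (hY _ hc)).congr_of_eventuallyEq (eventually_comps_mfderiv_along Y hφ hF.continuousAt hc hc')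

variable [IsManifold (𝓡 k) ∞ S]

theorem covIn_pullback (hY : IsC1Along (k := k) F Y p)
    (hφ : ContMDiffAt (𝓡 n) (𝓡 n) ∞ φ (F p)) (hF : MDifferentiableAt (𝓡 k) (𝓡 n) F p)
    (hinj : Function.Injective (mfderiv (𝓡 n) (𝓡 n) φ (F p))) (hg : IsMetricAt g (φ (F p)))
    (hc : F p ∈ (chartAt (𝔼 n) c).source) (hc' : φ (F p) ∈ (chartAt (𝔼 n) c').source)
    (v : TangentSpace (𝓡 k) p) :
    covIn g c' (fun q => φ (F q)) (fun q => mfderiv (𝓡 n) (𝓡 n) φ (F q) (Y q)) p v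
      = fderiv ℝ (localRep c c' φ) (extChartAt (𝓡 n) c (F p))
          (covIn (pullback (k := n) φ g) c F Y p v) := by
  have hφd := hφ.mdifferentiableAt (by simp)
  have hlocal : mvfderiv (𝓡 k)
        (fun q => comps c' (φ (F q)) (mfderiv (𝓡 n) (𝓡 n) φ (F q) (Y q))) p v
      = mvfderiv (𝓡 k) (fun q =>
          fderiv ℝ (localRep c c' φ) (extChartAt (𝓡 n) c (F q)) (comps c (F q) (Y q))) p v :=
    congrArg (fun L : TangentSpace (𝓡 k) p →L[ℝ] 𝔼 n => L v)
      (eventually_comps_mfderiv_along Y hφ hF.continuousAt hc hc').mfderiv_eq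
  have hchain : mfderiv (𝓡 k) (𝓡 n) (fun q => φ (F q)) p v
      = mfderiv (𝓡 n) (𝓡 n) φ (F p) (mfderiv (𝓡 k) (𝓡 n) F p v) :=
    mfderiv_comp_apply p hφd hF v
  rw [covIn, hlocal, hchain, covIn, map_add, comps_mfderiv_eq_fderiv_localRep hφd hc hc',
    comps_mfderiv_eq_fderiv_localRep hφd hc hc', christoffelMap_pullback hφ hinj hg hc hc',
    mvfderiv_clm_comp (a := fun q => extChartAt (𝓡 n) c (F q))
      ((contDiffAt_fderiv_localRep hφ hc hc').differentiableAt one_ne_zero)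
      ((mdifferentiableAt_extChartAt hc).comp p hF) (hY.mdifferentiableAt hc),
    comps_mfderiv hF hc]
  abel

theorem covAlong_pullback (hY : IsC1Along (k := k) F Y p)
    (hφ : ContMDiffAt (𝓡 n) (𝓡 n) ∞ φ (F p)) (hF : ContMDiffAt (𝓡 k) (𝓡 n) ∞ F p)
    (hinj : Function.Injective (mfderiv (𝓡 n) (𝓡 n) φ (F p)))
    (hg : IsMetricAt g (φ (F p))) (v : TangentSpace (𝓡 k) p) :
    covAlong g (fun q => φ (F q)) (fun q => mfderiv (𝓡 n) (𝓡 n) φ (F q) (Y q)) p v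
      = mfderiv (𝓡 n) (𝓡 n) φ (F p) (covAlong (pullback (k := n) φ g) F Y p v) := by
  have hc := mem_chart_source (𝔼 n) (F p)
  have hc' := mem_chart_source (𝔼 n) (φ (F p))
  refine (isInvertible_comps hc').injective ((comps_covAlong_self g (hY.mfderiv hφ hF) v).trans ?_)
  rw [covIn_pullback hY hφ (hF.mdifferentiableAt (by simp)) hinj hg hc hc',
    comps_mfderiv_eq_fderiv_localRep (hφ.mdifferentiableAt (by simp)) hc hc',
    comps_covAlong_self _ hY]

-- A change of charts is the pullback along the identity.
theorem comps_covAlong {g : FormField n M} (hY : IsC1Along (k := k) F Y p)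
    (hF : MDifferentiableAt (𝓡 k) (𝓡 n) F p) (hg : IsMetricAt g (F p))
    (hc : F p ∈ (chartAt (𝔼 n) c).source) (v : TangentSpace (𝓡 k) p) :
    comps c (F p) (covAlong g F Y p v) = covIn g c F Y p v := by
  have hx := mem_chart_source (𝔼 n) (F p)
  have hid : ContMDiffAt (𝓡 n) (𝓡 n) ∞ (id : M → M) (F p) := contMDiffAt_id
  have hpull : pullback (k := n) (id : M → M) g = g := by
    funext x u v
    simp [pullback, mfderiv_id]
  have hcovIn := covIn_pullback (φ := id) (g := g) hY hid hF
    (by rw [mfderiv_id]; exact fun _ _ h => h) hg hx hc v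
  have hcomps := comps_mfderiv_eq_fderiv_localRep (F := (id : M → M))
    (hid.mdifferentiableAt (by simp)) hx hc (covAlong g F Y p v)
  rw [hpull, ← comps_covAlong_self g hY] at hcovIn
  simp only [mfderiv_id] at hcovIn hcomps
  exact hcomps.trans hcovIn.symm

end CovariantDerivative

section MetricTrace

open Matrix

variable {k : ℕ} {S : Type*} [TopologicalSpace S] [ChartedSpace (𝔼 k) S] {h : FormField k S}
  {s c p : S}

/-- The trace `h^{ij} T(∂_i, ∂_j)` of a bilinear form `T` on `T_p S` with respect to `h`, computed
in the chart centred at `s`. -/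
def metricTrace (h : FormField k S) (s p : S)
    (T : TangentSpace (𝓡 k) p → TangentSpace (𝓡 k) p → ℝ) : ℝ :=
  ∑ i, ∑ j, (gram h s p)⁻¹ i j * T (coordFrame s p i) (coordFrame s p j)

theorem metricTrace_eq_trace (h : FormField k S) (s p : S)
    (T : TangentSpace (𝓡 k) p → TangentSpace (𝓡 k) p → ℝ) :
    metricTrace h s p T = ((gram h s p)⁻¹
      * (Matrix.of fun i j => T (coordFrame s p i) (coordFrame s p j))ᵀ).trace := by
  simp [metricTrace, Matrix.trace, Matrix.mul_apply]

/-- The matrix `A` with `∂_i = A_{ia} ∂'_a`, where `∂_i` and `∂'_a` are the coordinate vectors of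
the charts centred at `s` and `c`. -/
def transitionMatrix (s c p : S) : Matrix (Fin k) (Fin k) ℝ :=
  Matrix.of fun i a => comps c p (coordFrame s p i) a

theorem gram_congr {h h' : FormField k S} (heq : h p = h' p) (s : S) :
    gram h s p = gram h' s p := by
  simp only [gram, heq]

variable [IsManifold (𝓡 k) ∞ S]

theorem coordFrame_eq_sum (hc : p ∈ (chartAt (𝔼 k) c).source) (s : S) (i : Fin k) :
    coordFrame s p i = ∑ a : Fin k, transitionMatrix s c p i a • coordFrame c p a :=
  (sum_comps_smul_coordFrame hc _).symm

theorem transitionMatrix_mul_transitionMatrix (hs : p ∈ (chartAt (𝔼 k) s).source)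
    (hc : p ∈ (chartAt (𝔼 k) c).source) :
    transitionMatrix (k := k) s c p * transitionMatrix c s p = 1 := by
  ext i j
  have hij := congrArg (fun v => comps s p v j) (coordFrame_eq_sum hc s i)
  simp only [map_sum, map_smul, comps_coordFrame hs] at hij
  rw [Matrix.mul_apply, Matrix.one_apply]
  simpa [transitionMatrix, Pi.single_apply, eq_comm] using hij.symm

theorem of_coordFrame_eq_congruence (hc : p ∈ (chartAt (𝔼 k) c).source) (s : S)
    (T : TangentSpace (𝓡 k) p →ₗ[ℝ] TangentSpace (𝓡 k) p →ₗ[ℝ] ℝ) :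
    (Matrix.of fun i j => T (coordFrame s p i) (coordFrame s p j))
      = transitionMatrix s c p * (Matrix.of fun a b => T (coordFrame c p a) (coordFrame c p b))
        * (transitionMatrix s c p)ᵀ := by
  ext i j
  simp only [Matrix.mul_apply, Matrix.of_apply, Matrix.transpose_apply]
  rw [coordFrame_eq_sum hc s i, coordFrame_eq_sum hc s j]
  simp only [map_sum, LinearMap.sum_apply, map_smul, LinearMap.smul_apply, smul_eq_mul,
    Finset.sum_mul, Finset.mul_sum]
  exact Finset.sum_congr rfl fun a _ => Finset.sum_congr rfl fun b _ => by ring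

theorem IsBilinAt.gram_eq_congruence (hb : IsBilinAt h p) (hc : p ∈ (chartAt (𝔼 k) c).source)
    (s : S) :
    gram h s p = transitionMatrix s c p * gram h c p * (transitionMatrix s c p)ᵀ := by
  obtain ⟨B, hB⟩ := hb
  have hgram : ∀ c, gram h c p = Matrix.of fun i j => B (coordFrame c p i) (coordFrame c p j) :=
    fun c => Matrix.ext fun _ _ => hB _ _
  rw [hgram, hgram, of_coordFrame_eq_congruence hc]

theorem trace_congruence_inv_mul_congruence {A : Matrix (Fin k) (Fin k) ℝ} (hA : IsUnit A.det)
    (G T : Matrix (Fin k) (Fin k) ℝ) :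
    ((A * G * Aᵀ)⁻¹ * (A * T * Aᵀ)ᵀ).trace = (G⁻¹ * Tᵀ).trace := by
  have hAt : IsUnit Aᵀ.det := by rwa [Matrix.det_transpose]
  calc ((A * G * Aᵀ)⁻¹ * (A * T * Aᵀ)ᵀ).trace
      = (Aᵀ⁻¹ * (G⁻¹ * (A⁻¹ * A) * Tᵀ * Aᵀ)).trace := by
        simp only [Matrix.mul_inv_rev, Matrix.transpose_mul, Matrix.transpose_transpose,
          Matrix.mul_assoc]
    _ = (G⁻¹ * Tᵀ).trace := by
        rw [Matrix.nonsing_inv_mul _ hA, Matrix.mul_one, Matrix.trace_mul_comm,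
          Matrix.mul_nonsing_inv_cancel_right _ _ hAt]

theorem metricTrace_eq_of_charts (hb : IsBilinAt h p) (hs : p ∈ (chartAt (𝔼 k) s).source)
    (hc : p ∈ (chartAt (𝔼 k) c).source)
    (T : TangentSpace (𝓡 k) p →ₗ[ℝ] TangentSpace (𝓡 k) p →ₗ[ℝ] ℝ) :
    metricTrace h s p (fun u v => T u v) = metricTrace h c p (fun u v => T u v) := by
  have hA : IsUnit (transitionMatrix (k := k) s c p).det := by
    have hdet := congrArg Matrix.det (transitionMatrix_mul_transitionMatrix hs hc)
    rw [Matrix.det_mul, Matrix.det_one] at hdet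
    exact IsUnit.of_mul_eq_one _ hdet
  rw [metricTrace_eq_trace, metricTrace_eq_trace, hb.gram_eq_congruence hc s,
    of_coordFrame_eq_congruence hc s T, trace_congruence_inv_mul_congruence hA]

end MetricTrace

section MetricCompatibility

variable {k n : ℕ} {S : Type*} [TopologicalSpace S] [ChartedSpace (𝔼 k) S]
  {M : Type*} [TopologicalSpace M] [ChartedSpace (𝔼 n) M]
  {g : FormField n M}

theorem IsMetricAt.fderiv_metricIn_symm {c x : M} (hg : IsMetricAt g x)
    (hx : x ∈ (chartAt (𝔼 n) c).source) (u v w : 𝔼 n) :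
    fderiv ℝ (metricIn g c) (extChartAt (𝓡 n) c x) u v w
      = fderiv ℝ (metricIn g c) (extChartAt (𝓡 n) c x) u w v := by
  have hd := hg.differentiableAt hx
  have hentry : ∀ v w, fderiv ℝ (fun y => metricIn g c y v w) (extChartAt (𝓡 n) c x) u
      = fderiv ℝ (metricIn g c) (extChartAt (𝓡 n) c x) u v w := fun v w => by
    rw [fderiv_clm_apply_const (f := fun y => metricIn g c y v)
      (hd.clm_apply (differentiableAt_const v)), fderiv_clm_apply_const hd]
  have hsymm : (fun y => metricIn g c y v w) =ᶠ[𝓝 (extChartAt (𝓡 n) c x)]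
      fun y => metricIn g c y w v := (hg.metricIn_symm hx).mono fun y hy => hy v w
  rw [← hentry, ← hentry, hsymm.fderiv_eq]

variable [IsManifold (𝓡 n) ∞ M]

theorem metricIn_christoffelMap_add {c x : M} (hg : IsMetricAt g x)
    (hx : x ∈ (chartAt (𝔼 n) c).source) (u v w : 𝔼 n) :
    metricIn g c (extChartAt (𝓡 n) c x) (christoffelMap g c x u v) w
      + metricIn g c (extChartAt (𝓡 n) c x) v (christoffelMap g c x u w)
      = fderiv ℝ (metricIn g c) (extChartAt (𝓡 n) c x) u v w := by
  have hvw := koszul hg hx u v w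
  have hwv := koszul hg hx u w v
  rw [(hg.metricIn_symm hx).self_of_nhds v]
  rw [hg.fderiv_metricIn_symm hx u w v, hg.fderiv_metricIn_symm hx v w u] at hvw
  rw [hg.fderiv_metricIn_symm hx w v u] at hwv
  linarith

variable {F : S → M} {s p : S} {Y Z : ∀ q : S, TangentSpace (𝓡 n) (F q)}
  [IsManifold (𝓡 k) ∞ S]

theorem mvfderiv_bilin_comp {E : Type*} [NormedAddCommGroup E] [NormedSpace ℝ E]
    {f : E → E →L[ℝ] E →L[ℝ] ℝ} {a u w : S → E}
    (hf : DifferentiableAt ℝ f (a p)) (ha : MDifferentiableAt (𝓡 k) 𝓘(ℝ, E) a p)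
    (hu : MDifferentiableAt (𝓡 k) 𝓘(ℝ, E) u p) (hw : MDifferentiableAt (𝓡 k) 𝓘(ℝ, E) w p)
    (v : TangentSpace (𝓡 k) p) :
    mvfderiv (𝓡 k) (fun q => f (a q) (u q) (w q)) p v
      = fderiv ℝ f (a p) (mvfderiv (𝓡 k) a p v) (u p) (w p)
        + f (a p) (mvfderiv (𝓡 k) u p v) (w p) + f (a p) (u p) (mvfderiv (𝓡 k) w p v) := by
  have hp := mem_chart_source (𝔼 k) p
  have hfuw : MDifferentiableAt (𝓡 k) 𝓘(ℝ, ℝ) (fun q => f (a q) (u q) (w q)) p :=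
    ((hf.mdifferentiableAt.comp p ha).clm_apply hu).clm_apply hw
  have hsymm := extChartAt_symm_extChartAt hp
  rw [mvfderiv_eq_fderiv hfuw hp, mvfderiv_eq_fderiv ha hp, mvfderiv_eq_fderiv hu hp,
    mvfderiv_eq_fderiv hw hp,
    fderiv_comp_bilin_apply (by rwa [hsymm]) (differentiableAt_comp_extChartAt_symm ha hp)
      (differentiableAt_comp_extChartAt_symm hu hp) (differentiableAt_comp_extChartAt_symm hw hp),
    hsymm]

theorem covAlong_metric_compatible (hF : MDifferentiableAt (𝓡 k) (𝓡 n) F p)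
    (hg : IsMetricAt g (F p)) (hY : IsC1Along (k := k) F Y p) (hZ : IsC1Along (k := k) F Z p)
    (v : TangentSpace (𝓡 k) p) :
    g (F p) (covAlong g F Y p v) (Z p) + g (F p) (Y p) (covAlong g F Z p v)
      = mvfderiv (𝓡 k) (fun q => g (F q) (Y q) (Z q)) p v := by
  have hc := mem_chart_source (𝔼 n) (F p)
  have hb := hg.bilin.self_of_nhds
  have hlocal : (fun q => g (F q) (Y q) (Z q)) =ᶠ[𝓝 p] fun q => metricIn g (F p)
      (extChartAt (𝓡 n) (F p) (F q)) (comps (F p) (F q) (Y q)) (comps (F p) (F q) (Z q)) := by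
    filter_upwards [hF.continuousAt.eventually hg.bilin,
      eventually_mem_chart_source hF.continuousAt hc] with q hq hqc
    exact hq.eq_metricIn hqc _ _
  have hderiv : mvfderiv (𝓡 k) (fun q => g (F q) (Y q) (Z q)) p v
      = mvfderiv (𝓡 k) (fun q => metricIn g (F p) (extChartAt (𝓡 n) (F p) (F q))
          (comps (F p) (F q) (Y q)) (comps (F p) (F q) (Z q))) p v :=
    congrArg (fun L : TangentSpace (𝓡 k) p →L[ℝ] ℝ => L v) hlocal.mfderiv_eq
  rw [hderiv, mvfderiv_bilin_comp (f := metricIn g (F p))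
      (a := fun q => extChartAt (𝓡 n) (F p) (F q))
      (hg.differentiableAt hc) ((mdifferentiableAt_extChartAt hc).comp p hF)
      (hY.mdifferentiableAt hc) (hZ.mdifferentiableAt hc),
    ← comps_mfderiv hF hc, ← metricIn_christoffelMap_add hg hc, hb.eq_metricIn hc,
    hb.eq_metricIn hc, comps_covAlong_self _ hY, comps_covAlong_self _ hZ, covIn, covIn, map_add,
    map_add, add_apply]
  ring

theorem isC1Along_mfderiv_coordFrame (hF : ContMDiffAt (𝓡 k) (𝓡 n) ∞ F p)
    (hp : p ∈ (chartAt (𝔼 k) s).source) (j : Fin k) :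
    IsC1Along (k := k) F (fun q => mfderiv (𝓡 k) (𝓡 n) F q (coordFrame (n := k) s q j)) p := by
  intro c hc
  have hchart : ContMDiffAt (𝓡 k) 𝓘(ℝ, 𝔼 k) 1 (extChartAt (𝓡 k) s) p :=
    (contMDiffAt_extChartAt' (n := ∞) hp).of_le (mod_cast le_top)
  have hlocal : ContMDiffAt (𝓡 k) 𝓘(ℝ, 𝔼 n) 1
      (fun q => fderiv ℝ (localRep s c F) (extChartAt (𝓡 k) s q) (EuclideanSpace.single j 1)) p :=
    ((contDiffAt_fderiv_localRep hF hp hc).contMDiffAt.comp p hchart).clm_apply contMDiffAt_const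
  refine hlocal.congr_of_eventuallyEq ?_
  filter_upwards [eventually_comps_mfderiv hF hp hc,
    (chartAt (𝔼 k) s).open_source.mem_nhds hp] with q hq hqs
  rw [hq, comps_coordFrame hqs]

theorem metric_covAlong_mfderiv_coordFrame (hF : ContMDiffAt (𝓡 k) (𝓡 n) ∞ F p)
    (hg : IsMetricAt g (F p)) (hY : IsC1Along (k := k) F Y p)
    (hn : ∀ q v, g (F q) (Y q) (mfderiv (𝓡 k) (𝓡 n) F q v) = 0)
    (hp : p ∈ (chartAt (𝔼 k) s).source) (v : TangentSpace (𝓡 k) p) (j : Fin k) :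
    g (F p) (covAlong g F (fun q => mfderiv (𝓡 k) (𝓡 n) F q (coordFrame (n := k) s q j)) p v) (Y p)
      = -g (F p) (covAlong g F Y p v) (mfderiv (𝓡 k) (𝓡 n) F p (coordFrame (n := k) s p j)) := by
  have hcompat := covAlong_metric_compatible (hF.mdifferentiableAt (by simp)) hg hY
    (isC1Along_mfderiv_coordFrame hF hp j) v
  have hzero : (fun q => g (F q) (Y q) (mfderiv (𝓡 k) (𝓡 n) F q (coordFrame (n := k) s q j)))
      = fun _ => (0 : ℝ) := funext fun q => hn q _
  rw [hzero, mvfderiv_const, hg.symm.self_of_nhds (Y p), zero_apply] at hcompat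
  linarith

theorem meanCurvature_eq_of_normal (hF : ContMDiffAt (𝓡 k) (𝓡 n) ∞ F p)
    (hg : IsMetricAt g (F p)) (hY : IsC1Along (k := k) F Y p)
    (hn : ∀ q v, g (F q) (Y q) (mfderiv (𝓡 k) (𝓡 n) F q v) = 0) :
    g (F p) (meanCurvature k g F p) (Y p) = -metricTrace (pullback (k := k) F g) p p
      fun u v => g (F p) (covAlong g F Y p u) (mfderiv (𝓡 k) (𝓡 n) F p v) := by
  obtain ⟨B, hB⟩ := hg.bilin.self_of_nhds
  have hnormalPart : ∀ v, B (normalPart k g F p v) (Y p) = g (F p) v (Y p) := by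
    intro v
    rw [normalPart, map_sub, LinearMap.sub_apply, ← hB, ← hB,
      hg.symm.self_of_nhds (mfderiv _ _ _ _ _), hn, sub_zero]
  rw [hB, meanCurvature, metricTrace]
  simp only [map_sum, LinearMap.sum_apply, map_smul, LinearMap.smul_apply, hnormalPart, smul_eq_mul,
    metric_covAlong_mfderiv_coordFrame hF hg hY hn (mem_chart_source _ p), mul_neg,
    Finset.sum_neg_distrib]

end MetricCompatibility

section TraceDensity

variable {k n : ℕ} {S : Type*} [TopologicalSpace S] [ChartedSpace (𝔼 k) S]
  {M : Type*} [TopologicalSpace M] [ChartedSpace (𝔼 n) M]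

theorem pullback_comp {M' : Type*} [TopologicalSpace M'] [ChartedSpace (𝔼 n) M'] {F : S → M}
    {p : S} {φ : M → M'} {g : FormField n M'} (hφ : MDifferentiableAt (𝓡 n) (𝓡 n) φ (F p))
    (hF : MDifferentiableAt (𝓡 k) (𝓡 n) F p) :
    pullback (k := k) (fun q => φ (F q)) g p = pullback (k := k) F (pullback (k := n) φ g) p := by
  have hchain : ∀ v, mfderiv (𝓡 k) (𝓡 n) (fun q => φ (F q)) p v
      = mfderiv (𝓡 n) (𝓡 n) φ (F p) (mfderiv (𝓡 k) (𝓡 n) F p v) :=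
    mfderiv_comp_apply p hφ hF
  funext u v
  simp only [pullback, hchain]

theorem covAlong_add (g : FormField n M) (F : S → M) (Y : ∀ q : S, TangentSpace (𝓡 n) (F q))
    (p : S) (u v : TangentSpace (𝓡 k) p) :
    covAlong g F Y p (u + v) = covAlong g F Y p u + covAlong g F Y p v := by
  simp only [covAlong, connForm, map_add, PiLp.add_apply, mul_add, add_mul, add_smul,
    Finset.sum_add_distrib]
  abel

theorem covAlong_smul (g : FormField n M) (F : S → M) (Y : ∀ q : S, TangentSpace (𝓡 n) (F q))
    (p : S) (r : ℝ) (v : TangentSpace (𝓡 k) p) :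
    covAlong g F Y p (r • v) = r • covAlong g F Y p v := by
  simp only [covAlong, connForm, map_smul, PiLp.smul_apply, smul_eq_mul, mul_left_comm _ r,
    mul_assoc r, ← Finset.mul_sum, ← mul_add, ← smul_smul, ← Finset.smul_sum]

/-- The covariant derivative of a vector field along a map, as a linear map. -/
def covAlongLinear (g : FormField n M) (F : S → M) (Y : ∀ q : S, TangentSpace (𝓡 n) (F q))
    (p : S) : TangentSpace (𝓡 k) p →ₗ[ℝ] TangentSpace (𝓡 n) (F p) where
  toFun := covAlong g F Y p
  map_add' := covAlong_add g F Y p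
  map_smul' := covAlong_smul g F Y p

/-- The density `-‖ν‖ ⟨H, X⟩ + ‖ν‖⁻¹ ⟨∇_w X, ν⟩`, with the mean curvature of `F` in the normal
direction `X` expressed through the covariant derivative of `X`. -/
def traceDensity (g : FormField n M) (F : S → M) (X : ∀ q : S, TangentSpace (𝓡 n) (F q)) (p : S)
    (ν : TangentSpace (𝓡 n) (F p)) (w : TangentSpace (𝓡 k) p) : ℝ :=
  lnorm g ν * metricTrace (pullback (k := k) F g) p p
      (fun u v => g (F p) (covAlong g F X p u) (mfderiv (𝓡 k) (𝓡 n) F p v))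
    + 1 / lnorm g ν * g (F p) (covAlong g F X p w) ν

/-- The bilinear form whose trace with respect to the induced metric is `traceDensity`, for
`w` and `ν` the tangential and the normal part of `N`. -/
def densityForm (g₀ g : FormField n M) (F : S → M) (X : ∀ q : S, TangentSpace (𝓡 n) (F q)) (p : S)
    (N ν : TangentSpace (𝓡 n) (F p)) (u v : TangentSpace (𝓡 k) p) : ℝ :=
  lnorm g ν * g (F p) (covAlong g F X p u) (mfderiv (𝓡 k) (𝓡 n) F p v)
    + 1 / lnorm g ν * (g (F p) (covAlong g F X p u) ν * g₀ (F p) N (mfderiv (𝓡 k) (𝓡 n) F p v))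

theorem metricTrace_congr {h h' : FormField k S} {p : S} (heq : h p = h' p) (s : S)
    (T : TangentSpace (𝓡 k) p → TangentSpace (𝓡 k) p → ℝ) :
    metricTrace h s p T = metricTrace h' s p T := by
  simp only [metricTrace, gram_congr heq]

theorem metricTrace_mul_add_mul (h : FormField k S) (s p : S) (a b : ℝ)
    (T T' : TangentSpace (𝓡 k) p → TangentSpace (𝓡 k) p → ℝ) :
    metricTrace h s p (fun u v => a * T u v + b * T' u v)
      = a * metricTrace h s p T + b * metricTrace h s p T' := by
  simp only [metricTrace, mul_add, Finset.sum_add_distrib, Finset.mul_sum, mul_left_comm]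

variable [IsManifold (𝓡 k) ∞ S] {g₀ g : FormField n M} {F : S → M}
  {X : ∀ q : S, TangentSpace (𝓡 n) (F q)} {p s : S}

theorem map_tangentialPart (hb : IsBilinAt g (F p)) (hp : p ∈ (chartAt (𝔼 k) s).source)
    (N : TangentSpace (𝓡 n) (F p)) (L : TangentSpace (𝓡 k) p →ₗ[ℝ] ℝ) :
    L (tangentialPart g F p N) = metricTrace (pullback (k := k) F g) s p
      fun u v => L u * g (F p) N (mfderiv (𝓡 k) (𝓡 n) F p v) := by
  obtain ⟨B, hB⟩ := id hb
  let T := (LinearMap.mul ℝ ℝ).compl₁₂ L ((B N) ∘ₗ (mfderiv (𝓡 k) (𝓡 n) F p).toLinearMap)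
  have hT : ∀ u v, L u * g (F p) N (mfderiv (𝓡 k) (𝓡 n) F p v) = T u v := fun u v => by
    rw [hB]; rfl
  simp only [hT]
  rw [metricTrace_eq_of_charts hb.pullback hp (mem_chart_source _ p) T, metricTrace]
  simp only [← hT, tangentialPart, map_sum, map_smul, smul_eq_mul, mul_assoc,
    mul_comm (L _) (g _ _ _)]

theorem traceDensity_eq (hb₀ : IsBilinAt g₀ (F p)) (hb : IsBilinAt g (F p))
    (hp : p ∈ (chartAt (𝔼 k) s).source)
    (hpull : pullback (k := k) F g p = pullback (k := k) F g₀ p) (N ν : TangentSpace (𝓡 n) (F p)) :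
    traceDensity (k := k) g F X p ν (tangentialPart g₀ F p N)
      = metricTrace (pullback (k := k) F g₀) s p (densityForm g₀ g F X p N ν) := by
  obtain ⟨B, hB⟩ := id hb
  have hmap := map_tangentialPart hb₀ hp N ((B.flip ν).comp (covAlongLinear g F X p))
  have hchart := metricTrace_eq_of_charts hb.pullback (mem_chart_source _ p) hp
    (B.compl₁₂ (covAlongLinear g F X p) (mfderiv (𝓡 k) (𝓡 n) F p).toLinearMap)
  simp only [LinearMap.comp_apply, LinearMap.flip_apply, LinearMap.compl₁₂_apply,
    ContinuousLinearMap.coe_coe, ← hB, covAlongLinear, LinearMap.coe_mk, AddHom.coe_mk]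
    at hmap hchart
  rw [traceDensity, hmap, hchart, metricTrace_congr hpull s]
  exact (metricTrace_mul_add_mul (pullback (k := k) F g₀) s p _ _ _ _).symm

variable [IsManifold (𝓡 n) ∞ M] {M' : Type*} [TopologicalSpace M'] [ChartedSpace (𝔼 n) M']
  [IsManifold (𝓡 n) ∞ M']

theorem traceDensity_pullback {φ : M → M'} {g : FormField n M'} (hX : IsC1Along (k := k) F X p)
    (hφ : ContMDiffAt (𝓡 n) (𝓡 n) ∞ φ (F p)) (hF : ContMDiffAt (𝓡 k) (𝓡 n) ∞ F p)
    (hinj : Function.Injective (mfderiv (𝓡 n) (𝓡 n) φ (F p)))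
    (hg : IsMetricAt g (φ (F p))) (ν : TangentSpace (𝓡 n) (F p)) (w : TangentSpace (𝓡 k) p) :
    traceDensity g (fun q => φ (F q)) (fun q => mfderiv (𝓡 n) (𝓡 n) φ (F q) (X q)) p
      (mfderiv (𝓡 n) (𝓡 n) φ (F p) ν) w
      = traceDensity (pullback (k := n) φ g) F X p ν w := by
  have hFd := hF.mdifferentiableAt (by simp)
  have hφd := hφ.mdifferentiableAt (by simp)
  have hchain : ∀ v, mfderiv (𝓡 k) (𝓡 n) (fun q => φ (F q)) p v
      = mfderiv (𝓡 n) (𝓡 n) φ (F p) (mfderiv (𝓡 k) (𝓡 n) F p v) :=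
    mfderiv_comp_apply p hφd hFd
  simp only [traceDensity, metricTrace, covAlong_pullback hX hφ hF hinj hg, hchain,
    gram_congr (pullback_comp hφd hFd)]
  rfl

end TraceDensity

section Continuity

section Elementary

variable {T : Type*} [TopologicalSpace T] {p : T}

theorem continuousAt_matrix_inv_comp {k : ℕ} {A : T → Matrix (Fin k) (Fin k) ℝ}
    (hA : ContinuousAt A p) (hdet : (A p).det ≠ 0) : ContinuousAt (fun q => (A q)⁻¹) p := by
  have hinv : ContinuousAt Ring.inverse (A p).det := by
    simpa only [Ring.inverse_eq_inv'] using continuousAt_inv₀ hdet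
  exact (continuousAt_matrix_inv (A p) hinv).comp hA

theorem continuousAt_euclidean {n : ℕ} {f : T → 𝔼 n} :
    ContinuousAt f p ↔ ∀ a, ContinuousAt (fun q => f q a) p :=
  (PiLp.homeomorph 2 fun _ : Fin n => ℝ).isInducing.continuousAt_iff.trans continuousAt_pi

end Elementary

variable {k n : ℕ} {S : Type*} [TopologicalSpace S] [ChartedSpace (𝔼 k) S]
  {M : Type*} [TopologicalSpace M] [ChartedSpace (𝔼 n) M]

/-- The vector field `Y` along `F` is continuous at `p`. -/
def IsC0Along (F : S → M) (Y : ∀ q : S, TangentSpace (𝓡 n) (F q)) (p : S) : Prop :=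
  ∀ c, F p ∈ (chartAt (𝔼 n) c).source → ContinuousAt (fun q => comps c (F q) (Y q)) p

theorem IsC1Along.isC0Along {F : S → M} {Y : ∀ q : S, TangentSpace (𝓡 n) (F q)} {p : S}
    (hY : IsC1Along (k := k) F Y p) : IsC0Along F Y p :=
  fun c hc => (hY c hc).continuousAt

theorem continuousAt_metricTrace {h T : FormField k S} {s p : S}
    (hh : ContinuousAt (gram h s) p) (hdet : (gram h s p).det ≠ 0)
    (hT : ∀ i j, ContinuousAt (fun q => T q (coordFrame s q i) (coordFrame s q j)) p) :
    ContinuousAt (fun q => metricTrace h s q (T q)) p :=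
  tendsto_finsetSum _ fun i _ => tendsto_finsetSum _ fun j _ =>
    (continuousAt_pi.mp (continuousAt_pi.mp (continuousAt_matrix_inv_comp hh hdet) i) j).mul
      (hT i j)

section Christoffel

variable {g : FormField n M} {c x : M}

theorem IsMetricAt.continuousAt_gram (hg : IsMetricAt g x) (hx : x ∈ (chartAt (𝔼 n) c).source) :
    ContinuousAt (gram g c) x := by
  refine continuousAt_pi.mpr fun i => continuousAt_pi.mpr fun j => ?_
  refine (ContinuousAt.comp (f := extChartAt (𝓡 n) c) (hg.smooth c hx i j).continuousAt
    (continuousAt_extChartAt' (mem_extChartAt_source_of_mem_chart_source hx))).congr ?_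
  filter_upwards [(isOpen_extChartAt_source c).mem_nhds
    (mem_extChartAt_source_of_mem_chart_source hx)] with z hz
  simp only [Function.comp_apply, (extChartAt (𝓡 n) c).left_inv hz]

theorem IsMetricAt.continuousAt_partialDeriv_gram (hg : IsMetricAt g x)
    (hx : x ∈ (chartAt (𝔼 n) c).source) (l i j : Fin n) :
    ContinuousAt (partialDeriv c l fun z => gram g c z i j) x :=
  (ContinuousAt.comp (f := extChartAt (𝓡 n) c)
    ((hg.smooth c hx i j).fderiv_right (m := 0) (by norm_num)).continuousAt
    (continuousAt_extChartAt' (mem_extChartAt_source_of_mem_chart_source hx))).clm_apply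
      continuousAt_const

variable [IsManifold (𝓡 n) ∞ M]

set_option maxSynthPendingDepth 3 in
theorem IsMetricAt.continuousAt_christoffelMap (hg : IsMetricAt g x)
    (hx : x ∈ (chartAt (𝔼 n) c).source) : ContinuousAt (christoffelMap g c) x := by
  have hinv := continuousAt_matrix_inv_comp (hg.continuousAt_gram hx)
    (hg.isUnit_det_gram hx).ne_zero
  have hd := hg.continuousAt_partialDeriv_gram hx
  have hchristoffel (a m b : Fin n) : ContinuousAt (fun z => christoffel g c z a m b) x :=
    continuousAt_const.mul (tendsto_finsetSum _ fun d _ =>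
      (continuousAt_pi.mp (continuousAt_pi.mp hinv a) d).mul
        (((hd m d b).add (hd b d m)).sub (hd d m b)))
  exact tendsto_finsetSum _ fun a _ => tendsto_finsetSum _ fun m _ => tendsto_finsetSum _ fun b _ =>
    (hchristoffel a m b).smul continuousAt_const

end Christoffel

theorem IsC0Along.continuousAt_metric [IsManifold (𝓡 n) ∞ M] {g : FormField n M} {F : S → M}
    {p : S} {Y Z : ∀ q : S, TangentSpace (𝓡 n) (F q)} (hY : IsC0Along F Y p)
    (hZ : IsC0Along F Z p) (hg : IsMetricAt g (F p)) (hF : ContinuousAt F p) :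
    ContinuousAt (fun q => g (F q) (Y q) (Z q)) p := by
  have hc := mem_chart_source (𝔼 n) (F p)
  have hmetric : ContinuousAt (fun q => metricIn g (F p) (extChartAt (𝓡 n) (F p) (F q))) p :=
    ContinuousAt.comp (g := metricIn g (F p)) (hg.contDiffAt hc).continuousAt
      (ContinuousAt.comp (g := extChartAt (𝓡 n) (F p)) (continuousAt_extChartAt (F p)) hF)
  refine ((hmetric.clm_apply (hY _ hc)).clm_apply (hZ _ hc)).congr ?_
  filter_upwards [hF.eventually hg.bilin, eventually_mem_chart_source hF hc] with q hq hqc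
  exact (hq.eq_metricIn hqc _ _).symm

variable [IsManifold (𝓡 k) ∞ S] [IsManifold (𝓡 n) ∞ M] {g₀ g : FormField n M} {F : S → M}
  {X N : ∀ q : S, TangentSpace (𝓡 n) (F q)} {p s : S}

theorem isC0Along_covAlong (hF : ContMDiff (𝓡 k) (𝓡 n) ∞ F) (hg : ∀ q, IsMetricAt g (F q))
    (hX : ∀ q, IsC1Along (k := k) F X q) (hp : p ∈ (chartAt (𝔼 k) s).source) (i : Fin k) :
    IsC0Along F (fun q => covAlong g F X q (coordFrame (n := k) s q i)) p := by
  intro c hc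
  have hFp : ContinuousAt F p := hF.continuous.continuousAt
  have hΓ := ((((hg p).continuousAt_christoffelMap hc).comp hFp).clm_apply
    ((isC1Along_mfderiv_coordFrame hF.contMDiffAt hp i).isC0Along c hc)).clm_apply
      ((hX p).isC0Along c hc)
  have hfderiv := ((contDiffAt_comp_extChartAt_symm (mod_cast le_top) hp
    (hX p c hc)).fderiv_right (m := 0) (by norm_num)).continuousAt
  have hderiv := (ContinuousAt.comp (f := extChartAt (𝓡 k) s) hfderiv
    (continuousAt_extChartAt' (mem_extChartAt_source_of_mem_chart_source hp))).clm_apply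
      (continuousAt_const (y := EuclideanSpace.single i (1 : ℝ)))
  refine (hderiv.add hΓ).congr ?_
  filter_upwards [eventually_mem_chart_source hFp hc,
    (chartAt (𝔼 k) s).open_source.mem_nhds hp] with q hqc hq
  rw [comps_covAlong (hX q) (hF.mdifferentiableAt (by simp)) (hg q) hqc, covIn,
    mvfderiv_eq_fderiv ((hX q).mdifferentiableAt hqc) hq, comps_coordFrame hq]
  rfl

theorem continuousAt_gram_pullback (hF : ContMDiff (𝓡 k) (𝓡 n) ∞ F)
    (hg : IsMetricAt g (F p)) (hp : p ∈ (chartAt (𝔼 k) s).source) :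
    ContinuousAt (gram (pullback (k := k) F g) s) p :=
  continuousAt_pi.mpr fun i => continuousAt_pi.mpr fun j =>
    (isC1Along_mfderiv_coordFrame hF.contMDiffAt hp i).isC0Along.continuousAt_metric
      (isC1Along_mfderiv_coordFrame hF.contMDiffAt hp j).isC0Along hg hF.continuous.continuousAt

theorem isC0Along_normalPart (hF : ContMDiff (𝓡 k) (𝓡 n) ∞ F) (hg : ∀ q, IsMetricAt g (F q))
    (hdet : (gram (pullback (k := k) F g) p p).det ≠ 0) (hN : IsC0Along F N p) :
    IsC0Along F (fun q => normalPart k g F q (N q)) p := by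
  intro c hc
  have hp := mem_chart_source (𝔼 k) p
  have hFp : ContinuousAt F p := hF.continuous.continuousAt
  have hJ := fun j => (isC1Along_mfderiv_coordFrame (F := F) hF.contMDiffAt hp j).isC0Along
  refine continuousAt_euclidean.mpr fun a => ?_
  have htrace : ContinuousAt (fun q => metricTrace (pullback (k := k) F g) p q fun u v =>
      comps c (F q) (mfderiv (𝓡 k) (𝓡 n) F q u) a
        * g (F q) (N q) (mfderiv (𝓡 k) (𝓡 n) F q v)) p :=
    continuousAt_metricTrace (continuousAt_gram_pullback hF (hg p) hp) hdet fun i j =>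
      (continuousAt_euclidean.mp (hJ i c hc) a).mul (hN.continuousAt_metric (hJ j) (hg p) hFp)
  refine ((continuousAt_euclidean.mp (hN c hc) a).sub htrace).congr ?_
  filter_upwards [(chartAt (𝔼 k) p).open_source.mem_nhds hp] with q hq
  rw [normalPart, map_sub, PiLp.sub_apply]
  exact congrArg (comps c (F q) (N q) a - ·) (map_tangentialPart (hg q).bilin.self_of_nhds hq (N q)
    ((EuclideanSpace.proj a : 𝔼 n →L[ℝ] ℝ).toLinearMap ∘ₗ
      (comps c (F q)).toLinearMap ∘ₗ (mfderiv (𝓡 k) (𝓡 n) F q).toLinearMap)).symm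

theorem continuous_traceDensity (hF : ContMDiff (𝓡 k) (𝓡 n) ∞ F)
    (hg₀ : ∀ q, IsMetricAt g₀ (F q)) (hg : ∀ q, IsMetricAt g (F q))
    (hpull : pullback (k := k) F g = pullback (k := k) F g₀)
    (hdet : ∀ q, (gram (pullback (k := k) F g₀) q q).det ≠ 0)
    (hX : ∀ q, IsC1Along (k := k) F X q) (hN : ∀ q, IsC0Along F N q)
    (hν : ∀ q, lnorm g (normalPart k g₀ F q (N q)) ≠ 0) :
    Continuous fun q => traceDensity g F X q (normalPart k g₀ F q (N q))
      (tangentialPart (k := k) g₀ F q (N q)) := by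
  refine continuous_iff_continuousAt.mpr fun p => ?_
  have hp := mem_chart_source (𝔼 k) p
  have hFp : ContinuousAt F p := hF.continuous.continuousAt
  have hJ := fun j => (isC1Along_mfderiv_coordFrame (F := F) hF.contMDiffAt hp j).isC0Along
  have hD := isC0Along_covAlong (p := p) hF hg hX hp
  have hn := isC0Along_normalPart hF hg₀ (hdet p) (hN p)
  have hl : ContinuousAt (fun q => lnorm g (normalPart k g₀ F q (N q))) p :=
    Real.continuous_sqrt.continuousAt.comp (hn.continuousAt_metric hn (hg p) hFp).abs
  refine (continuousAt_metricTrace (continuousAt_gram_pullback hF (hg₀ p) hp) (hdet p)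
    (T := fun q => densityForm g₀ g F X q (N q) (normalPart k g₀ F q (N q)))
    fun i j => ?_).congr ?_
  · exact (hl.mul ((hD i).continuousAt_metric (hJ j) (hg p) hFp)).add
      ((continuousAt_const.div hl (hν p)).mul (((hD i).continuousAt_metric hn (hg p) hFp).mul
        ((hN p).continuousAt_metric (hJ j) (hg₀ p) hFp)))
  · filter_upwards [(chartAt (𝔼 k) p).open_source.mem_nhds hp] with q hq
    exact (traceDensity_eq (hg₀ q).bilin.self_of_nhds (hg q).bilin.self_of_nhds hq
      (congrFun hpull q) _ _).symm

end Continuity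

section VolumeContraction

open Matrix

/-- The matrix of the bilinear form `(x, y) ↦ det (x, y, u, v)` on `ℝ⁴`; its entries are those of
the Hodge dual of `u ∧ v`. -/
def hodgeMatrix (u v : Fin 4 → ℝ) : Matrix (Fin 4) (Fin 4) ℝ :=
  !![0, u 2 * v 3 - u 3 * v 2, u 3 * v 1 - u 1 * v 3, u 1 * v 2 - u 2 * v 1;
    u 3 * v 2 - u 2 * v 3, 0, u 0 * v 3 - u 3 * v 0, u 2 * v 0 - u 0 * v 2;
    u 1 * v 3 - u 3 * v 1, u 3 * v 0 - u 0 * v 3, 0, u 0 * v 1 - u 1 * v 0;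
    u 2 * v 1 - u 1 * v 2, u 0 * v 2 - u 2 * v 0, u 1 * v 0 - u 0 * v 1, 0]

theorem dotProduct_hodgeMatrix_mulVec (x y u v : Fin 4 → ℝ) :
    x ⬝ᵥ hodgeMatrix u v *ᵥ y = Matrix.det (Matrix.of ![x, y, u, v]) := by
  simp only [hodgeMatrix, Matrix.det_succ_row_zero, Fin.sum_univ_succ, mulVec, dotProduct]
  simp [Fin.succAbove]
  ring

theorem hodgeMatrix_apply (u v : Fin 4 → ℝ) (a d : Fin 4) :
    hodgeMatrix u v a d = Matrix.det (Matrix.of ![Pi.single a 1, Pi.single d 1, u, v]) := by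
  rw [← dotProduct_hodgeMatrix_mulVec]
  simp

theorem transpose_mul_hodgeMatrix_mulVec_mul (P : Matrix (Fin 4) (Fin 4) ℝ) (u v : Fin 4 → ℝ) :
    Pᵀ * hodgeMatrix (P *ᵥ u) (P *ᵥ v) * P = P.det • hodgeMatrix u v := by
  ext i j
  have hrows : Matrix.of ![P *ᵥ Pi.single i 1, P *ᵥ Pi.single j 1, P *ᵥ u, P *ᵥ v]
      = Matrix.of ![Pi.single i 1, Pi.single j 1, u, v] * Pᵀ := by
    ext r s
    fin_cases r <;> simp [Matrix.mul_apply, mulVec, dotProduct, mul_comm, Pi.single_apply]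
  calc (Pᵀ * hodgeMatrix (P *ᵥ u) (P *ᵥ v) * P) i j
      = (P *ᵥ Pi.single i 1) ⬝ᵥ hodgeMatrix (P *ᵥ u) (P *ᵥ v) *ᵥ (P *ᵥ Pi.single j 1) := by
        rw [dotProduct_mulVec, vecMul_mulVec, ← dotProduct_mulVec, mulVec_mulVec]
        simp
    _ = P.det * hodgeMatrix u v i j := by
        rw [dotProduct_hodgeMatrix_mulVec, hrows, det_mul, det_transpose, mul_comm,
          hodgeMatrix_apply]

theorem leviCivita_eq_hodgeMatrix (a d m s : Fin 4) :
    leviCivita a d m s = hodgeMatrix (Pi.single m 1) (Pi.single s 1) a d := by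
  rw [hodgeMatrix_apply]
  refine congrArg Matrix.det ?_
  ext i j
  fin_cases i <;> simp [Pi.single_apply, eq_comm]

theorem sum_leviCivita_mul (a d : Fin 4) (u v : Fin 4 → ℝ) :
    ∑ m, ∑ s, leviCivita a d m s * (u m * v s - u s * v m) = 2 * hodgeMatrix u v a d := by
  simp only [leviCivita_eq_hodgeMatrix, hodgeMatrix]
  fin_cases a <;> fin_cases d <;> simp [Fin.sum_univ_four] <;> ring

/-- The contraction `B^{ad} ε_{adms} u^m v^s`. -/
def volContraction (B : Matrix (Fin 4) (Fin 4) ℝ) (u v : Fin 4 → ℝ) : ℝ :=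
  (Bᵀ * hodgeMatrix u v).trace

theorem volContraction_congruence (P b : Matrix (Fin 4) (Fin 4) ℝ) (u v : Fin 4 → ℝ) :
    volContraction (P * b * Pᵀ) (P *ᵥ u) (P *ᵥ v) = P.det * volContraction b u v := by
  rw [volContraction, volContraction, transpose_mul, transpose_mul, transpose_transpose,
    Matrix.trace_mul_comm, ← Matrix.mul_assoc, ← Matrix.mul_assoc, Matrix.trace_mul_comm,
    ← Matrix.mul_assoc, ← Matrix.mul_assoc, transpose_mul_hodgeMatrix_mulVec_mul,
    Matrix.smul_mul, Matrix.trace_smul, Matrix.trace_mul_comm, smul_eq_mul]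

theorem volContraction_of_transpose_eq_neg {b : Matrix (Fin 4) (Fin 4) ℝ} (hb : bᵀ = -b)
    (w : Fin 2 → ℝ) :
    volContraction b ![1, 0, w 0, w 1] (Pi.single 3 1) = 2 * (b 1 2 + w 0 * b 0 1) ∧
    volContraction b ![1, 0, w 0, w 1] (Pi.single 2 1) = -(2 * (b 1 3 + w 1 * b 0 1)) := by
  have h : ∀ i j, b j i = -b i j := fun i j => congrFun (congrFun hb i) j
  simp only [volContraction, hodgeMatrix, Matrix.trace, Fin.sum_univ_four, Matrix.diag_apply,
    Matrix.mul_apply, Matrix.transpose_apply, h 0 1, h 1 2, h 1 3]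
  constructor <;> simp <;> ring

/-- The Gram matrix of a frame `(N, X, e₀, e₁)` of a spacetime along a surface: `N` is timelike of
length `ν`, `X` is a unit vector, both are normal to the surface and orthogonal to each other, and
`h` is the Gram matrix of the tangent frame `(e₀, e₁)`. -/
def adaptedGram (ν : ℝ) (h : Matrix (Fin 2) (Fin 2) ℝ) : Matrix (Fin 4) (Fin 4) ℝ :=
  !![-ν ^ 2, 0, 0, 0; 0, 1, 0, 0; 0, 0, h 0 0, h 0 1; 0, 0, h 1 0, h 1 1]

theorem det_adaptedGram (ν : ℝ) (h : Matrix (Fin 2) (Fin 2) ℝ) :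
    (adaptedGram ν h).det = -ν ^ 2 * h.det := by
  rw [Matrix.det_fin_two h]
  simp only [adaptedGram, Matrix.det_succ_row_zero, Fin.sum_univ_succ]
  simp [Fin.succAbove, -mul_eq_mul_left_iff]
  ring

theorem adaptedGram_mul_mul_adaptedGram (ν : ℝ) (h : Matrix (Fin 2) (Fin 2) ℝ)
    (b : Matrix (Fin 4) (Fin 4) ℝ) :
    (adaptedGram ν h * b * adaptedGram ν h) 1 0 = -ν ^ 2 * b 1 0 ∧
      ∀ j, (adaptedGram ν h * b * adaptedGram ν h) 1 (![2, 3] j)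
        = ∑ k, b 1 (![2, 3] k) * h k j := by
  refine ⟨?_, fun j => ?_⟩
  · simp [adaptedGram, Matrix.mul_apply, Fin.sum_univ_four, vecMul, dotProduct, mul_comm]
  · fin_cases j <;>
      simp [adaptedGram, Matrix.mul_apply, Fin.sum_univ_four, vecMul, dotProduct]

variable {G P : Matrix (Fin 4) (Fin 4) ℝ} {h : Matrix (Fin 2) (Fin 2) ℝ} {ν : ℝ}

theorem sqrt_neg_det_mul_det {σ τ : ℝ} (hν : 0 < ν) (hD : Pᵀ * G * P = adaptedGram ν h)
    (hσ : |σ| = 1) (hτ : |τ| = 1) (hpos : 0 < τ * (σ * P.det)) :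
    τ * (σ * Real.sqrt (-G.det) * P.det) = ν * Real.sqrt h.det := by
  have habs : τ * (σ * P.det) = |P.det| := by
    rw [← abs_of_pos hpos, abs_mul, abs_mul, hσ, hτ, one_mul, one_mul]
  have hdet : -G.det * (P.det * P.det) = ν ^ 2 * h.det := by
    have := congrArg Matrix.det hD
    rw [det_mul, det_mul, det_transpose, det_adaptedGram] at this
    linear_combination -this
  calc τ * (σ * Real.sqrt (-G.det) * P.det) = Real.sqrt (-G.det) * |P.det| := by
        rw [← habs]; ring
    _ = Real.sqrt (-G.det * (P.det * P.det)) := by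
        rw [Real.sqrt_mul' _ (mul_self_nonneg _), Real.sqrt_mul_self_eq_abs]
    _ = ν * Real.sqrt h.det := by rw [hdet, Real.sqrt_mul (by positivity), Real.sqrt_sq hν.le]

theorem exists_skew_of_skewAdjoint {ι : Type*} [Fintype ι] [DecidableEq ι] {G P A : Matrix ι ι ℝ}
    (hG : Gᵀ = G) (hdet : IsUnit (Pᵀ * G * P).det) (hA : Aᵀ * G + G * A = 0) :
    ∃ b : Matrix ι ι ℝ, bᵀ = -b ∧ A * G⁻¹ = P * b * Pᵀ ∧
      Pᵀ * Aᵀ * G * P = -(Pᵀ * G * P * b * (Pᵀ * G * P)) := by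
  rw [det_mul, det_mul] at hdet
  have hPt : IsUnit Pᵀ.det := isUnit_of_mul_isUnit_left (isUnit_of_mul_isUnit_left hdet)
  have hGu : IsUnit G.det := isUnit_of_mul_isUnit_right (isUnit_of_mul_isUnit_left hdet)
  have hP : IsUnit P.det := isUnit_of_mul_isUnit_right hdet
  have hAt : Aᵀ * G = -(G * A) := eq_neg_of_add_eq_zero_left hA
  have hskew : (A * G⁻¹)ᵀ = -(A * G⁻¹) := by
    calc (A * G⁻¹)ᵀ = G⁻¹ * (Aᵀ * G) * G⁻¹ := by
          rw [transpose_mul, transpose_nonsing_inv, hG, Matrix.mul_assoc, Matrix.mul_assoc,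
            mul_nonsing_inv _ hGu, Matrix.mul_one]
      _ = -(A * G⁻¹) := by
          rw [hAt, Matrix.mul_neg, nonsing_inv_mul_cancel_left _ _ hGu, Matrix.neg_mul]
  have hb : A * G⁻¹ = P * (P⁻¹ * (A * G⁻¹) * (Pᵀ)⁻¹) * Pᵀ := by
    simp only [Matrix.mul_assoc]
    rw [nonsing_inv_mul _ hPt, Matrix.mul_one, mul_nonsing_inv_cancel_left _ _ hP]
  refine ⟨P⁻¹ * (A * G⁻¹) * (Pᵀ)⁻¹, ?_, hb, ?_⟩
  · rw [transpose_mul, transpose_mul, hskew, transpose_nonsing_inv, transpose_nonsing_inv,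
      transpose_transpose, Matrix.neg_mul, Matrix.mul_neg]
    simp only [Matrix.mul_assoc]
  · calc Pᵀ * Aᵀ * G * P = -(Pᵀ * G * (A * G⁻¹) * G * P) := by
          rw [Matrix.mul_assoc Pᵀ, hAt]
          simp only [Matrix.mul_assoc, nonsing_inv_mul_cancel_left _ _ hGu, Matrix.mul_neg,
            Matrix.neg_mul]
      _ = -(Pᵀ * G * P * (P⁻¹ * (A * G⁻¹) * (Pᵀ)⁻¹) * (Pᵀ * G * P)) := by
          nth_rewrite 1 [hb]
          simp only [Matrix.mul_assoc]

theorem sum_inv_mul_sum_mul (hh : hᵀ = h) (hdet : IsUnit h.det) (T : Matrix (Fin 2) (Fin 2) ℝ) :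
    ∑ i, ∑ j, h⁻¹ i j * ∑ k, T i k * h k j = T.trace := by
  calc ∑ i, ∑ j, h⁻¹ i j * ∑ k, T i k * h k j = (h⁻¹ * (T * h)ᵀ).trace := by
        simp only [Matrix.trace, Matrix.diag_apply, Matrix.mul_apply, Matrix.transpose_apply]
    _ = T.trace := by
        rw [transpose_mul, hh, nonsing_inv_mul_cancel_left _ _ hdet, trace_transpose]

theorem volContraction_eq_trace {A : Fin 2 → Matrix (Fin 4) (Fin 4) ℝ} {w : Fin 2 → ℝ}
    (hν : 0 < ν) (hh : hᵀ = h) (hdet : 0 < h.det) (hG : Gᵀ = G)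
    (hD : Pᵀ * G * P = adaptedGram ν h) (hA : ∀ i, (A i)ᵀ * G + G * A i = 0) :
    -volContraction (A 0 * G⁻¹) (P *ᵥ ![1, 0, w 0, w 1]) (P *ᵥ Pi.single 3 1)
        + volContraction (A 1 * G⁻¹) (P *ᵥ ![1, 0, w 0, w 1]) (P *ᵥ Pi.single 2 1)
      = 2 * P.det * (∑ i, ∑ j, h⁻¹ i j * (Pᵀ * (A i)ᵀ * G * P) 1 (![2, 3] j)
          + 1 / ν ^ 2 * ∑ i, w i * (Pᵀ * (A i)ᵀ * G * P) 1 0) := by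
  have hDdet : IsUnit (Pᵀ * G * P).det := by
    rw [hD, det_adaptedGram, isUnit_iff_ne_zero]
    exact mul_ne_zero (neg_ne_zero.mpr (by positivity)) hdet.ne'
  choose b hskew hAb hT using fun i => exists_skew_of_skewAdjoint hG hDdet (hA i)
  rw [hAb, hAb, volContraction_congruence, volContraction_congruence,
    (volContraction_of_transpose_eq_neg (hskew 0) w).1,
    (volContraction_of_transpose_eq_neg (hskew 1) w).2]
  have tangential : ∑ i, ∑ j, h⁻¹ i j * (Pᵀ * (A i)ᵀ * G * P) 1 (![2, 3] j)
      = -(b 0 1 2 + b 1 1 3) := by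
    have := sum_inv_mul_sum_mul hh hdet.ne'.isUnit (Matrix.of fun i k => b i 1 (![2, 3] k))
    simp only [hT, hD, Matrix.neg_apply, (adaptedGram_mul_mul_adaptedGram ν h _).2, mul_neg,
      Finset.sum_neg_distrib]
    exact congrArg Neg.neg (this.trans (Matrix.trace_fin_two _))
  have normal : ∀ i, 1 / ν ^ 2 * (w i * (Pᵀ * (A i)ᵀ * G * P) 1 0) = -(w i * b i 0 1) :=
    fun i => by
      have hanti : b i 1 0 = -b i 0 1 := congrFun (congrFun (hskew i) 0) 1
      rw [hT, hD, Matrix.neg_apply, (adaptedGram_mul_mul_adaptedGram ν h _).1, hanti]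
      field_simp
  rw [tangential, Finset.mul_sum, Fin.sum_univ_two, normal, normal]
  ring

end VolumeContraction

section ConnectionDifference

open Matrix

variable {k n : ℕ} {S : Type*} [TopologicalSpace S] [ChartedSpace (𝔼 k) S]
  {M : Type*} [TopologicalSpace M] [ChartedSpace (𝔼 n) M]

/-- The matrix `ω'(u) - ω(u)` of the difference of the Levi-Civita connections of `g'` and `g` in
direction `u`, in the coordinate frame of the chart centred at `x`. -/
def connDiff (g g' : FormField n M) (x : M) (u : TangentSpace (𝓡 n) x) :
    Matrix (Fin n) (Fin n) ℝ :=
  Matrix.of fun a b => connForm g' x x a b u - connForm g x x a b u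

theorem connDiff_mulVec (g g' : FormField n M) (x : M) (u : TangentSpace (𝓡 n) x) (v : 𝔼 n) :
    connDiff g g' x u *ᵥ v.ofLp
      = (christoffelMap g' x x (comps x x u) v - christoffelMap g x x (comps x x u) v).ofLp := by
  funext a
  simp only [connDiff, mulVec, dotProduct, Matrix.of_apply, sub_mul, Finset.sum_sub_distrib,
    WithLp.ofLp_sub, Pi.sub_apply, christoffelMap_comps]

variable [IsManifold (𝓡 n) ∞ M] {g g' : FormField n M} {F : S → M} {p : S}

theorem comps_covAlong_sub {X : ∀ q : S, TangentSpace (𝓡 n) (F q)}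
    (hX : IsC1Along (k := k) F X p) (v : TangentSpace (𝓡 k) p) :
    (comps (F p) (F p) (covAlong g' F X p v - covAlong g F X p v)).ofLp
      = connDiff g g' (F p) (mfderiv (𝓡 k) (𝓡 n) F p v) *ᵥ (comps (F p) (F p) (X p)).ofLp := by
  rw [map_sub, comps_covAlong_self g' hX, comps_covAlong_self g hX, covIn, covIn,
    add_sub_add_left_eq_sub, connDiff_mulVec]

variable [IsManifold (𝓡 k) ∞ S]

set_option maxSynthPendingDepth 3 in
theorem fderiv_metricIn_eq_of_agree (hg : IsMetricAt g (F p)) (hg' : IsMetricAt g' (F p))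
    (hF : ContMDiffAt (𝓡 k) (𝓡 n) ∞ F p) (heq : ∀ᶠ q in 𝓝 p, g' (F q) = g (F q))
    (e : TangentSpace (𝓡 k) p) :
    fderiv ℝ (metricIn g' (F p)) (extChartAt (𝓡 n) (F p) (F p))
        (comps (F p) (F p) (mfderiv (𝓡 k) (𝓡 n) F p e))
      = fderiv ℝ (metricIn g (F p)) (extChartAt (𝓡 n) (F p) (F p))
        (comps (F p) (F p) (mfderiv (𝓡 k) (𝓡 n) F p e)) := by
  have hp := mem_chart_source (𝔼 k) p
  have hx := mem_chart_source (𝔼 n) (F p)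
  have hψ := (contDiffAt_localRep hF hp hx).differentiableAt (by simp)
  have chain : ∀ {γ : FormField n M}, IsMetricAt γ (F p) →
      fderiv ℝ (metricIn γ (F p) ∘ localRep p (F p) F) (extChartAt (𝓡 k) p p) (comps p p e)
        = fderiv ℝ (metricIn γ (F p)) (extChartAt (𝓡 n) (F p) (F p))
          (fderiv ℝ (localRep p (F p) F) (extChartAt (𝓡 k) p p) (comps p p e)) := by
    intro γ hγ
    have hd := hγ.differentiableAt hx
    rw [← localRep_extChartAt hp (F p) F] at hd ⊢
    rw [fderiv_comp _ hd hψ]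
    rfl
  have hlocal : metricIn g' (F p) ∘ localRep p (F p) F
      =ᶠ[𝓝 (extChartAt (𝓡 k) p p)] metricIn g (F p) ∘ localRep p (F p) F := by
    filter_upwards [(tendsto_extChartAt_symm hp).eventually
      ((eventually_mem_chart_source hF.continuousAt hx).and heq)] with y ⟨hy, hgy⟩
    ext u v
    simp only [Function.comp_apply, localRep, metricIn_extChartAt hy, gram_congr hgy]
  rw [comps_mfderiv_eq_fderiv_localRep (hF.mdifferentiableAt (by simp)) hp hx, ← chain hg,
    ← chain hg', hlocal.fderiv_eq]

theorem connDiff_skewAdjoint (hg : IsMetricAt g (F p)) (hg' : IsMetricAt g' (F p))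
    (hF : ContMDiffAt (𝓡 k) (𝓡 n) ∞ F p) (heq : ∀ᶠ q in 𝓝 p, g' (F q) = g (F q))
    (e : TangentSpace (𝓡 k) p) :
    (connDiff g g' (F p) (mfderiv (𝓡 k) (𝓡 n) F p e))ᵀ * gram g (F p) (F p)
      + gram g (F p) (F p) * connDiff g g' (F p) (mfderiv (𝓡 k) (𝓡 n) F p e) = 0 := by
  have hx := mem_chart_source (𝔼 n) (F p)
  set u := mfderiv (𝓡 k) (𝓡 n) F p e
  have hform : ∀ (v w : 𝔼 n), (connDiff g g' (F p) u *ᵥ v.ofLp) ⬝ᵥ gram g (F p) (F p) *ᵥ w.ofLp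
      + v.ofLp ⬝ᵥ gram g (F p) (F p) *ᵥ (connDiff g g' (F p) u *ᵥ w.ofLp) = 0 := by
    intro v w
    have hsum := metricIn_christoffelMap_add hg hx (comps (F p) (F p) u) v w
    have hsum' := metricIn_christoffelMap_add hg' hx (comps (F p) (F p) u) v w
    rw [fderiv_metricIn_eq_of_agree hg hg' hF heq, ← hsum] at hsum'
    simp only [metricIn_extChartAt hx, gram_congr heq.self_of_nhds] at hsum'
    simp only [connDiff_mulVec, WithLp.ofLp_sub, sub_dotProduct, mulVec_sub, dotProduct_sub]
    linarith
  ext a b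
  have hab := hform (EuclideanSpace.single a 1) (EuclideanSpace.single b 1)
  rw [dotProduct_mulVec, vecMul_mulVec, ← dotProduct_mulVec, mulVec_mulVec,
    ← dotProduct_add, ← add_mulVec] at hab
  simpa using hab

end ConnectionDifference

section Frames

open Matrix

variable {n m : ℕ} {M : Type*} [TopologicalSpace M] [ChartedSpace (𝔼 n) M] {c x : M}

theorem abs_sign (o : ManifoldOrientation n M) (c x : M) : |o.sign c x| = 1 := by
  rw [ManifoldOrientation.sign]
  split_ifs <;> simp

/-- The matrix whose columns are the components of the vectors `E` in the chart centred at `c`. -/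
def frameMatrix (c x : M) (E : Fin m → TangentSpace (𝓡 n) x) : Matrix (Fin n) (Fin m) ℝ :=
  Matrix.of fun a α => comps c x (E α) a

theorem frameMatrix_mulVec (E : Fin m → TangentSpace (𝓡 n) x) (z : Fin m → ℝ) :
    frameMatrix c x E *ᵥ z = (comps c x (∑ α, z α • E α)).ofLp := by
  funext a
  simp [frameMatrix, mulVec, dotProduct, mul_comm]

variable [IsManifold (𝓡 n) ∞ M]

/-- The coordinate frame of a chart as a basis of the tangent space. -/
def coordBasis (hx : x ∈ (chartAt (𝔼 n) c).source) :
    Module.Basis (Fin n) ℝ (TangentSpace (𝓡 n) x) :=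
  Module.Basis.ofEquivFun
    ((LinearEquiv.ofBijective (comps c x).toLinearMap (isInvertible_comps hx).bijective).trans
      (WithLp.linearEquiv 2 ℝ (Fin n → ℝ)))

theorem coordBasis_repr (hx : x ∈ (chartAt (𝔼 n) c).source) (v : TangentSpace (𝓡 n) x)
    (a : Fin n) : (coordBasis hx).repr v a = comps c x v a := rfl

theorem coordBasis_apply (hx : x ∈ (chartAt (𝔼 n) c).source) (i : Fin n) :
    coordBasis hx i = coordFrame c x i := by
  apply (coordBasis hx).repr.injective
  ext a
  rw [Module.Basis.repr_self, coordBasis_repr, comps_coordFrame hx]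
  simp [Finsupp.single_apply, eq_comm]

theorem isPositiveFrame_coordFrame_iff (hx : x ∈ (chartAt (𝔼 n) c).source)
    (o : Orientation ℝ (TangentSpace (𝓡 n) x) (Fin n)) :
    IsPositiveFrame o (coordFrame c x) ↔ (coordBasis hx).orientation = o := by
  constructor
  · rintro ⟨b, hb, rfl⟩
    have hbasis : coordBasis hx = b := Module.Basis.eq_of_apply_eq fun i => by
      rw [coordBasis_apply, hb]
    rw [hbasis]
  · exact fun h => ⟨coordBasis hx, coordBasis_apply hx, h⟩

theorem sign_mul_det_frameMatrix_pos (o : ManifoldOrientation n M)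
    (hx : x ∈ (chartAt (𝔼 n) c).source) {E : Fin n → TangentSpace (𝓡 n) x}
    (hE : IsPositiveFrame (o.at' x) E) : 0 < o.sign c x * (frameMatrix c x E).det := by
  obtain ⟨b, hb, hbo⟩ := hE
  have hdet : (coordBasis hx).det b = (frameMatrix c x E).det := by
    rw [Module.Basis.det_apply]
    congr 1
    ext i j
    rw [Module.Basis.toMatrix_apply, coordBasis_repr, hb, frameMatrix, Matrix.of_apply]
  have hiff := (coordBasis hx).orientation_eq_iff_det_pos b
  rw [hdet, hbo, ← isPositiveFrame_coordFrame_iff] at hiff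
  have hne : (frameMatrix c x E).det ≠ 0 := hdet ▸ ((coordBasis hx).isUnit_det b).ne_zero
  rw [ManifoldOrientation.sign]
  split_ifs with h
  · simpa using hiff.mp h
  · have := lt_of_le_of_ne (not_lt.mp fun hpos => h (hiff.mpr hpos)) hne
    linarith

theorem isPositiveFrame_update_neg [NeZero n] (hx : x ∈ (chartAt (𝔼 n) c).source)
    {o : Orientation ℝ (TangentSpace (𝓡 n) x) (Fin n)}
    (h : ¬ IsPositiveFrame o (coordFrame c x)) :
    IsPositiveFrame o (Function.update (coordFrame c x) 0 (-coordFrame c x 0)) := by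
  rw [isPositiveFrame_coordFrame_iff hx] at h
  refine ⟨(coordBasis hx).unitsSMul (Function.update 1 0 (-1)), fun i => ?_, ?_⟩
  · rw [Module.Basis.unitsSMul_apply, coordBasis_apply]
    by_cases hi : i = 0
    · subst hi; simp
    · simp [Function.update_of_ne hi]
  · rw [Module.Basis.orientation_neg_single]
    exact (((coordBasis hx).orientation_ne_iff_eq_neg o).mp (Ne.symm h)).symm

theorem IsBilinAt.eq_dotProduct_gram {g : FormField n M} (hb : IsBilinAt g x)
    (hx : x ∈ (chartAt (𝔼 n) c).source) (u v : TangentSpace (𝓡 n) x) :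
    g x u v = (comps c x u).ofLp ⬝ᵥ gram g c x *ᵥ (comps c x v).ofLp := by
  rw [hb.eq_metricIn hx, metricIn_extChartAt hx]

theorem transpose_frameMatrix_mul_mul {g : FormField n M} (hx : x ∈ (chartAt (𝔼 n) c).source)
    (hb : IsBilinAt g x) (E : Fin m → TangentSpace (𝓡 n) x) :
    (frameMatrix c x E)ᵀ * gram g c x * frameMatrix c x E
      = Matrix.of fun α β => g x (E α) (E β) := by
  ext α β
  rw [Matrix.of_apply, hb.eq_dotProduct_gram hx, Matrix.mul_assoc]
  rfl

end Frames

section NormalPart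

open Matrix

variable {k n : ℕ} {S : Type*} [TopologicalSpace S] [ChartedSpace (𝔼 k) S]
  {M : Type*} [TopologicalSpace M] [ChartedSpace (𝔼 n) M]

theorem normalPart_add_tangentialPart (g : FormField n M) (F : S → M) {p : S}
    (N : TangentSpace (𝓡 n) (F p)) :
    normalPart k g F p N + mfderiv (𝓡 k) (𝓡 n) F p (tangentialPart g F p N) = N :=
  sub_add_cancel _ _

variable [IsManifold (𝓡 k) ∞ S]

theorem posDef_gram {h : FormField k S} {s p : S} (hp : p ∈ (chartAt (𝔼 k) s).source)
    (hb : IsBilinAt h p) (hs : ∀ u v, h p u v = h p v u) (hpos : ∀ v, v ≠ 0 → 0 < h p v v) :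
    (gram h s p).PosDef := by
  refine PosDef.of_dotProduct_mulVec_pos (gram_transpose hs s) fun x hx => ?_
  obtain ⟨v, hv⟩ := (isInvertible_comps hp).bijective.surjective (WithLp.toLp 2 x)
  have hne : v ≠ 0 := by
    rintro rfl
    rw [map_zero] at hv
    exact hx (congrArg WithLp.ofLp hv).symm
  have := hpos v hne
  rwa [hb.eq_dotProduct_gram hp, hv] at this

variable {g : FormField n M} {F : S → M} {p : S}

theorem metric_mfderiv_tangentialPart (hb : IsBilinAt g (F p))
    (hs : ∀ u v, g (F p) u v = g (F p) v u) (hdet : IsUnit (gram (pullback (k := k) F g) p p).det)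
    (N : TangentSpace (𝓡 n) (F p)) (v : TangentSpace (𝓡 k) p) :
    g (F p) (mfderiv (𝓡 k) (𝓡 n) F p (tangentialPart g F p N)) (mfderiv (𝓡 k) (𝓡 n) F p v)
      = g (F p) N (mfderiv (𝓡 k) (𝓡 n) F p v) := by
  have hp := mem_chart_source (𝔼 k) p
  obtain ⟨B, hB⟩ := id hb
  let L := B.compl₁₂ (mfderiv (𝓡 k) (𝓡 n) F p).toLinearMap (mfderiv (𝓡 k) (𝓡 n) F p).toLinearMap
  have hL : ∀ u v, L u v = pullback F g p u v := fun u v => (hB _ _).symm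
  have hframe : ∀ j, L (tangentialPart g F p N) (coordFrame p p j)
      = B N (mfderiv (𝓡 k) (𝓡 n) F p (coordFrame p p j)) := by
    intro j
    set K := gram (pullback (k := k) F g) p p with hK
    set b : Fin k → ℝ := fun l => B N (mfderiv (𝓡 k) (𝓡 n) F p (coordFrame p p l)) with hbdef
    have hKsymm : ∀ i, K i j = K j i := fun _ => hs _ _
    calc L (tangentialPart g F p N) (coordFrame p p j)
        = ∑ i, ∑ l, K⁻¹ i l * (K i j * b l) := by
          refine (map_tangentialPart hb hp N (L.flip (coordFrame p p j))).trans ?_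
          simp only [metricTrace, LinearMap.flip_apply, hL, hB, hK, hbdef]
          rfl
      _ = (K *ᵥ (K⁻¹ *ᵥ b)) j := by
          simp only [mulVec, dotProduct, Finset.mul_sum, hKsymm, mul_left_comm]
      _ = b j := by rw [mulVec_mulVec, mul_nonsing_inv _ hdet, one_mulVec]
  change pullback F g p (tangentialPart g F p N) v = _
  rw [← hL, hB, ← sum_comps_smul_coordFrame hp v]
  simp only [map_sum, map_smul, hframe]

theorem normalPart_orthogonal (hb : IsBilinAt g (F p)) (hs : ∀ u v, g (F p) u v = g (F p) v u)
    (hdet : IsUnit (gram (pullback (k := k) F g) p p).det) (N : TangentSpace (𝓡 n) (F p))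
    (v : TangentSpace (𝓡 k) p) :
    g (F p) (normalPart k g F p N) (mfderiv (𝓡 k) (𝓡 n) F p v) = 0 := by
  have htangential := metric_mfderiv_tangentialPart hb hs hdet N v
  obtain ⟨B, hB⟩ := hb
  rw [hB, hB] at htangential
  rw [hB, normalPart, map_sub, LinearMap.sub_apply, htangential, sub_self]

theorem metric_self_eq_normalPart_add (hb : IsBilinAt g (F p))
    (hs : ∀ u v, g (F p) u v = g (F p) v u) (hdet : IsUnit (gram (pullback (k := k) F g) p p).det)
    (N : TangentSpace (𝓡 n) (F p)) :
    g (F p) N N = g (F p) (normalPart k g F p N) (normalPart k g F p N)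
      + pullback (k := k) F g p (tangentialPart g F p N) (tangentialPart g F p N) := by
  have hνt := normalPart_orthogonal hb hs hdet N (tangentialPart g F p N)
  have htν := (hs _ _).trans hνt
  obtain ⟨B, hB⟩ := hb
  rw [hB] at hνt htν
  conv_lhs => rw [← normalPart_add_tangentialPart (k := k) g F N]
  rw [pullback, hB, hB, hB, map_add, map_add, LinearMap.add_apply, LinearMap.add_apply, hνt,
    htν, add_zero, zero_add]

end NormalPart

section NormalFrame

variable {k n : ℕ} {S : Type*} [TopologicalSpace S] [ChartedSpace (𝔼 k) S]
  {M : Type*} [TopologicalSpace M] [ChartedSpace (𝔼 n) M]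

/-- `ν` and `X` are normal to `F` at `p` and orthogonal to each other, `ν` is timelike, and `X` is a
unit vector. For a spacelike surface in a spacetime this is an orthogonal frame of the normal
plane. -/
structure IsNormalFrame (k : ℕ) [ChartedSpace (𝔼 k) S] (g : FormField n M) (F : S → M) (p : S)
    (ν X : TangentSpace (𝓡 n) (F p)) : Prop where
  timelike : g (F p) ν ν < 0
  unit : g (F p) X X = 1
  orthogonal : g (F p) X ν = 0
  normal_left : ∀ v, g (F p) ν (mfderiv (𝓡 k) (𝓡 n) F p v) = 0
  normal_right : ∀ v, g (F p) X (mfderiv (𝓡 k) (𝓡 n) F p v) = 0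

variable {g : FormField n M} {F : S → M} {p : S} {X N : TangentSpace (𝓡 n) (F p)}

theorem IsNormalFrame.lnorm_pos {ν : TangentSpace (𝓡 n) (F p)} (h : IsNormalFrame k g F p ν X) :
    0 < lnorm g ν :=
  Real.sqrt_pos.mpr (abs_pos.mpr h.timelike.ne)

variable [IsManifold (𝓡 k) ∞ S]

theorem isNormalFrame_normalPart (hb : IsBilinAt g (F p)) (hs : ∀ u v, g (F p) u v = g (F p) v u)
    (hpos : ∀ v, v ≠ 0 → 0 < pullback (k := k) F g p v v) (hN : g (F p) N N < 0)
    (hX : g (F p) X X = 1) (hXt : ∀ v, g (F p) X (mfderiv (𝓡 k) (𝓡 n) F p v) = 0)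
    (hXN : g (F p) X N = 0) : IsNormalFrame k g F p (normalPart k g F p N) X := by
  have hdet := (posDef_gram (mem_chart_source _ p) hb.pullback (fun _ _ => hs _ _) hpos).det_pos
  have hnonneg : ∀ v, 0 ≤ pullback (k := k) F g p v v := fun v => by
    rcases eq_or_ne v 0 with rfl | hv
    · obtain ⟨B, hB⟩ := hb
      rw [pullback, hB, map_zero, map_zero]
    · exact (hpos v hv).le
  refine ⟨?_, hX, ?_, normalPart_orthogonal hb hs hdet.ne'.isUnit N, hXt⟩
  · have := metric_self_eq_normalPart_add (k := k) hb hs hdet.ne'.isUnit N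
    linarith [hnonneg (tangentialPart g F p N)]
  · obtain ⟨B, hB⟩ := id hb
    rw [normalPart, hB, map_sub, ← hB, ← hB, hXN, hXt, sub_zero]

end NormalFrame

section EnergyForm

open Matrix

variable {M : Type*} [TopologicalSpace M] [ChartedSpace (𝔼 4) M]

theorem sum_mul_etaForm (o : ManifoldOrientation 4 M) (g : FormField 4 M) (x : M)
    (A : Matrix (Fin 4) (Fin 4) ℝ) (u v : TangentSpace (𝓡 4) x) :
    ∑ a, ∑ b, A a b * etaForm o g x x a b u v
      = o.sign x x * Real.sqrt (-(gram g x x).det)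
        * volContraction (A * (gram g x x)⁻¹) (comps x x u).ofLp (comps x x v).ofLp := by
  have heta : ∀ a b, etaForm o g x x a b u v = o.sign x x * Real.sqrt (-(gram g x x).det)
      * ∑ d, (gram g x x)⁻¹ b d * hodgeMatrix (comps x x u).ofLp (comps x x v).ofLp a d := by
    intro a b
    rw [etaForm, Finset.mul_sum, Finset.mul_sum]
    refine Finset.sum_congr rfl fun d _ => ?_
    simp only [mul_assoc, ← Finset.mul_sum]
    rw [sum_leviCivita_mul a d (comps x x u).ofLp (comps x x v).ofLp]
    ring
  rw [volContraction, ← Matrix.trace_transpose, transpose_mul, transpose_transpose,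
    Matrix.trace_mul_comm]
  simp only [heta, Matrix.trace, Matrix.diag_apply, Matrix.mul_apply, transpose_apply,
    Finset.mul_sum, Finset.sum_mul]
  refine Finset.sum_congr rfl fun a _ => ?_
  rw [Finset.sum_comm]
  exact Finset.sum_congr rfl fun d _ => Finset.sum_congr rfl fun b _ => by ring

theorem cntForm_eq_of_eq (o : ManifoldOrientation 4 M) {g g' : FormField 4 M} {x : M}
    (heq : g' x = g x) (N : ∀ x : M, TangentSpace (𝓡 4) x) (u v : TangentSpace (𝓡 4) x) :
    cntForm o g g' N x u v = o.sign x x * Real.sqrt (-(gram g x x).det) *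
      (-volContraction (connDiff g g' x u * (gram g x x)⁻¹)
          (comps x x (N x)).ofLp (comps x x v).ofLp
        + volContraction (connDiff g g' x v * (gram g x x)⁻¹)
          (comps x x (N x)).ofLp (comps x x u).ofLp) := by
  have heta : ∀ a b, etaForm o g' x x a b u v = etaForm o g x x a b u v := fun a b => by
    simp only [etaForm, gram_congr heq]
  rw [mul_add, mul_neg, ← sum_mul_etaForm, ← sum_mul_etaForm, cntForm]
  simp only [← Finset.sum_neg_distrib, ← Finset.sum_add_distrib]
  refine Finset.sum_congr rfl fun a _ => Finset.sum_congr rfl fun b _ => ?_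
  rw [heta, connDiff, connDiff, Matrix.of_apply, Matrix.of_apply]
  ring

end EnergyForm

section AdaptedFrame

open Matrix

variable {M : Type*} [TopologicalSpace M] [ChartedSpace (𝔼 4) M]
  {S : Type*} [TopologicalSpace S] [ChartedSpace (𝔼 2) S]

/-- The frame `ν, X, dF ∂₁, dF ∂₂` of the four-dimensional tangent space along a surface `F`, where
`∂₁, ∂₂` are the coordinate vectors of the chart of the surface centred at `s`. -/
def adaptedFrame (F : S → M) (s p : S) (ν X : TangentSpace (𝓡 4) (F p)) :
    Fin 4 → TangentSpace (𝓡 4) (F p) :=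
  ![ν, X, mfderiv (𝓡 2) (𝓡 4) F p (coordFrame s p 0), mfderiv (𝓡 2) (𝓡 4) F p (coordFrame s p 1)]

theorem IsNormalFrame.gram_adaptedFrame {g : FormField 4 M} {F : S → M} {p : S}
    {ν X : TangentSpace (𝓡 4) (F p)} (h : IsNormalFrame 2 g F p ν X)
    (hs : ∀ u v, g (F p) u v = g (F p) v u) (s : S) :
    (Matrix.of fun α β => g (F p) (adaptedFrame F s p ν X α) (adaptedFrame F s p ν X β))
      = adaptedGram (lnorm g ν) (gram (pullback (k := 2) F g) s p) := by
  have hνν : g (F p) ν ν = -lnorm g ν ^ 2 := by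
    rw [lnorm, Real.sq_sqrt (abs_nonneg _), abs_of_neg h.timelike, neg_neg]
  have hνX : g (F p) ν X = 0 := by rw [hs, h.orthogonal]
  have htν : ∀ v, g (F p) (mfderiv (𝓡 2) (𝓡 4) F p v) ν = 0 := fun v => by rw [hs, h.normal_left]
  have htX : ∀ v, g (F p) (mfderiv (𝓡 2) (𝓡 4) F p v) X = 0 := fun v => by rw [hs, h.normal_right]
  ext i j
  fin_cases i <;> fin_cases j <;>
    simp [adaptedFrame, adaptedGram, hνν, h.unit, h.orthogonal, hνX, h.normal_left, htν,
      h.normal_right, htX, gram, pullback]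

variable [IsManifold (𝓡 2) ∞ S]

theorem frameMatrix_adaptedFrame_mulVec (g : FormField 4 M) (F : S → M) {s p : S}
    (hp : p ∈ (chartAt (𝔼 2) s).source) (N X : TangentSpace (𝓡 4) (F p)) :
    frameMatrix (F p) (F p) (adaptedFrame F s p (normalPart 2 g F p N) X)
        *ᵥ ![1, 0, comps (n := 2) s p (tangentialPart g F p N) 0,
          comps (n := 2) s p (tangentialPart g F p N) 1]
      = (comps (F p) (F p) N).ofLp := by
  rw [frameMatrix_mulVec]
  congr 2
  conv_rhs => rw [← normalPart_add_tangentialPart (k := 2) g F N,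
    ← sum_comps_smul_coordFrame hp (tangentialPart g F p N)]
  simp [Fin.sum_univ_succ, adaptedFrame]

variable [IsManifold (𝓡 4) ∞ M]

theorem sign_mul_sign_mul_det_adaptedFrame_pos (o : ManifoldOrientation 2 S)
    (oM : ManifoldOrientation 4 M) {F : S → M} {s p : S} (hp : p ∈ (chartAt (𝔼 2) s).source)
    {ν X : TangentSpace (𝓡 4) (F p)}
    (hor : ∀ e : Fin 2 → TangentSpace (𝓡 2) p, IsPositiveFrame (o.at' p) e →
      IsPositiveFrame (oM.at' (F p))
        ![ν, X, mfderiv (𝓡 2) (𝓡 4) F p (e 0), mfderiv (𝓡 2) (𝓡 4) F p (e 1)]) :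
    0 < o.sign s p * (oM.sign (F p) (F p)
      * (frameMatrix (F p) (F p) (adaptedFrame F s p ν X)).det) := by
  have hx := mem_chart_source (𝔼 4) (F p)
  rw [ManifoldOrientation.sign]
  split_ifs with h
  · rw [one_mul]
    exact sign_mul_det_frameMatrix_pos oM hx (hor _ h)
  · have hpos := sign_mul_det_frameMatrix_pos oM hx (hor _ (isPositiveFrame_update_neg hp h))
    have hcol : frameMatrix (F p) (F p) ![ν, X,
        mfderiv (𝓡 2) (𝓡 4) F p (Function.update (coordFrame s p) 0 (-coordFrame s p 0) 0),
        mfderiv (𝓡 2) (𝓡 4) F p (Function.update (coordFrame s p) 0 (-coordFrame s p 0) 1)]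
        = (frameMatrix (F p) (F p) (adaptedFrame F s p ν X)).updateCol 2
          ((-1 : ℝ) • (frameMatrix (F p) (F p) (adaptedFrame F s p ν X)).col 2) := by
      ext a α
      fin_cases α <;> simp [frameMatrix, adaptedFrame]
    rw [hcol, det_updateCol_smul] at hpos
    have hself : (frameMatrix (F p) (F p) (adaptedFrame F s p ν X)).updateCol 2
        ((frameMatrix (F p) (F p) (adaptedFrame F s p ν X)).col 2) = _ := updateCol_eq_self _ _
    rw [hself] at hpos
    linarith

end AdaptedFrame

section DensityDifference

open Matrix

variable {k n : ℕ} {S : Type*} [TopologicalSpace S] [ChartedSpace (𝔼 k) S]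
  {M : Type*} [TopologicalSpace M] [ChartedSpace (𝔼 n) M]
  {g g' : FormField n M} {F : S → M} {X : ∀ q : S, TangentSpace (𝓡 n) (F q)} {s p : S}

theorem metric_covAlong_sub [IsManifold (𝓡 n) ∞ M] {m : ℕ} (hb : IsBilinAt g (F p))
    (hX : IsC1Along (k := k) F X p) {E : Fin m → TangentSpace (𝓡 n) (F p)} {α : Fin m}
    (hα : E α = X p) (β : Fin m) (v : TangentSpace (𝓡 k) p) :
    g (F p) (covAlong g' F X p v - covAlong g F X p v) (E β)
      = ((frameMatrix (F p) (F p) E)ᵀ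
        * (connDiff g g' (F p) (mfderiv (𝓡 k) (𝓡 n) F p v))ᵀ
        * gram g (F p) (F p) * frameMatrix (F p) (F p) E) α β := by
  rw [hb.eq_dotProduct_gram (mem_chart_source _ (F p)), comps_covAlong_sub hX, ← hα,
    ← transpose_mul, Matrix.mul_assoc]
  rfl

variable [IsManifold (𝓡 k) ∞ S]

theorem traceDensity_sub (hb : IsBilinAt g (F p)) (heq : g' (F p) = g (F p))
    (hp : p ∈ (chartAt (𝔼 k) s).source) (ν : TangentSpace (𝓡 n) (F p))
    (w : TangentSpace (𝓡 k) p) :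
    traceDensity g' F X p ν w - traceDensity g F X p ν w
      = lnorm g ν * metricTrace (pullback (k := k) F g) s p (fun u v =>
          g (F p) (covAlong g' F X p u - covAlong g F X p u) (mfderiv (𝓡 k) (𝓡 n) F p v))
        + 1 / lnorm g ν * ∑ i, comps s p w i
          * g (F p) (covAlong g' F X p (coordFrame s p i) - covAlong g F X p (coordFrame s p i))
            ν := by
  obtain ⟨B, hB⟩ := id hb
  let Δ := covAlongLinear (k := k) g' F X p - covAlongLinear g F X p
  have hchart := metricTrace_eq_of_charts hb.pullback (mem_chart_source _ p) hp
    (B.compl₁₂ Δ (mfderiv (𝓡 k) (𝓡 n) F p).toLinearMap)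
  have hw : B (Δ w) ν = ∑ i, comps s p w i * B (Δ (coordFrame s p i)) ν := by
    conv_lhs => rw [← sum_comps_smul_coordFrame hp w]
    simp only [map_sum, map_smul, LinearMap.sum_apply, LinearMap.smul_apply, smul_eq_mul]
  have hpull : pullback (k := k) F g' p = pullback F g p := by
    funext u v
    simp only [pullback, heq]
  have hlnorm : lnorm g' ν = lnorm g ν := by rw [lnorm, lnorm, heq]
  have hΔ : ∀ u, Δ u = covAlong g' F X p u - covAlong g F X p u := fun _ => rfl
  simp only [LinearMap.compl₁₂_apply, ContinuousLinearMap.coe_coe, hΔ] at hchart hw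
  simp only [traceDensity, metricTrace_congr hpull, hlnorm, heq, hB, ← hchart, ← hw]
  simp only [metricTrace, map_sub, LinearMap.sub_apply, mul_sub, Finset.sum_sub_distrib]
  ring

end DensityDifference

section EnergyDensity

open Matrix

variable {M : Type*} [TopologicalSpace M] [ChartedSpace (𝔼 4) M] [IsManifold (𝓡 4) ∞ M]
  {S : Type*} [TopologicalSpace S] [ChartedSpace (𝔼 2) S] [IsManifold (𝓡 2) ∞ S]
  {g g' : FormField 4 M} {F : S → M} {s p : S} {X : ∀ q : S, TangentSpace (𝓡 4) (F q)}

theorem volContraction_connDiff (hg : IsMetricAt g (F p)) (hg' : IsMetricAt g' (F p))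
    (hF : ContMDiffAt (𝓡 2) (𝓡 4) ∞ F p) (heq : ∀ᶠ q in 𝓝 p, g' (F q) = g (F q))
    (hp : p ∈ (chartAt (𝔼 2) s).source) (hdet : 0 < (gram (pullback (k := 2) F g) s p).det)
    (hX : IsC1Along (k := 2) F X p) {N : TangentSpace (𝓡 4) (F p)}
    (hn : IsNormalFrame 2 g F p (normalPart 2 g F p N) (X p)) :
    -volContraction
        (connDiff g g' (F p) (mfderiv (𝓡 2) (𝓡 4) F p (coordFrame s p 0)) * (gram g (F p) (F p))⁻¹)
        (comps (F p) (F p) N).ofLp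
        (comps (F p) (F p) (mfderiv (𝓡 2) (𝓡 4) F p (coordFrame s p 1))).ofLp
      + volContraction
        (connDiff g g' (F p) (mfderiv (𝓡 2) (𝓡 4) F p (coordFrame s p 1)) * (gram g (F p) (F p))⁻¹)
        (comps (F p) (F p) N).ofLp
        (comps (F p) (F p) (mfderiv (𝓡 2) (𝓡 4) F p (coordFrame s p 0))).ofLp
      = 2 * (frameMatrix (F p) (F p) (adaptedFrame F s p (normalPart 2 g F p N) (X p))).det
        / lnorm g (normalPart 2 g F p N)
        * (traceDensity (k := 2) g' F X p (normalPart 2 g F p N) (tangentialPart g F p N)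
          - traceDensity (k := 2) g F X p (normalPart 2 g F p N) (tangentialPart g F p N)) := by
  have hb := hg.bilin.self_of_nhds
  have hs := hg.symm.self_of_nhds
  rw [traceDensity_sub hb heq.self_of_nhds hp, ← frameMatrix_adaptedFrame_mulVec g F hp N (X p),
    metricTrace]
  set E := adaptedFrame F s p (normalPart 2 g F p N) (X p)
  have hcol : ∀ α, (comps (F p) (F p) (E α)).ofLp = frameMatrix (F p) (F p) E *ᵥ Pi.single α 1 :=
    fun α => by rw [mulVec_single_one]; rfl
  have hcol₁ : (comps (F p) (F p) (mfderiv (𝓡 2) (𝓡 4) F p (coordFrame s p 0))).ofLp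
    = frameMatrix (F p) (F p) E *ᵥ Pi.single 2 1 := hcol 2
  have hcol₂ : (comps (F p) (F p) (mfderiv (𝓡 2) (𝓡 4) F p (coordFrame s p 1))).ofLp
    = frameMatrix (F p) (F p) E *ᵥ Pi.single 3 1 := hcol 3
  have htangent : ∀ j, E (![2, 3] j) = mfderiv (𝓡 2) (𝓡 4) F p (coordFrame s p j) := fun j => by
    fin_cases j <;> rfl
  have hnormal : E 0 = normalPart 2 g F p N := rfl
  have hentry := fun i β => metric_covAlong_sub (g' := g') hb hX (E := E) (α := 1) rfl β
    (coordFrame (n := 2) s p i)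
  have key := volContraction_eq_trace (w := (comps s p (tangentialPart g F p N)).ofLp)
    (A := fun i => connDiff g g' (F p) (mfderiv (𝓡 2) (𝓡 4) F p (coordFrame (n := 2) s p i)))
    hn.lnorm_pos (gram_transpose (g := pullback F g) (fun _ _ => hs _ _) s) hdet
    (gram_transpose hs (F p))
    ((transpose_frameMatrix_mul_mul (mem_chart_source _ _) hb E).trans (hn.gram_adaptedFrame hs s))
    (fun i => connDiff_skewAdjoint hg hg' hF heq _)
  simp only [← hentry, htangent, hnormal] at key
  have hlnorm := hn.lnorm_pos.ne'
  rw [hcol₁, hcol₂]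
  refine key.trans ?_
  field_simp

theorem sign_mul_pullback_cntForm (o : ManifoldOrientation 2 S) (oM : ManifoldOrientation 4 M)
    (hg : IsMetricAt g (F p)) (hg' : IsMetricAt g' (F p)) (hF : ContMDiffAt (𝓡 2) (𝓡 4) ∞ F p)
    (heq : ∀ᶠ q in 𝓝 p, g' (F q) = g (F q)) (hp : p ∈ (chartAt (𝔼 2) s).source)
    (hdet : 0 < (gram (pullback (k := 2) F g) s p).det) (hX : IsC1Along (k := 2) F X p)
    {N : ∀ x : M, TangentSpace (𝓡 4) x}
    (hn : IsNormalFrame 2 g F p (normalPart 2 g F p (N (F p))) (X p))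
    (hor : ∀ e : Fin 2 → TangentSpace (𝓡 2) p, IsPositiveFrame (o.at' p) e →
      IsPositiveFrame (oM.at' (F p)) ![normalPart 2 g F p (N (F p)), X p,
        mfderiv (𝓡 2) (𝓡 4) F p (e 0), mfderiv (𝓡 2) (𝓡 4) F p (e 1)]) :
    o.sign s p * pullback F (cntForm oM g g' N) p (coordFrame (n := 2) s p 0) (coordFrame s p 1)
      = 2 * Real.sqrt (gram (pullback (k := 2) F g) s p).det
        * (traceDensity (k := 2) g' F X p (normalPart 2 g F p (N (F p)))
            (tangentialPart g F p (N (F p)))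
          - traceDensity (k := 2) g F X p (normalPart 2 g F p (N (F p)))
            (tangentialPart g F p (N (F p)))) := by
  have hframe := (transpose_frameMatrix_mul_mul (mem_chart_source _ (F p)) hg.bilin.self_of_nhds
    _).trans (hn.gram_adaptedFrame hg.symm.self_of_nhds s)
  have hvol := sqrt_neg_det_mul_det hn.lnorm_pos hframe (abs_sign oM (F p) (F p)) (abs_sign o s p)
    (sign_mul_sign_mul_det_adaptedFrame_pos o oM hp hor)
  have hlnorm := hn.lnorm_pos.ne'
  rw [pullback, cntForm_eq_of_eq oM heq.self_of_nhds, volContraction_connDiff hg hg' hF heq hp hdet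
    hX hn]
  calc _ = 2 / lnorm g (normalPart 2 g F p (N (F p))) * (o.sign s p
          * (oM.sign (F p) (F p) * Real.sqrt (-(gram g (F p) (F p)).det)
            * (frameMatrix (F p) (F p)
              (adaptedFrame F s p (normalPart 2 g F p (N (F p))) (X p))).det))
        * (traceDensity (k := 2) g' F X p (normalPart 2 g F p (N (F p)))
            (tangentialPart g F p (N (F p)))
          - traceDensity (k := 2) g F X p (normalPart 2 g F p (N (F p)))
            (tangentialPart g F p (N (F p)))) := by ring
    _ = _ := by
      rw [hvol]
      field_simp

end EnergyDensity

section TangentBundle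

variable {k n : ℕ} {S : Type*} [TopologicalSpace S] [ChartedSpace (𝔼 k) S]
  {M : Type*} [TopologicalSpace M] [ChartedSpace (𝔼 n) M] [IsManifold (𝓡 n) ∞ M]

theorem contMDiffAt_tangentBundle_iff {m : ℕ} {F : S → M} {Y : ∀ q : S, TangentSpace (𝓡 n) (F q)}
    {p : S} {c : M} (hc : F p ∈ (chartAt (𝔼 n) c).source) :
    ContMDiffAt (𝓡 k) (𝓡 n).tangent m (fun q => (⟨F q, Y q⟩ : TangentBundle (𝓡 n) M)) p ↔
      ContMDiffAt (𝓡 k) (𝓡 n) m F p ∧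
        ContMDiffAt (𝓡 k) 𝓘(ℝ, 𝔼 n) m (fun q => comps c (F q) (Y q)) p := by
  have : IsManifold (𝓡 n) (m + 1) M := IsManifold.of_le (n := ∞) (mod_cast le_top)
  have : IsManifold (𝓡 n) 1 M := IsManifold.of_le (n := ∞) (mod_cast le_top)
  have htriv := (trivializationAt (𝔼 n) (TangentSpace (𝓡 n)) c).contMDiffAt_iff (n := m)
    (IB := 𝓡 n) (IM := 𝓡 k) (f := fun q => (⟨F q, Y q⟩ : TangentBundle (𝓡 n) M)) (x₀ := p)
    ((Bundle.Trivialization.mem_source _).mpr hc)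
  refine htriv.trans (and_congr_right fun hF => EventuallyEq.contMDiffAt_iff ?_)
  filter_upwards [eventually_mem_chart_source hF.continuousAt hc] with q hq
  rw [comps, ← TangentBundle.continuousLinearMapAt_trivializationAt (I := 𝓡 n) hq,
    Bundle.Trivialization.continuousLinearMapAt_apply_of_mem]
  exact hq

theorem isC0Along_of_contMDiffAt {F : S → M} {Y : ∀ q : S, TangentSpace (𝓡 n) (F q)} {p : S}
    (h : ContMDiffAt (𝓡 k) (𝓡 n).tangent 0 (fun q => (⟨F q, Y q⟩ : TangentBundle (𝓡 n) M)) p) :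
    IsC0Along F Y p :=
  fun _ hc => ((contMDiffAt_tangentBundle_iff (m := 0) hc).mp h).2.continuousAt

theorem isC1Along_of_contMDiffAt {F : S → M} {Y : ∀ q : S, TangentSpace (𝓡 n) (F q)} {p : S}
    (h : ContMDiffAt (𝓡 k) (𝓡 n).tangent 1 (fun q => (⟨F q, Y q⟩ : TangentBundle (𝓡 n) M)) p) :
    IsC1Along (k := k) F Y p :=
  fun _ hc => ((contMDiffAt_tangentBundle_iff (m := 1) hc).mp h).2

theorem contMDiffAt_coordFrame {m : ℕ} {c x : M} (hx : x ∈ (chartAt (𝔼 n) c).source) (i : Fin n) :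
    ContMDiffAt (𝓡 n) (𝓡 n).tangent m
      (fun z => (⟨z, coordFrame c z i⟩ : TangentBundle (𝓡 n) M)) x := by
  refine (contMDiffAt_tangentBundle_iff (F := id) hx).mpr ⟨contMDiffAt_id, ?_⟩
  refine (contMDiffAt_const (c := EuclideanSpace.single i (1 : ℝ))).congr_of_eventuallyEq ?_
  filter_upwards [(chartAt (𝔼 n) c).open_source.mem_nhds hx] with z hz
  exact comps_coordFrame hz i

end TangentBundle

section SpacetimeMetric

variable {M : Type*} [TopologicalSpace M] [ChartedSpace (𝔼 4) M] [IsManifold (𝓡 4) ∞ M]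
  (𝓜 : Spacetime M)

theorem Spacetime.isBilinAt (x : M) : IsBilinAt 𝓜.g x :=
  ⟨LinearMap.mk₂ ℝ (fun u v => 𝓜.metric x u v) (fun _ _ _ => by simp) (fun _ _ _ => by simp)
    (fun _ _ _ => by simp) (fun _ _ _ => by simp), fun _ _ => rfl⟩

theorem Spacetime.eq_zero_of_forall {x : M} {u : TangentSpace (𝓡 4) x}
    (h : ∀ v, 𝓜.g x u v = 0) : u = 0 := by
  obtain ⟨b, hb⟩ := 𝓜.lorentzian x
  have hcoord : ∀ j, 𝓜.g x u (b j) = b.repr u j * if j = 0 then -1 else 1 := by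
    intro j
    conv_lhs => rw [Spacetime.g, ← b.sum_repr u]
    simp only [map_sum, map_smul, FunLike.coe_sum, Finset.sum_apply, FunLike.coe_smul,
      Pi.smul_apply, smul_eq_mul, hb, mul_ite, mul_zero, Finset.sum_ite_eq', Finset.mem_univ,
      if_true]
  refine b.ext_elem fun j => ?_
  have hzero := (hcoord j).symm.trans (h _)
  rw [map_zero, Finsupp.zero_apply]
  split_ifs at hzero <;> linarith

theorem Spacetime.isMetricAt (x : M) : IsMetricAt 𝓜.g x where
  bilin := Eventually.of_forall 𝓜.isBilinAt
  symm := Eventually.of_forall 𝓜.symm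
  nondeg _ := 𝓜.eq_zero_of_forall
  smooth c hx i j := by
    have h := ContMDiffAt.clm_bundle_apply₂ (F₁ := 𝔼 4) (F₂ := 𝔼 4) (F₃ := ℝ) (IB := 𝓡 4)
      (IM := 𝓡 4) (n := 1) (E₁ := fun x : M => TangentSpace (𝓡 4) x)
      (E₂ := fun x : M => TangentSpace (𝓡 4) x) (E₃ := fun _ : M => ℝ) (b := fun x : M => x)
      (ψ := fun x => 𝓜.metric x) (v := fun z => coordFrame c z i) (w := fun z => coordFrame c z j)
      (x := x) ((𝓜.smooth x).of_le (mod_cast le_top)) (contMDiffAt_coordFrame (m := 1) hx i)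
      (contMDiffAt_coordFrame (m := 1) hx j)
    have hgram : ContMDiffAt (𝓡 4) 𝓘(ℝ, ℝ) 1 (fun z => gram 𝓜.g c z i j) x :=
      (Bundle.contMDiffAt_totalSpace.mp h).2
    exact contDiffAt_comp_extChartAt_symm (mod_cast le_top) hx hgram

end SpacetimeMetric

section SurfaceIntegrals

variable {S : Type*} [TopologicalSpace S] [ChartedSpace (𝔼 2) S]

theorem extChartAt_symm_mem_chart_source {c : S} {y : 𝔼 2} (hy : y ∈ (extChartAt (𝓡 2) c).target) :
    (extChartAt (𝓡 2) c).symm y ∈ (chartAt (𝔼 2) c).source := by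
  rw [← extChartAt_source (𝓡 2) c]
  exact (extChartAt (𝓡 2) c).map_target hy

variable [IsManifold (𝓡 2) ∞ S] [T2Space S] [SigmaCompactSpace S]

/-- The integrand of `∫_S f dV_h` in the chart centred at `c`, cut off by the partition of unity. -/
def areaIntegrand (h : FormField 2 S) (f : S → ℝ) (c : S) (y : 𝔼 2) : ℝ :=
  chartPartition S c ((extChartAt (𝓡 2) c).symm y) * f ((extChartAt (𝓡 2) c).symm y)
    * Real.sqrt (gram h c ((extChartAt (𝓡 2) c).symm y)).det

theorem integralArea_eq_finsum (h : FormField 2 S) (f : S → ℝ) :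
    integralArea h f = ∑ᶠ c : S, ∫ y in (extChartAt (𝓡 2) c).target, areaIntegrand h f c y :=
  rfl

theorem integralArea_const_mul (h : FormField 2 S) (r : ℝ) (f : S → ℝ) :
    integralArea h (fun p => r * f p) = r * integralArea h f := by
  simp only [integralArea_eq_finsum, mul_finsum, ← integral_const_mul, areaIntegrand,
    mul_left_comm r, mul_assoc]

theorem integralForm_eq_integralArea {o : ManifoldOrientation 2 S} {α h : FormField 2 S}
    {f : S → ℝ}
    (hα : ∀ s p : S, p ∈ (chartAt (𝔼 2) s).source →
      o.sign s p * α p (coordFrame s p 0) (coordFrame s p 1)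
        = f p * Real.sqrt (gram h s p).det) :
    integralForm o α = integralArea h f := by
  refine finsum_congr fun c =>
    setIntegral_congr_fun (isOpen_extChartAt_target c).measurableSet fun y hy => ?_
  simp only [mul_assoc]
  rw [hα c _ (extChartAt_symm_mem_chart_source hy)]

variable [CompactSpace S]

theorem integrableOn_areaIntegrand {h : FormField 2 S} {f : S → ℝ} (hf : Continuous f) {c : S}
    (hh : ∀ p ∈ (chartAt (𝔼 2) c).source, ContinuousAt (gram h c) p) :
    IntegrableOn (areaIntegrand h f c) (extChartAt (𝓡 2) c).target := by
  set K := extChartAt (𝓡 2) c '' tsupport (chartPartition S c)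
  have hsub : tsupport (chartPartition S c) ⊆ (extChartAt (𝓡 2) c).source := by
    rw [extChartAt_source]
    exact chartPartition_isSubordinate S c
  have hKcompact : IsCompact K :=
    (isClosed_tsupport _).isCompact.image_of_continuousOn ((continuousOn_extChartAt c).mono hsub)
  have hKtarget : K ⊆ (extChartAt (𝓡 2) c).target :=
    image_subset_iff.mpr fun p hp => (extChartAt (𝓡 2) c).map_source (hsub hp)
  have hcont : ContinuousOn (areaIntegrand h f c) (extChartAt (𝓡 2) c).target := by
    have hsymm := continuousOn_extChartAt_symm (I := 𝓡 2) c
    have hdet : ContinuousOn (fun q => (gram h c q).det) (chartAt (𝔼 2) c).source := fun p hp =>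
      (continuous_id.matrix_det.continuousAt.comp (hh p hp)).continuousWithinAt
    exact (((chartPartition S c).contMDiff.continuous.comp_continuousOn hsymm).mul
      (hf.comp_continuousOn hsymm)).mul (Real.continuous_sqrt.comp_continuousOn
        (hdet.comp hsymm fun y hy => extChartAt_symm_mem_chart_source hy))
  refine ((hcont.mono hKtarget).integrableOn_compact hKcompact).of_forall_sdiff_eq_zero
    (isOpen_extChartAt_target c).measurableSet fun y hy => ?_
  have hρ : chartPartition S c ((extChartAt (𝓡 2) c).symm y) = 0 := by
    by_contra hne
    exact hy.2 ⟨_, subset_tsupport _ hne, (extChartAt (𝓡 2) c).right_inv hy.1⟩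
  rw [areaIntegrand, hρ, zero_mul, zero_mul]

theorem hasFiniteSupport_integral_areaIntegrand (h : FormField 2 S) (f : S → ℝ) :
    Function.HasFiniteSupport fun c : S =>
      ∫ y in (extChartAt (𝓡 2) c).target, areaIntegrand h f c y := by
  refine (chartPartition S).locallyFinite.finite_nonempty_of_compact.subset fun c hc => ?_
  contrapose! hc
  have hρ : ∀ p, chartPartition S c p = 0 := fun p =>
    Function.notMem_support.mp (not_nonempty_iff_eq_empty.mp hc ▸ notMem_empty p)
  simp [areaIntegrand, hρ]

theorem integralArea_sub {h : FormField 2 S} {f f' : S → ℝ} (hf : Continuous f)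
    (hf' : Continuous f')
    (hh : ∀ c, ∀ p ∈ (chartAt (𝔼 2) c).source, ContinuousAt (gram h c) p) :
    integralArea h (fun p => f p - f' p) = integralArea h f - integralArea h f' := by
  simp only [integralArea_eq_finsum]
  rw [← finsum_sub_distrib (hasFiniteSupport_integral_areaIntegrand h f)
    (hasFiniteSupport_integral_areaIntegrand h f')]
  refine finsum_congr fun c => ?_
  rw [← integral_sub (integrableOn_areaIntegrand hf (hh c)) (integrableOn_areaIntegrand hf' (hh c))]
  simp only [areaIntegrand, mul_sub, sub_mul]

end SurfaceIntegrals

section BoundaryDensity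

variable {M : Type*} [TopologicalSpace M] [ChartedSpace (𝔼 4) M] [IsManifold (𝓡 4) ∞ M]
  (𝓜 : Spacetime M) {S : Type*} [TopologicalSpace S] [ChartedSpace (𝔼 2) S]
  {F : S → M} {X : ∀ q : S, TangentSpace (𝓡 4) (F q)} {p : S}

theorem boundaryDensity_zero (ν : TangentSpace (𝓡 4) (F p)) :
    boundaryDensity 𝓜 F X p ν (0 : TangentSpace (𝓡 2) p)
      = -lnorm 𝓜.g ν * 𝓜.g (F p) (meanCurvature 2 𝓜.g F p) (X p) := by
  have hzero : covAlong 𝓜.g F X p (0 : TangentSpace (𝓡 2) p) = 0 :=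
    (covAlongLinear 𝓜.g F X p).map_zero
  obtain ⟨B, hB⟩ := 𝓜.isBilinAt (F p)
  rw [boundaryDensity, hzero, hB _ ν, map_zero, LinearMap.zero_apply, mul_zero, add_zero]

variable [IsManifold (𝓡 2) ∞ S]

theorem boundaryDensity_eq_traceDensity (hF : ContMDiffAt (𝓡 2) (𝓡 4) ∞ F p)
    (hX : IsC1Along (k := 2) F X p)
    (hn : ∀ q v, 𝓜.g (F q) (X q) (mfderiv (𝓡 2) (𝓡 4) F q v) = 0)
    (ν : TangentSpace (𝓡 4) (F p)) (w : TangentSpace (𝓡 2) p) :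
    boundaryDensity 𝓜 F X p ν w = traceDensity 𝓜.g F X p ν w := by
  rw [boundaryDensity, traceDensity, meanCurvature_eq_of_normal hF (𝓜.isMetricAt _) hX hn,
    neg_mul_neg]

theorem det_gram_pullback_pos {s : S} (hp : p ∈ (chartAt (𝔼 2) s).source)
    (hpos : ∀ v, v ≠ 0 → 0 < pullback (k := 2) F 𝓜.g p v v) :
    0 < (gram (pullback (k := 2) F 𝓜.g) s p).det :=
  (posDef_gram hp (𝓜.isBilinAt _).pullback (fun _ _ => 𝓜.symm _ _ _) hpos).det_pos

variable {N : ∀ q : S, TangentSpace (𝓡 4) (F q)}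

theorem continuous_boundaryDensity (hF : ContMDiff (𝓡 2) (𝓡 4) ∞ F)
    (hpos : ∀ p v, v ≠ 0 → 0 < pullback (k := 2) F 𝓜.g p v v) (hN : ∀ p, IsC0Along F N p)
    (hX : ∀ p, IsC1Along (k := 2) F X p)
    (hn : ∀ p, IsNormalFrame 2 𝓜.g F p (normalPart 2 𝓜.g F p (N p)) (X p)) :
    Continuous fun p => boundaryDensity 𝓜 F X p (normalPart 2 𝓜.g F p (N p))
      (tangentialPart 𝓜.g F p (N p)) := by
  simp only [boundaryDensity_eq_traceDensity 𝓜 (hF _) (hX _) fun q => (hn q).normal_right]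
  exact continuous_traceDensity hF (fun _ => 𝓜.isMetricAt _) (fun _ => 𝓜.isMetricAt _) rfl
    (fun p => (det_gram_pullback_pos 𝓜 (mem_chart_source _ p) (hpos p)).ne') hX hN
    fun p => (hn p).lnorm_pos.ne'

end BoundaryDensity

section TangentialPart

variable {k n : ℕ} {S : Type*} [TopologicalSpace S] [ChartedSpace (𝔼 k) S]
  {M : Type*} [TopologicalSpace M] [ChartedSpace (𝔼 n) M] {g : FormField n M} {F : S → M} {p : S}
  {N : TangentSpace (𝓡 n) (F p)}

theorem tangentialPart_eq_zero (hN : ∀ v, g (F p) N (mfderiv (𝓡 k) (𝓡 n) F p v) = 0) :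
    tangentialPart (k := k) g F p N = 0 := by
  simp [tangentialPart, hN]

theorem normalPart_eq_self (hN : ∀ v, g (F p) N (mfderiv (𝓡 k) (𝓡 n) F p v) = 0) :
    normalPart k g F p N = N := by
  rw [normalPart, tangentialPart_eq_zero hN, map_zero, sub_zero]

end TangentialPart

section Matching

variable {M : Type*} [TopologicalSpace M] [ChartedSpace (𝔼 4) M] [IsManifold (𝓡 4) ∞ M]
  {M' : Type*} [TopologicalSpace M'] [ChartedSpace (𝔼 4) M'] [IsManifold (𝓡 4) ∞ M']
  {S : Type*}

/-- `φ` is smooth at the points of the surface `ι` and isometric there on the four-dimensional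
tangent spaces. In contrast to a 4D isometric matching reference, such a `φ` may fail to be
injective or to preserve the orientation or the time-orientation. -/
structure IsMatchingAlong (𝓜 : Spacetime M) (𝓜' : Spacetime M') (ι : S → M) (φ : M → M') :
    Prop where
  contMDiffAt : ∀ p, ContMDiffAt (𝓡 4) (𝓡 4) ∞ φ (ι p)
  pullback_apply : ∀ p u v, pullback (k := 4) φ 𝓜'.g (ι p) u v = 𝓜.g (ι p) u v

variable {𝓜 : Spacetime M} {𝓜' : Spacetime M'} {ι : S → M} {φ : M → M'}

theorem IsIsometricMatching.isMatchingAlong {U : Set M}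
    (hφ : IsIsometricMatching 𝓜 𝓜' (range ι) U φ) : IsMatchingAlong 𝓜 𝓜' ι φ where
  contMDiffAt p := hφ.smooth.contMDiffAt (hφ.isOpen.mem_nhds (hφ.subset (mem_range_self p)))
  pullback_apply p := hφ.matching _ (mem_range_self p)

theorem IsMatchingAlong.pullback_eq (hφ : IsMatchingAlong 𝓜 𝓜' ι φ) (p : S) :
    pullback (k := 4) φ 𝓜'.g (ι p) = 𝓜.g (ι p) :=
  funext₂ (hφ.pullback_apply p)

theorem IsMatchingAlong.mdifferentiableAt (hφ : IsMatchingAlong 𝓜 𝓜' ι φ) (p : S) :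
    MDifferentiableAt (𝓡 4) (𝓡 4) φ (ι p) :=
  (hφ.contMDiffAt p).mdifferentiableAt (by simp)

theorem IsMatchingAlong.injective_mfderiv (hφ : IsMatchingAlong 𝓜 𝓜' ι φ) (p : S) :
    Function.Injective (mfderiv (𝓡 4) (𝓡 4) φ (ι p)) := by
  refine (injective_iff_map_eq_zero _).mpr fun u hu => 𝓜.eq_zero_of_forall fun v => ?_
  obtain ⟨B, hB⟩ := 𝓜'.isBilinAt (φ (ι p))
  rw [← hφ.pullback_apply, pullback, hu, hB, map_zero, LinearMap.zero_apply]

theorem IsMatchingAlong.isMetricAt_pullback (hφ : IsMatchingAlong 𝓜 𝓜' ι φ) (p : S) :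
    IsMetricAt (pullback (k := 4) φ 𝓜'.g) (ι p) :=
  (𝓜'.isMetricAt _).pullback (hφ.contMDiffAt p) (hφ.injective_mfderiv p)

theorem IsMatchingAlong.lnorm_mfderiv (hφ : IsMatchingAlong 𝓜 𝓜' ι φ) {p : S}
    (v : TangentSpace (𝓡 4) (ι p)) :
    lnorm 𝓜'.g (mfderiv (𝓡 4) (𝓡 4) φ (ι p) v) = lnorm 𝓜.g v :=
  congrArg (fun t => Real.sqrt |t|) (hφ.pullback_apply p v v)

variable [TopologicalSpace S] [ChartedSpace (𝔼 2) S]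

theorem IsMatchingAlong.pullback_comp_eq (hφ : IsMatchingAlong 𝓜 𝓜' ι φ)
    (hι : ContMDiff (𝓡 2) (𝓡 4) ∞ ι) :
    pullback (k := 2) (fun q => φ (ι q)) 𝓜'.g = pullback (k := 2) ι 𝓜.g := by
  funext p u v
  rw [pullback_comp (hφ.mdifferentiableAt p) ((hι p).mdifferentiableAt (by simp))]
  exact hφ.pullback_apply p _ _

variable [IsManifold (𝓡 2) ∞ S] {N X : ∀ q : S, TangentSpace (𝓡 4) (ι q)}

theorem IsMatchingAlong.boundaryDensity_map (hφ : IsMatchingAlong 𝓜 𝓜' ι φ)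
    (hι : ContMDiff (𝓡 2) (𝓡 4) ∞ ι) {p : S} (hX : IsC1Along (k := 2) ι X p)
    (hXt : ∀ q v, 𝓜.g (ι q) (X q) (mfderiv (𝓡 2) (𝓡 4) ι q v) = 0)
    (ν : TangentSpace (𝓡 4) (ι p)) (w : TangentSpace (𝓡 2) p) :
    boundaryDensity 𝓜' (fun q => φ (ι q)) (fun q => mfderiv (𝓡 4) (𝓡 4) φ (ι q) (X q)) p
        (mfderiv (𝓡 4) (𝓡 4) φ (ι p) ν) w
      = traceDensity (pullback (k := 4) φ 𝓜'.g) ι X p ν w := by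
  have hXt' : ∀ q v, 𝓜'.g (φ (ι q)) (mfderiv (𝓡 4) (𝓡 4) φ (ι q) (X q))
      (mfderiv (𝓡 2) (𝓡 4) (fun q => φ (ι q)) q v) = 0 := by
    intro q v
    have hchain : mfderiv (𝓡 2) (𝓡 4) (fun q => φ (ι q)) q v
        = mfderiv (𝓡 4) (𝓡 4) φ (ι q) (mfderiv (𝓡 2) (𝓡 4) ι q v) :=
      mfderiv_comp_apply q (hφ.mdifferentiableAt q) ((hι q).mdifferentiableAt (by simp)) v
    rw [hchain]
    exact (hφ.pullback_apply q _ _).trans (hXt q v)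
  rw [← traceDensity_pullback hX (hφ.contMDiffAt p) (hι p) (hφ.injective_mfderiv p)
    (𝓜'.isMetricAt _)]
  exact boundaryDensity_eq_traceDensity (F := fun q => φ (ι q)) 𝓜'
    ((hφ.contMDiffAt p).comp p (hι p)) (hX.mfderiv (hφ.contMDiffAt p) (hι p)) hXt' _ w

theorem IsMatchingAlong.continuous_boundaryDensity_map (hφ : IsMatchingAlong 𝓜 𝓜' ι φ)
    (hι : ContMDiff (𝓡 2) (𝓡 4) ∞ ι)
    (hpos : ∀ p v, v ≠ 0 → 0 < pullback (k := 2) ι 𝓜.g p v v) (hN : ∀ p, IsC0Along ι N p)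
    (hX : ∀ p, IsC1Along (k := 2) ι X p)
    (hn : ∀ p, IsNormalFrame 2 𝓜.g ι p (normalPart 2 𝓜.g ι p (N p)) (X p)) :
    Continuous fun p => boundaryDensity 𝓜' (fun q => φ (ι q))
      (fun q => mfderiv (𝓡 4) (𝓡 4) φ (ι q) (X q)) p
      (mfderiv (𝓡 4) (𝓡 4) φ (ι p) (normalPart 2 𝓜.g ι p (N p)))
      (tangentialPart 𝓜.g ι p (N p)) := by
  have hlnorm : ∀ p, lnorm (pullback (k := 4) φ 𝓜'.g) (normalPart 2 𝓜.g ι p (N p)) ≠ 0 := fun p =>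
    (hφ.lnorm_mfderiv _).trans_ne (hn p).lnorm_pos.ne'
  simp only [hφ.boundaryDensity_map hι (hX _) fun q => (hn q).normal_right]
  exact continuous_traceDensity hι (fun _ => 𝓜.isMetricAt _) hφ.isMetricAt_pullback
    (by funext p u v; exact hφ.pullback_apply p _ _)
    (fun p => (det_gram_pullback_pos 𝓜 (mem_chart_source _ p) (hpos p)).ne') hX hN hlnorm

variable [T2Space S] [SigmaCompactSpace S]

theorem IsMatchingAlong.energy_eq_integralArea (hφ : IsMatchingAlong 𝓜 𝓜' ι φ)
    (o : ManifoldOrientation 2 S) (hι : ContMDiff (𝓡 2) (𝓡 4) ∞ ι)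
    (hpos : ∀ p v, v ≠ 0 → 0 < pullback (k := 2) ι 𝓜.g p v v)
    (hX : ∀ p, IsC1Along (k := 2) ι X p)
    (hn : ∀ p, IsNormalFrame 2 𝓜.g ι p (normalPart 2 𝓜.g ι p (N p)) (X p))
    (hor : ∀ (p : S) (e : Fin 2 → TangentSpace (𝓡 2) p), IsPositiveFrame (o.at' p) e →
      IsPositiveFrame (𝓜.orientation.at' (ι p)) ![normalPart 2 𝓜.g ι p (N p), X p,
        mfderiv (𝓡 2) (𝓡 4) ι p (e 0), mfderiv (𝓡 2) (𝓡 4) ι p (e 1)])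
    {Next : ∀ x : M, TangentSpace (𝓡 4) x} (hNext : ∀ p, Next (ι p) = N p) :
    energy 𝓜 𝓜' o ι Next φ = 1 / (8 * Real.pi) * integralArea (pullback ι 𝓜.g) fun p =>
      boundaryDensity 𝓜' (fun q => φ (ι q)) (fun q => mfderiv (𝓡 4) (𝓡 4) φ (ι q) (X q)) p
          (mfderiv (𝓡 4) (𝓡 4) φ (ι p) (normalPart 2 𝓜.g ι p (N p)))
          (tangentialPart 𝓜.g ι p (N p))
        - boundaryDensity 𝓜 ι X p (normalPart 2 𝓜.g ι p (N p)) (tangentialPart 𝓜.g ι p (N p)) := by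
  obtain rfl : N = fun p => Next (ι p) := funext fun p => (hNext p).symm
  have hXt := fun q => (hn q).normal_right
  have hdensity := fun s p (hp : p ∈ (chartAt (𝔼 2) s).source) =>
    sign_mul_pullback_cntForm o 𝓜.orientation (𝓜.isMetricAt _) (hφ.isMetricAt_pullback p) (hι p)
      (Eventually.of_forall hφ.pullback_eq) hp (det_gram_pullback_pos 𝓜 hp (hpos p)) (hX p) (hn p)
      (hor p)
  simp only [hφ.boundaryDensity_map hι (hX _) hXt,
    boundaryDensity_eq_traceDensity 𝓜 (hι _) (hX _) hXt]
  rw [energy, integralForm_eq_integralArea (h := pullback ι 𝓜.g) fun s p hp =>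
    (hdensity s p hp).trans (mul_right_comm _ _ _), integralArea_const_mul]
  field_simp

end Matching

end CNT

end

theorem theorem1p1_general
    {M : Type*} [TopologicalSpace M] [ChartedSpace (EuclideanSpace ℝ (Fin 4)) M]
    [IsManifold (𝓡 4) ∞ M]
    {M' : Type*} [TopologicalSpace M'] [ChartedSpace (EuclideanSpace ℝ (Fin 4)) M']
    [IsManifold (𝓡 4) ∞ M']
    {S : Type*} [TopologicalSpace S] [T2Space S] [CompactSpace S]
    [ChartedSpace (EuclideanSpace ℝ (Fin 2)) S] [IsManifold (𝓡 2) ∞ S]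
    (𝓜 : CNT.Spacetime M) (𝓜' : CNT.Spacetime M') (o : CNT.ManifoldOrientation 2 S)
    (ι : S → M) (hι : ContMDiff (𝓡 2) (𝓡 4) ∞ ι)
    (hspacelike : ∀ (p : S) (v : TangentSpace (𝓡 2) p), v ≠ 0 →
      0 < CNT.pullback ι 𝓜.g p v v)
    (N : ∀ p : S, TangentSpace (𝓡 4) (ι p))
    (hN : ContMDiff (𝓡 2) (𝓡 4).tangent 0 (fun p => (⟨ι p, N p⟩ : TangentBundle (𝓡 4) M)))
    (hNtimelike : ∀ p : S, 𝓜.IsTimelike (N p))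
    (X : ∀ p : S, TangentSpace (𝓡 4) (ι p))
    (hX : ContMDiff (𝓡 2) (𝓡 4).tangent 1 (fun p => (⟨ι p, X p⟩ : TangentBundle (𝓡 4) M)))
    (hXunit : ∀ p : S, 𝓜.g (ι p) (X p) (X p) = 1)
    (hXnormal : ∀ (p : S) (v : TangentSpace (𝓡 2) p),
      𝓜.g (ι p) (X p) (mfderiv (𝓡 2) (𝓡 4) ι p v) = 0)
    (hXN : ∀ p : S, 𝓜.g (ι p) (X p) (N p) = 0)
    (hXor : ∀ (p : S) (e : Fin 2 → TangentSpace (𝓡 2) p),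
      CNT.IsPositiveFrame (o.at' p) e →
      CNT.IsPositiveFrame (𝓜.orientation.at' (ι p))
        ![CNT.normalPart 2 𝓜.g ι p (N p), X p,
          mfderiv (𝓡 2) (𝓡 4) ι p (e 0), mfderiv (𝓡 2) (𝓡 4) ι p (e 1)])
    (φ : M → M') (hφ : CNT.IsMatchingAlong 𝓜 𝓜' ι φ)
    (Next : ∀ x : M, TangentSpace (𝓡 4) x) (hNext : ∀ p : S, Next (ι p) = N p) :
    CNT.energy 𝓜 𝓜' o ι Next φ
      = 1 / (8 * Real.pi) * CNT.integralArea (CNT.pullback (fun q => φ (ι q)) 𝓜'.g)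
          (fun p => CNT.boundaryDensity 𝓜' (fun q => φ (ι q))
            (fun q => mfderiv (𝓡 4) (𝓡 4) φ (ι q) (X q)) p
            (mfderiv (𝓡 4) (𝓡 4) φ (ι p) (CNT.normalPart 2 𝓜.g ι p (N p)))
            (CNT.tangentialPart 𝓜.g ι p (N p)))
        - 1 / (8 * Real.pi) * CNT.integralArea (CNT.pullback ι 𝓜.g)
          (fun p => CNT.boundaryDensity 𝓜 ι X p
            (CNT.normalPart 2 𝓜.g ι p (N p)) (CNT.tangentialPart 𝓜.g ι p (N p)))
    ∧ ((∀ (p : S) (v : TangentSpace (𝓡 2) p),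
          𝓜.g (ι p) (N p) (mfderiv (𝓡 2) (𝓡 4) ι p v) = 0) →
        CNT.energy 𝓜 𝓜' o ι Next φ
          = 1 / (8 * Real.pi) * CNT.integralArea (CNT.pullback ι 𝓜.g)
            (fun p => CNT.lnorm 𝓜.g (N p) *
              (-𝓜'.g (φ (ι p)) (CNT.meanCurvature 2 𝓜'.g (fun q => φ (ι q)) p)
                  (mfderiv (𝓡 4) (𝓡 4) φ (ι p) (X p))
                + 𝓜.g (ι p) (CNT.meanCurvature 2 𝓜.g ι p) (X p)))) := by
  have hNC := fun p => CNT.isC0Along_of_contMDiffAt (hN p)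
  have hXC := fun p => CNT.isC1Along_of_contMDiffAt (hX p)
  have hframe := fun p => CNT.isNormalFrame_normalPart (𝓜.isBilinAt _) (𝓜.symm _) (hspacelike p)
    (hNtimelike p) (hXunit p) (hXnormal p) (hXN p)
  have henergy := hφ.energy_eq_integralArea o hι hspacelike hXC hframe hXor hNext
  refine ⟨?_, fun hNnormal => ?_⟩
  · rw [henergy, CNT.integralArea_sub
      (hφ.continuous_boundaryDensity_map hι hspacelike hNC hXC hframe)
      (CNT.continuous_boundaryDensity 𝓜 hι hspacelike hNC hXC hframe)
      fun _ _ => CNT.continuousAt_gram_pullback hι (𝓜.isMetricAt _),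
      hφ.pullback_comp_eq hι, mul_sub]
  · rw [henergy]
    congr 2 with p
    rw [CNT.normalPart_eq_self (hNnormal p), CNT.tangentialPart_eq_zero (hNnormal p),
      CNT.boundaryDensity_zero, CNT.boundaryDensity_zero, hφ.lnorm_mfderiv]
    ring

theorem theorem1p1
    {M : Type*} [TopologicalSpace M] [T2Space M] [SecondCountableTopology M]
    [ChartedSpace (EuclideanSpace ℝ (Fin 4)) M] [IsManifold (𝓡 4) ∞ M]
    {M' : Type*} [TopologicalSpace M'] [T2Space M'] [SecondCountableTopology M']
    [ChartedSpace (EuclideanSpace ℝ (Fin 4)) M'] [IsManifold (𝓡 4) ∞ M']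
    {S : Type*} [TopologicalSpace S] [T2Space S] [CompactSpace S]
    [ChartedSpace (EuclideanSpace ℝ (Fin 2)) S] [IsManifold (𝓡 2) ∞ S]
    -- the physical and the reference spacetime, the oriented closed spacelike surface `ι : S → M`
    (𝓜 : CNT.Spacetime M) (𝓜' : CNT.Spacetime M') (o : CNT.ManifoldOrientation 2 S)
    (ι : S → M) (hι : Manifold.IsSmoothEmbedding (𝓡 2) (𝓡 4) ∞ ι)
    (hspacelike : ∀ (p : S) (v : TangentSpace (𝓡 2) p), v ≠ 0 →
      0 < CNT.pullback ι 𝓜.g p v v)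
    -- the future-directed timelike vector field `N` on the surface
    (N : ∀ p : S, TangentSpace (𝓡 4) (ι p))
    (hN : ContMDiff (𝓡 2) (𝓡 4).tangent ∞ (fun p => (⟨ι p, N p⟩ : TangentBundle (𝓡 4) M)))
    (hNfuture : ∀ p : S, 𝓜.IsFutureTimelike (N p))
    -- the unit normal vector field `X`, orthogonal to `N`, with `(N^⊥, X, S)` positively oriented
    (X : ∀ p : S, TangentSpace (𝓡 4) (ι p))
    (hX : ContMDiff (𝓡 2) (𝓡 4).tangent ∞ (fun p => (⟨ι p, X p⟩ : TangentBundle (𝓡 4) M)))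
    (hXunit : ∀ p : S, 𝓜.g (ι p) (X p) (X p) = 1)
    (hXnormal : ∀ (p : S) (v : TangentSpace (𝓡 2) p),
      𝓜.g (ι p) (X p) (mfderiv (𝓡 2) (𝓡 4) ι p v) = 0)
    (hXN : ∀ p : S, 𝓜.g (ι p) (X p) (N p) = 0)
    (hXor : ∀ (p : S) (e : Fin 2 → TangentSpace (𝓡 2) p),
      CNT.IsPositiveFrame (o.at' p) e →
      CNT.IsPositiveFrame (𝓜.orientation.at' (ι p))
        ![CNT.normalPart 2 𝓜.g ι p (N p), X p,
          mfderiv (𝓡 2) (𝓡 4) ι p (e 0), mfderiv (𝓡 2) (𝓡 4) ι p (e 1)])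
    -- the 4D isometric matching reference `φ`, defined on the neighbourhood `U` of the surface
    (U : Set M) (φ : M → M') (hφ : CNT.IsIsometricMatching 𝓜 𝓜' (Set.range ι) U φ)
    -- any extension of `N`, used to form `D̄_b N^a` in the definition of the energy
    (Next : ∀ x : M, TangentSpace (𝓡 4) x) (hNext : ∀ p : S, Next (ι p) = N p) :
    CNT.energy 𝓜 𝓜' o ι Next φ
      = 1 / (8 * Real.pi) * CNT.integralArea (CNT.pullback (fun q => φ (ι q)) 𝓜'.g)
          (fun p => CNT.boundaryDensity 𝓜' (fun q => φ (ι q))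
            (fun q => mfderiv (𝓡 4) (𝓡 4) φ (ι q) (X q)) p
            (mfderiv (𝓡 4) (𝓡 4) φ (ι p) (CNT.normalPart 2 𝓜.g ι p (N p)))
            (CNT.tangentialPart 𝓜.g ι p (N p)))
        - 1 / (8 * Real.pi) * CNT.integralArea (CNT.pullback ι 𝓜.g)
          (fun p => CNT.boundaryDensity 𝓜 ι X p
            (CNT.normalPart 2 𝓜.g ι p (N p)) (CNT.tangentialPart 𝓜.g ι p (N p)))
    ∧ ((∀ (p : S) (v : TangentSpace (𝓡 2) p),
          𝓜.g (ι p) (N p) (mfderiv (𝓡 2) (𝓡 4) ι p v) = 0) →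
        CNT.energy 𝓜 𝓜' o ι Next φ
          = 1 / (8 * Real.pi) * CNT.integralArea (CNT.pullback ι 𝓜.g)
            (fun p => CNT.lnorm 𝓜.g (N p) *
              (-𝓜'.g (φ (ι p)) (CNT.meanCurvature 2 𝓜'.g (fun q => φ (ι q)) p)
                  (mfderiv (𝓡 4) (𝓡 4) φ (ι p) (X p))
                + 𝓜.g (ι p) (CNT.meanCurvature 2 𝓜.g ι p) (X p)))) :=
  theorem1p1_general 𝓜 𝓜' o ι hι.contMDiff hspacelike N (hN.of_le (mod_cast le_top))
    (fun p => (hNfuture p).1) X (hX.of_le (mod_cast le_top)) hXunit hXnormal hXN hXor φ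
    hφ.isMatchingAlong Next hNext
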